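/- **Setting.** Let $q>0$ be a real number with $q\neq 1$, and $[x]_q=\frac{q^x-q^{-x}}{q-q^{-1}}$. *The Hopf $*$-algebra.* $\mathcal U=\mathcal U_q(\mathrm{su}_2)$ is the complex algebra with generators $E,F,K,K^{-1}$ and relations $KK^{-1}=K^{-1}K=1$, $KE=qEK$, $FK=qKF$, $EF-FE=\frac{K^2-K^{-2}}{q-q^{-1}}$, with $E^*=F$, $K^*=K$, $\Delta(E)=E\otimes K+K^{-1}\otimes E$, $\Delta(F)=F\otimes K+K^{-1}\otimes F$, $\Delta(K)=K\otimes K$, $\varepsilon(E)=\varepsilon(F)=0$, $\varepsilon(K)=1$, $S(E)=-qE$, $S(F)=-q^{-1}F$, $S(K)=K^{-1}$. *The quantum sphere.* $\mathcal O(\mathrm{SU}_q(2))$ is the complex $*$-algebra generated by $a,b,c,d$ with $ab=q\,ba$, $ac=q\,ca$, $bd=q\,db$, $cd=q\,dc$, $bc=cb$, $ad=1+q\,bc$, $da=1+q^{-1}bc$, $a^*=d$, $b^*=-qc$; its counit is given by $\varepsilon(a)=\varepsilon(d)=1$, $\varepsilon(b)=\varepsilon(c)=0$. It is a left $\mathcal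 U$-module $*$-algebra (so $f\triangleright(xy)=(f_{(1)}\triangleright x)(f_{(2)}\triangleright y)$ and $f\triangleright 1=\varepsilon(f)1$) with $E\triangleright a=b$, $E\triangleright c=d$, $E\triangleright b=E\triangleright d=0$, $F\triangleright b=a$, $F\triangleright d=c$, $F\triangleright a=F\triangleright c=0$, $K\triangleright a=q^{-1/2}a$, $K\triangleright c=q^{-1/2}c$, $K\triangleright b=q^{1/2}b$, $K\triangleright d=q^{1/2}d$. Let $\partial_{K^2}$ be the automorphism with $a\mapsto qa$, $b\mapsto qb$, $c\mapsto q^{-1}c$, $d\mapsto q^{-1}d$. The standard Podleś sphere is the $*$-subalgebra and $\mathcal U$-submodule $\mathcal B=\mathcal O(\mathrm S_q^2)=\{x:\partial_{K^2}(x)=x\}$. The map $\theta^{-1}(x)=K^2\triangleright x$ is an automorphism of $\mathcal B$ (the inverse of the modular automorphism $\theta$ of the Haar state). *Equivariant $K_0$.* For a matrix $X$ over $\mathcal B$ let $X^\dagger=\theta^{-1}(X)^*$. Let $\rho^\circ:\mathcal U^\circ\to \mathrm M_n(\mathbb C)$ be a $*$-representation of the opposite algebra. Put $\mathrm{ad}_R^\circ(f)(X)=\rho^\circ(S^{-1}(f_{(1)}))\,(S^{-2}(f_{(2)})\triangleright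 X)\,\rho^\circ(f_{(3)})$ for $X\in\mathrm M_n(\mathcal B)$ and $\pi^\circ(f)(v\otimes x)=\rho^\circ(f_{(2)})v\otimes S^{-1}(f_{(1)})\triangleright x$ on $\mathbb C^n\otimes\mathcal B$. An invariant projection (relative to $\rho^\circ$) is a $P\in \mathrm M_n(\mathcal B)$ with $P^2=P=P^\dagger$ and $\mathrm{ad}_R^\circ(f)(P)=\varepsilon(f)P$ for all $f\in\mathcal U$. Invariant projections $P$ (with $\rho_1^\circ$, of size $n$) and $Q$ (with $\rho_2^\circ$, of size $m$) are Murray–von Neumann equivalent if there is $V\in \mathrm M_{m\times n}(\mathcal B)$ with $V^\dagger V=P$, $VV^\dagger=Q$ and $\pi_2^\circ(f)V=V\pi_1^\circ(f)$ for all $f\in\mathcal U$. $K_0^{\mathcal U}(\mathcal B)$ is the Grothendieck group of the semigroup of equivalence classes with $[P]+[Q]=[P\oplus Q]$ (with the direct sum representation). *Twisted (co)homology.* For a unital complex algebra $A$ with automorphism $\lambda$ let $C_n=A^{\otimes(n+1)}$, $\tau_n(a_0\otimes\cdots\otimes a_n)=\lambda(a_n)\otimes a_0\otimes\cdots\otimes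 a_{n-1}$, and $$b_n(a_0\otimes\cdots\otimes a_n)=\sum_{i=0}^{n-1}(-1)^i a_0\otimes\cdots\otimes a_ia_{i+1}\otimes\cdots\otimes a_n+(-1)^n\lambda(a_n)a_0\otimes a_1\otimes\cdots\otimes a_{n-1}.$$ $\mathrm{HH}_n^\lambda(A)$ is the homology of $(C_n/\mathrm{im}(\mathrm{id}-\tau_n^{n+1}),b_n)$. A twisted cyclic 2-cocycle is a linear form $\Phi$ on $C_2$ with $\Phi=\Phi\circ\tau_2$ and $\Phi\circ b_3=0$; $\mathrm{HC}^2_\lambda(A)$ is the space of these modulo the forms $\psi\circ b_2$, where $\psi$ is a linear form on $C_1$ with $\psi=-\psi\circ\tau_1$. *The pairing.* There is a well-defined pairing $\langle\cdot,\cdot\rangle:\mathrm{HC}^2_{\theta^{-1}}(\mathcal B)\times K_0^{\mathcal U}(\mathcal B)\to\mathbb C$, linear in the first and additive in the second argument, given for an invariant projection $P$ (relative to $\rho^\circ$) by $$\langle[\Phi],[P]\rangle=-2\sum_{j_0,j_1,j_2,j_3}\rho^\circ(K^2)_{j_3j_0}\,\Phi(P_{j_0j_1}\otimes P_{j_1j_2}\otimes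 P_{j_2j_3}).$$ *The line bundles.* Let $N\in\mathbb Z$, $l=|N|/2$, and let $\mathbf t=(t_{-l},t_{-l+1},\dots,t_l)$ be the row vector $(t^l_{N/2,-l},\dots,t^l_{N/2,l})$ of matrix elements of the spin-$l$ corepresentation, i.e. with $\beta_k=\Big(q^{-(l+k)(l-k)}\frac{[2l]_q!}{[l+k]_q!\,[l-k]_q!}\Big)^{1/2}$, $t_k=\beta_k\, c^{\,l-k}d^{\,l+k}$ if $N\ge0$ and $t_k=\beta_k\,a^{\,l-k}b^{\,l+k}$ if $N<0$. Let $\sigma_l$ be the spin-$l$ representation of $\mathcal U$ on $\mathbb C^{2l+1}$ with basis $e_{-l},\dots,e_l$: $Ee_k=([l-k]_q[l+k+1]_q)^{1/2}e_{k+1}$, $Fe_k=([l-k+1]_q[l+k]_q)^{1/2}e_{k-1}$, $Ke_k=q^ke_k$; and $\rho_l^\circ(f)=\sigma_l(K^{-1}S(f)K)$. Put $P_N=\rho_l^\circ(K^{-1})\,\mathbf t^*\mathbf t\,\rho_l^\circ(K)\in \mathrm M_{|N|+1}(\mathcal B)$. *The cocycle.* Let $\varphi(a_0\otimes a_1\otimes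 a_2)=q\,\varepsilon\big(a_0\,(K^{-1}E\triangleright a_1)\,(K^{-1}F\triangleright a_2)\big)$ for $a_0,a_1,a_2\in\mathcal B$. For a linear form $\chi$ on $\mathcal B\otimes\mathcal B$ let $\phi_\chi=\varphi+\chi\circ b_2$ (with $\lambda=\theta^{-1}$), and call $\chi$ normalizing if $\phi_\chi(1\otimes a_1\otimes a_2)=0$ for all $a_1,a_2\in\mathcal B$. **Proposition.** Normalizing $\chi$ exist. For every normalizing $\chi$, Krähmer's cocycle $\phi=\phi_\chi$ is a $\theta^{-1}$-twisted cyclic 2-cocycle on $\mathcal B$, the functional on $\mathrm{HH}_2^{\theta^{-1}}(\mathcal B)$ induced by $\phi$ is non-zero, and for every $N\in\mathbb Z$ the matrix $P_N$ is an invariant projection relative to the $*$-representation $\rho^\circ_{|N|/2}$ and $$\langle[\phi],[P_N]\rangle=[N]_q .$$ -/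

import Mathlib

open scoped TensorProduct
open MulOpposite (op unop)

namespace Podles

noncomputable section

set_option linter.all false

/-- The deformation parameter: a positive real number different from one. -/
abbrev QParam : Type := {q : ℝ // 0 < q ∧ q ≠ 1}

/-- The parameter as a complex number. -/
def qc (q : QParam) : ℂ := ((q : ℝ) : ℂ)

/-- The positive square root of the parameter as a complex number. -/
def qs (q : QParam) : ℂ := ((Real.sqrt (q : ℝ) : ℝ) : ℂ)

/-- The `q`-number `[n]_q = (q ^ n - q ^ (-n)) / (q - q⁻¹)`. -/
def qInt (q : QParam) (n : ℤ) : ℝ :=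
  ((q : ℝ) ^ n - (q : ℝ) ^ (-n)) / ((q : ℝ) - (q : ℝ)⁻¹)

theorem qc_ne_zero (q : QParam) : qc q ≠ 0 :=
  Complex.ofReal_ne_zero.mpr q.2.1.ne'

theorem qs_ne_zero (q : QParam) : qs q ≠ 0 :=
  Complex.ofReal_ne_zero.mpr (Real.sqrt_pos.mpr q.2.1).ne'

theorem qs_mul_qs (q : QParam) : qs q * qs q = qc q := by
  rw [qs, qc, ← Complex.ofReal_mul, Real.mul_self_sqrt q.2.1.le]

theorem real_sub_inv_ne_zero (q : QParam) : (q : ℝ) - (q : ℝ)⁻¹ ≠ 0 := by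
  obtain ⟨q, h0, h1⟩ := q
  simp only
  intro h
  have h2 : q * q = 1 := by
    field_simp at h
    nlinarith
  have h3 : (q - 1) * (q + 1) = 0 := by ring_nf; linarith
  rcases mul_eq_zero.mp h3 with h | h
  · exact h1 (by linarith)
  · linarith

theorem qc_sub_inv_ne_zero (q : QParam) : qc q - (qc q)⁻¹ ≠ 0 := by
  have := real_sub_inv_ne_zero q
  rw [qc, ← Complex.ofReal_inv, ← Complex.ofReal_sub]
  exact Complex.ofReal_ne_zero.mpr this

theorem conj_qc (q : QParam) : (starRingEnd ℂ) (qc q) = qc q := Complex.conj_ofReal _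

/-! ### Conjugate-linear anti-homomorphisms on free algebras -/

/-- The conjugate-linear anti-homomorphism on a free algebra with prescribed values on the
generators, written as a ring homomorphism to the opposite ring. -/
def conjLift {X A : Type*} [Ring A] [Algebra ℂ A] (g : X → A) : FreeAlgebra ℂ X →+* Aᵐᵒᵖ :=
  letI : Algebra ℂ Aᵐᵒᵖ :=
    ((algebraMap ℂ Aᵐᵒᵖ).comp (starRingEnd ℂ)).toAlgebra' fun r x =>
      Algebra.commutes (starRingEnd ℂ r) x
  (FreeAlgebra.lift ℂ (fun x => op (g x))).toRingHom

theorem conjLift_ι {X A : Type*} [Ring A] [Algebra ℂ A] (g : X → A) (x : X) :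
    conjLift g (FreeAlgebra.ι ℂ x) = op (g x) := by
  let _inst : Algebra ℂ Aᵐᵒᵖ :=
    ((algebraMap ℂ Aᵐᵒᵖ).comp (starRingEnd ℂ)).toAlgebra' fun r x =>
      Algebra.commutes (starRingEnd ℂ r) x
  exact FreeAlgebra.lift_ι_apply (R := ℂ) (fun x => op (g x)) x

theorem conjLift_algebraMap {X A : Type*} [Ring A] [Algebra ℂ A] (g : X → A) (r : ℂ) :
    conjLift g (algebraMap ℂ _ r) = op (algebraMap ℂ A (starRingEnd ℂ r)) := by
  let _inst : Algebra ℂ Aᵐᵒᵖ :=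
    ((algebraMap ℂ Aᵐᵒᵖ).comp (starRingEnd ℂ)).toAlgebra' fun r x =>
      Algebra.commutes (starRingEnd ℂ r) x
  exact (FreeAlgebra.lift ℂ (fun x => op (g x))).commutes r

theorem conjLift_smul {X A : Type*} [Ring A] [Algebra ℂ A] (g : X → A) (r : ℂ)
    (x : FreeAlgebra ℂ X) :
    conjLift g (r • x) = (starRingEnd ℂ r) • conjLift g x := by
  rw [Algebra.smul_def, map_mul, conjLift_algebraMap, Algebra.smul_def]
  rfl

theorem ringQuot_lift_mkAlgHom {A T : Type*} [Ring A] [Algebra ℂ A] [Ring T]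
    {r : A → A → Prop} (f : A →+* T) (w : ∀ ⦃x y⦄, r x y → f x = f y) (x : A) :
    RingQuot.lift ⟨f, w⟩ (RingQuot.mkAlgHom ℂ r x) = f x := by
  have h : RingQuot.mkAlgHom ℂ r x = RingQuot.mkRingHom r x := by
    rw [← RingQuot.mkAlgHom_coe ℂ r]
    rfl
  rw [h, RingQuot.lift_mkRingHom_apply]

/-! ### The Hopf *-algebra `U_q(su_2)` -/

/-- Generators of `U_q(su_2)`; `Ki` is the inverse of `K`. -/
inductive UGen : Type
  | E | F | K | Ki

open FreeAlgebra in
/-- Defining relations of `U_q(su_2)`. -/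
inductive URel (q : QParam) : FreeAlgebra ℂ UGen → FreeAlgebra ℂ UGen → Prop
  | K_Ki : URel q (ι ℂ .K * ι ℂ .Ki) 1
  | Ki_K : URel q (ι ℂ .Ki * ι ℂ .K) 1
  | KE : URel q (ι ℂ .K * ι ℂ .E) (qc q • (ι ℂ .E * ι ℂ .K))
  | FK : URel q (ι ℂ .F * ι ℂ .K) (qc q • (ι ℂ .K * ι ℂ .F))
  | EF : URel q (ι ℂ .E * ι ℂ .F - ι ℂ .F * ι ℂ .E)
      ((qc q - (qc q)⁻¹)⁻¹ • (ι ℂ .K * ι ℂ .K - ι ℂ .Ki * ι ℂ .Ki))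

/-- The algebra `U_q(su_2)`. -/
def U (q : QParam) : Type := RingQuot (URel q)

instance instRingU (q : QParam) : Ring (U q) := inferInstanceAs (Ring (RingQuot (URel q)))

instance instAlgebraU (q : QParam) : Algebra ℂ (U q) :=
  inferInstanceAs (Algebra ℂ (RingQuot (URel q)))

/-- The quotient map. -/
def uMk (q : QParam) : FreeAlgebra ℂ UGen →ₐ[ℂ] U q := RingQuot.mkAlgHom ℂ (URel q)

theorem uMk_rel (q : QParam) {x y : FreeAlgebra ℂ UGen} (h : URel q x y) : uMk q x = uMk q y :=
  RingQuot.mkAlgHom_rel ℂ h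

/-- The generators as elements of `U_q(su_2)`. -/
def uGen (q : QParam) (x : UGen) : U q := uMk q (FreeAlgebra.ι ℂ x)

abbrev uE (q : QParam) : U q := uGen q .E
abbrev uF (q : QParam) : U q := uGen q .F
abbrev uK (q : QParam) : U q := uGen q .K
abbrev uKi (q : QParam) : U q := uGen q .Ki

theorem uK_Ki (q : QParam) : uK q * uKi q = 1 := by
  simpa [uGen] using uMk_rel q (URel.K_Ki (q := q))

theorem uKi_K (q : QParam) : uKi q * uK q = 1 := by
  simpa [uGen] using uMk_rel q (URel.Ki_K (q := q))

theorem uKE (q : QParam) : uK q * uE q = qc q • (uE q * uK q) := by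
  simpa [uGen] using uMk_rel q (URel.KE (q := q))

theorem uFK (q : QParam) : uF q * uK q = qc q • (uK q * uF q) := by
  simpa [uGen] using uMk_rel q (URel.FK (q := q))

theorem uEF (q : QParam) : uE q * uF q - uF q * uE q =
    (qc q - (qc q)⁻¹)⁻¹ • (uK q * uK q - uKi q * uKi q) := by
  simpa [uGen] using uMk_rel q (URel.EF (q := q))

theorem uEKi (q : QParam) : uE q * uKi q = qc q • (uKi q * uE q) := by
  have h := congrArg (fun x => uKi q * x * uKi q) (uKE q)
  simp only [mul_smul_comm, smul_mul_assoc] at h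
  rw [← mul_assoc, uKi_K, one_mul, mul_assoc, mul_assoc (uE q), uK_Ki, mul_one] at h
  exact h

theorem uKiF (q : QParam) : uKi q * uF q = qc q • (uF q * uKi q) := by
  have h := congrArg (fun x => uKi q * x * uKi q) (uFK q)
  simp only [mul_smul_comm, smul_mul_assoc] at h
  rw [← mul_assoc (uKi q) (uK q), uKi_K, one_mul, mul_assoc, mul_assoc, uK_Ki, mul_one] at h
  exact h

/-- Homomorphisms out of `U_q(su_2)`, given by the images of the generators. -/
def uLift (q : QParam) {A : Type*} [Ring A] [Algebra ℂ A] (g : UGen → A)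
    (h₁ : g .K * g .Ki = 1) (h₂ : g .Ki * g .K = 1)
    (h₃ : g .K * g .E = qc q • (g .E * g .K)) (h₄ : g .F * g .K = qc q • (g .K * g .F))
    (h₅ : g .E * g .F - g .F * g .E =
      (qc q - (qc q)⁻¹)⁻¹ • (g .K * g .K - g .Ki * g .Ki)) : U q →ₐ[ℂ] A :=
  RingQuot.liftAlgHom ℂ ⟨FreeAlgebra.lift ℂ g, by
    intro x y h
    cases h <;> simpa [FreeAlgebra.lift_ι_apply]⟩

theorem uLift_gen (q : QParam) {A : Type*} [Ring A] [Algebra ℂ A] (g : UGen → A)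
    (h₁ h₂ h₃ h₄ h₅) (x : UGen) : uLift q g h₁ h₂ h₃ h₄ h₅ (uGen q x) = g x := by
  rw [uGen, uMk, uLift]
  exact (RingQuot.liftAlgHom_mkAlgHom_apply ℂ _ _ _).trans (FreeAlgebra.lift_ι_apply _ _)

/-- The comultiplication: `Δ(E) = E ⊗ K + K⁻¹ ⊗ E`, `Δ(F) = F ⊗ K + K⁻¹ ⊗ F`,
`Δ(K) = K ⊗ K`. -/
def uComul (q : QParam) : U q →ₐ[ℂ] U q ⊗[ℂ] U q :=
  uLift q
    (fun
      | .E => uE q ⊗ₜ uK q + uKi q ⊗ₜ uE q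
      | .F => uF q ⊗ₜ uK q + uKi q ⊗ₜ uF q
      | .K => uK q ⊗ₜ uK q
      | .Ki => uKi q ⊗ₜ uKi q)
    (by simp [uK_Ki, Algebra.TensorProduct.one_def])
    (by simp [uKi_K, Algebra.TensorProduct.one_def])
    (by
      simp only [mul_add, add_mul, Algebra.TensorProduct.tmul_mul_tmul, uK_Ki, uKi_K, uKE,
        smul_add, TensorProduct.smul_tmul', TensorProduct.tmul_smul])
    (by
      simp only [mul_add, add_mul, Algebra.TensorProduct.tmul_mul_tmul, uK_Ki, uKi_K, uFK,
        smul_add, TensorProduct.smul_tmul', TensorProduct.tmul_smul])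
    (by
      have h1 : uE q * uF q = uF q * uE q +
          (qc q - (qc q)⁻¹)⁻¹ • (uK q * uK q - uKi q * uKi q) := by rw [← uEF]; abel
      simp only [mul_add, add_mul, Algebra.TensorProduct.tmul_mul_tmul, uKE, uFK, uEKi, uKiF, h1,
        smul_add, TensorProduct.add_tmul, TensorProduct.tmul_add, TensorProduct.sub_tmul,
        TensorProduct.tmul_sub, smul_sub, TensorProduct.tmul_smul, ← TensorProduct.smul_tmul']
      abel)

/-- The counit of `U_q(su_2)`. -/
def uCounit (q : QParam) : U q →ₐ[ℂ] ℂ :=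
  uLift q
    (fun
      | .E => 0
      | .F => 0
      | .K => 1
      | .Ki => 1)
    (by simp) (by simp) (by simp) (by simp) (by simp)

/-- The antipode: `S(E) = -q E`, `S(F) = -q⁻¹ F`, `S(K) = K⁻¹`, as a homomorphism to the
opposite algebra. -/
def uAntipode (q : QParam) : U q →ₐ[ℂ] (U q)ᵐᵒᵖ :=
  uLift q
    (fun
      | .E => op (-(qc q • uE q))
      | .F => op (-((qc q)⁻¹ • uF q))
      | .K => op (uKi q)
      | .Ki => op (uK q))
    (by simp [← MulOpposite.op_mul, uK_Ki])
    (by simp [← MulOpposite.op_mul, uKi_K])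
    (by simp [← MulOpposite.op_mul, ← MulOpposite.op_smul, uEKi])
    (by
      simp [← MulOpposite.op_mul, ← MulOpposite.op_smul, uKiF, qc_ne_zero q, smul_smul])
    (by
      have h1 : uE q * uF q = uF q * uE q +
          (qc q - (qc q)⁻¹)⁻¹ • (uK q * uK q - uKi q * uKi q) := by rw [← uEF]; abel
      simp only [← MulOpposite.op_mul, ← MulOpposite.op_smul, ← MulOpposite.op_sub,
        MulOpposite.op_inj, neg_mul_neg, mul_smul_comm, smul_mul_assoc, smul_smul, h1,
        inv_mul_cancel₀ (qc_ne_zero q), mul_inv_cancel₀ (qc_ne_zero q), one_smul]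
      rw [smul_sub, smul_sub]
      abel)

/-- The inverse of the antipode: `S⁻¹(E) = -q⁻¹ E`, `S⁻¹(F) = -q F`, `S⁻¹(K) = K⁻¹`. -/
def uAntipodeInv (q : QParam) : U q →ₐ[ℂ] (U q)ᵐᵒᵖ :=
  uLift q
    (fun
      | .E => op (-((qc q)⁻¹ • uE q))
      | .F => op (-(qc q • uF q))
      | .K => op (uKi q)
      | .Ki => op (uK q))
    (by simp [← MulOpposite.op_mul, uK_Ki])
    (by simp [← MulOpposite.op_mul, uKi_K])
    (by
      simp [← MulOpposite.op_mul, ← MulOpposite.op_smul, uEKi, qc_ne_zero q, smul_smul])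
    (by simp [← MulOpposite.op_mul, ← MulOpposite.op_smul, uKiF])
    (by
      have h1 : uE q * uF q = uF q * uE q +
          (qc q - (qc q)⁻¹)⁻¹ • (uK q * uK q - uKi q * uKi q) := by rw [← uEF]; abel
      simp only [← MulOpposite.op_mul, ← MulOpposite.op_smul, ← MulOpposite.op_sub,
        MulOpposite.op_inj, neg_mul_neg, mul_smul_comm, smul_mul_assoc, smul_smul, h1,
        inv_mul_cancel₀ (qc_ne_zero q), mul_inv_cancel₀ (qc_ne_zero q), one_smul]
      rw [smul_sub, smul_sub]
      abel)

/-- The involution of `U_q(su_2)`: the conjugate-linear anti-homomorphism with `E* = F`,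
`F* = E`, `K* = K`, as a ring homomorphism to the opposite ring. -/
def uStarHom (q : QParam) : U q →+* (U q)ᵐᵒᵖ :=
  RingQuot.lift ⟨conjLift (fun
      | .E => uF q
      | .F => uE q
      | .K => uK q
      | .Ki => uKi q), by
    have h1 : uE q * uF q = uF q * uE q +
        (qc q - (qc q)⁻¹)⁻¹ • (uK q * uK q - uKi q * uKi q) := by rw [← uEF]; abel
    intro x y h
    cases h <;>
      simp only [map_mul, map_sub, map_one, conjLift_smul, conjLift_ι, conj_qc, map_inv₀,
        ← MulOpposite.op_mul, ← MulOpposite.op_smul, ← MulOpposite.op_sub,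
        ← MulOpposite.op_one, MulOpposite.op_inj, uK_Ki, uKi_K, uKE, uFK, h1]
    abel⟩

/-- The involution of `U_q(su_2)`. -/
def uStar (q : QParam) (f : U q) : U q := unop (uStarHom q f)

/-! ### The coordinate algebra `O(SU_q(2))` -/

/-- Generators of `O(SU_q(2))`, the entries of the fundamental matrix `(a b; c d)`. -/
inductive OGen : Type
  | a | b | c | d

open FreeAlgebra in
/-- Defining relations of `O(SU_q(2))`. -/
inductive ORel (q : QParam) : FreeAlgebra ℂ OGen → FreeAlgebra ℂ OGen → Prop
  | ab : ORel q (ι ℂ .a * ι ℂ .b) (qc q • (ι ℂ .b * ι ℂ .a))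
  | ac : ORel q (ι ℂ .a * ι ℂ .c) (qc q • (ι ℂ .c * ι ℂ .a))
  | bd : ORel q (ι ℂ .b * ι ℂ .d) (qc q • (ι ℂ .d * ι ℂ .b))
  | cd : ORel q (ι ℂ .c * ι ℂ .d) (qc q • (ι ℂ .d * ι ℂ .c))
  | bc : ORel q (ι ℂ .b * ι ℂ .c) (ι ℂ .c * ι ℂ .b)
  | ad : ORel q (ι ℂ .a * ι ℂ .d) (1 + qc q • (ι ℂ .b * ι ℂ .c))
  | da : ORel q (ι ℂ .d * ι ℂ .a) (1 + (qc q)⁻¹ • (ι ℂ .b * ι ℂ .c))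

/-- The algebra `O(SU_q(2))`. -/
def O (q : QParam) : Type := RingQuot (ORel q)

instance instRingO (q : QParam) : Ring (O q) := inferInstanceAs (Ring (RingQuot (ORel q)))

instance instAlgebraO (q : QParam) : Algebra ℂ (O q) :=
  inferInstanceAs (Algebra ℂ (RingQuot (ORel q)))

/-- The quotient map. -/
def oMk (q : QParam) : FreeAlgebra ℂ OGen →ₐ[ℂ] O q := RingQuot.mkAlgHom ℂ (ORel q)

theorem oMk_rel (q : QParam) {x y : FreeAlgebra ℂ OGen} (h : ORel q x y) : oMk q x = oMk q y :=
  RingQuot.mkAlgHom_rel ℂ h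

/-- The generators as elements of `O(SU_q(2))`. -/
def oGen (q : QParam) (x : OGen) : O q := oMk q (FreeAlgebra.ι ℂ x)

abbrev oa (q : QParam) : O q := oGen q .a
abbrev ob (q : QParam) : O q := oGen q .b
abbrev oc (q : QParam) : O q := oGen q .c
abbrev od (q : QParam) : O q := oGen q .d

theorem o_ab (q : QParam) : oa q * ob q = qc q • (ob q * oa q) := by
  simpa [oGen] using oMk_rel q (ORel.ab (q := q))

theorem o_ac (q : QParam) : oa q * oc q = qc q • (oc q * oa q) := by
  simpa [oGen] using oMk_rel q (ORel.ac (q := q))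

theorem o_bd (q : QParam) : ob q * od q = qc q • (od q * ob q) := by
  simpa [oGen] using oMk_rel q (ORel.bd (q := q))

theorem o_cd (q : QParam) : oc q * od q = qc q • (od q * oc q) := by
  simpa [oGen] using oMk_rel q (ORel.cd (q := q))

theorem o_bc (q : QParam) : ob q * oc q = oc q * ob q := by
  simpa [oGen] using oMk_rel q (ORel.bc (q := q))

theorem o_ad (q : QParam) : oa q * od q = 1 + qc q • (ob q * oc q) := by
  simpa [oGen] using oMk_rel q (ORel.ad (q := q))

theorem o_da (q : QParam) : od q * oa q = 1 + (qc q)⁻¹ • (ob q * oc q) := by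
  simpa [oGen] using oMk_rel q (ORel.da (q := q))

/-- Homomorphisms out of `O(SU_q(2))`, given by the images of the generators. -/
def oLift (q : QParam) {A : Type*} [Ring A] [Algebra ℂ A] (g : OGen → A)
    (h₁ : g .a * g .b = qc q • (g .b * g .a)) (h₂ : g .a * g .c = qc q • (g .c * g .a))
    (h₃ : g .b * g .d = qc q • (g .d * g .b)) (h₄ : g .c * g .d = qc q • (g .d * g .c))
    (h₅ : g .b * g .c = g .c * g .b) (h₆ : g .a * g .d = 1 + qc q • (g .b * g .c))
    (h₇ : g .d * g .a = 1 + (qc q)⁻¹ • (g .b * g .c)) : O q →ₐ[ℂ] A :=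
  RingQuot.liftAlgHom ℂ ⟨FreeAlgebra.lift ℂ g, by
    intro x y h
    cases h <;> simpa [FreeAlgebra.lift_ι_apply]⟩

theorem oLift_gen (q : QParam) {A : Type*} [Ring A] [Algebra ℂ A] (g : OGen → A)
    (h₁ h₂ h₃ h₄ h₅ h₆ h₇) (x : OGen) :
    oLift q g h₁ h₂ h₃ h₄ h₅ h₆ h₇ (oGen q x) = g x := by
  rw [oGen, oMk, oLift]
  exact (RingQuot.liftAlgHom_mkAlgHom_apply ℂ _ _ _).trans (FreeAlgebra.lift_ι_apply _ _)

theorem o_induction (q : QParam) {C : O q → Prop} (halg : ∀ r : ℂ, C (algebraMap ℂ (O q) r))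
    (hgen : ∀ x : OGen, C (oGen q x)) (hmul : ∀ x y, C x → C y → C (x * y))
    (hadd : ∀ x y, C x → C y → C (x + y)) (x : O q) : C x := by
  obtain ⟨x, rfl⟩ := RingQuot.mkAlgHom_surjective ℂ (ORel q) x
  induction x using FreeAlgebra.induction with
  | grade0 r =>
    rw [AlgHom.commutes]
    exact halg r
  | grade1 x => exact hgen x
  | mul x y hx hy =>
    rw [map_mul]
    exact hmul _ _ hx hy
  | add x y hx hy =>
    rw [map_add]
    exact hadd _ _ hx hy

theorem o_algHom_ext (q : QParam) {A : Type*} [Ring A] [Algebra ℂ A] {f g : O q →ₐ[ℂ] A}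
    (h : ∀ x, f (oGen q x) = g (oGen q x)) : f = g := by
  ext x
  induction x using o_induction with
  | halg r => rw [AlgHom.commutes, AlgHom.commutes]
  | hgen x => exact h x
  | hmul x y hx hy => rw [map_mul, map_mul, hx, hy]
  | hadd x y hx hy => rw [map_add, map_add, hx, hy]

/-- The counit of `O(SU_q(2))`: `ε(a) = ε(d) = 1`, `ε(b) = ε(c) = 0`. -/
def oCounit (q : QParam) : O q →ₐ[ℂ] ℂ :=
  oLift q
    (fun
      | .a => 1
      | .b => 0
      | .c => 0
      | .d => 1)
    (by simp) (by simp) (by simp) (by simp) (by simp) (by simp) (by simp)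

/-- The adjoints of the generators: `a* = d`, `b* = -q c`, `c* = -q⁻¹ b`, `d* = a`. -/
def oStarGen (q : QParam) : OGen → O q
  | .a => od q
  | .b => -(qc q • oc q)
  | .c => -((qc q)⁻¹ • ob q)
  | .d => oa q

/-- The involution of `O(SU_q(2))`: the conjugate-linear anti-homomorphism with the above
values on the generators, as a ring homomorphism to the opposite ring. -/
def oStarHom (q : QParam) : O q →+* (O q)ᵐᵒᵖ :=
  RingQuot.lift ⟨conjLift (oStarGen q), by
    intro x y h
    cases h <;>
      simp only [oStarGen, map_mul, map_sub, map_one, map_add, conjLift_smul, conjLift_ι, conj_qc,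
        map_inv₀, ← MulOpposite.op_mul, ← MulOpposite.op_smul, ← MulOpposite.op_sub,
        ← MulOpposite.op_add, ← MulOpposite.op_one, MulOpposite.op_inj, mul_neg, neg_mul,
        mul_smul_comm, smul_mul_assoc, smul_neg, neg_neg, o_ab, o_ac, o_bd, o_cd, o_bc,
        o_ad, o_da, smul_smul, inv_mul_cancel₀ (qc_ne_zero q), mul_inv_cancel₀ (qc_ne_zero q),
        one_smul, mul_one, mul_comm]⟩

/-- The involution of `O(SU_q(2))`. -/
def oStar (q : QParam) (x : O q) : O q := unop (oStarHom q x)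

theorem oStarHom_mk (q : QParam) (x : FreeAlgebra ℂ OGen) :
    oStarHom q (oMk q x) = conjLift (oStarGen q) x :=
  ringQuot_lift_mkAlgHom _ _ x

theorem oStar_gen (q : QParam) (x : OGen) : oStar q (oGen q x) = oStarGen q x := by
  rw [oStar, oGen, oStarHom_mk, conjLift_ι, MulOpposite.unop_op]

theorem oStar_mul (q : QParam) (x y : O q) : oStar q (x * y) = oStar q y * oStar q x := by
  simp [oStar]

theorem oStar_add (q : QParam) (x y : O q) : oStar q (x + y) = oStar q x + oStar q y := by
  simp [oStar]

theorem oStar_one (q : QParam) : oStar q 1 = 1 := by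
  simp [oStar]

theorem oStar_zero (q : QParam) : oStar q 0 = 0 := by
  simp [oStar]

theorem oStar_algebraMap (q : QParam) (r : ℂ) :
    oStar q (algebraMap ℂ (O q) r) = algebraMap ℂ (O q) (starRingEnd ℂ r) := by
  have h : algebraMap ℂ (O q) r = oMk q (algebraMap ℂ _ r) := ((oMk q).commutes r).symm
  rw [h, oStar, oStarHom_mk, conjLift_algebraMap, MulOpposite.unop_op]

/-! ### The actions on `O(SU_q(2))` -/

/-- The automorphism `t_{jk} ↦ r ^ (2 j) t ^ (2 k) t_{jk}`, `j, k = ± 1/2`. -/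
def oScale (q : QParam) (r t : ℂ) (hr : r ≠ 0) (ht : t ≠ 0) : O q →ₐ[ℂ] O q :=
  oLift q
    (fun
      | .a => (r⁻¹ * t⁻¹) • oa q
      | .b => (r⁻¹ * t) • ob q
      | .c => (r * t⁻¹) • oc q
      | .d => (r * t) • od q)
    (by simp only [mul_smul_comm, smul_mul_assoc, smul_smul, o_ab]; congr 1; ring)
    (by simp only [mul_smul_comm, smul_mul_assoc, smul_smul, o_ac]; congr 1; ring)
    (by simp only [mul_smul_comm, smul_mul_assoc, smul_smul, o_bd]; congr 1; ring)
    (by simp only [mul_smul_comm, smul_mul_assoc, smul_smul, o_cd]; congr 1; ring)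
    (by simp only [mul_smul_comm, smul_mul_assoc, smul_smul, o_bc]; congr 1; ring)
    (by
      have h1 : r * t * (r⁻¹ * t⁻¹) = 1 := by field_simp
      have h2 : r * t⁻¹ * (r⁻¹ * t) = 1 := by field_simp
      simp only [mul_smul_comm, smul_mul_assoc, smul_smul, o_ad, h1, h2, one_smul, mul_one])
    (by
      have h1 : r⁻¹ * t⁻¹ * (r * t) = 1 := by field_simp
      have h2 : r * t⁻¹ * (r⁻¹ * t) = 1 := by field_simp
      simp only [mul_smul_comm, smul_mul_assoc, smul_smul, o_da, h1, h2, one_smul, mul_one])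

theorem oScale_gen (q : QParam) (r t : ℂ) (hr : r ≠ 0) (ht : t ≠ 0) (x : OGen) :
    oScale q r t hr ht (oGen q x) = match x with
      | .a => (r⁻¹ * t⁻¹) • oa q
      | .b => (r⁻¹ * t) • ob q
      | .c => (r * t⁻¹) • oc q
      | .d => (r * t) • od q := by
  rw [oScale, oLift_gen]

/-- Left action of `K`. -/
def actK (q : QParam) : O q →ₐ[ℂ] O q := oScale q 1 (qs q) one_ne_zero (qs_ne_zero q)

/-- Left action of `K⁻¹`. -/
def actKi (q : QParam) : O q →ₐ[ℂ] O q :=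
  oScale q 1 (qs q)⁻¹ one_ne_zero (inv_ne_zero (qs_ne_zero q))

/-- The operator `∂_{K²}` given by the right action of the group-like element `K²`:
`∂_{K²}(t^l_{jk}) = q ^ (-2 j) t^l_{jk}`. -/
def dK2 (q : QParam) : O q →ₐ[ℂ] O q :=
  oScale q (qc q)⁻¹ 1 (inv_ne_zero (qc_ne_zero q)) one_ne_zero

/-- The homomorphism `x ↦ (K⁻¹ ▷ x, E ▷ x; 0, K ▷ x)`, which is multiplicative because
`E ▷ (x y) = (E ▷ x) (K ▷ y) + (K⁻¹ ▷ x) (E ▷ y)`; on generators `E ▷ a = b`, `E ▷ c = d`,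
`E ▷ b = E ▷ d = 0`. -/
def actEMat (q : QParam) : O q →ₐ[ℂ] Matrix (Fin 2) (Fin 2) (O q) :=
  oLift q
    (fun
      | .a => !![qs q • oa q, ob q; 0, (qs q)⁻¹ • oa q]
      | .b => !![(qs q)⁻¹ • ob q, 0; 0, qs q • ob q]
      | .c => !![qs q • oc q, od q; 0, (qs q)⁻¹ • oc q]
      | .d => !![(qs q)⁻¹ • od q, 0; 0, qs q • od q])
    (by
      have hs := qs_ne_zero q
      ext i j
      fin_cases i <;> fin_cases j <;>
        simp [o_ab, o_ac, o_bd, o_cd, o_bc, o_ad, o_da, smul_smul, ← qs_mul_qs, hs] <;>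
        match_scalars <;> field_simp <;> ring) (by
      have hs := qs_ne_zero q
      ext i j
      fin_cases i <;> fin_cases j <;>
        simp [o_ab, o_ac, o_bd, o_cd, o_bc, o_ad, o_da, smul_smul, ← qs_mul_qs, hs] <;>
        match_scalars <;> field_simp <;> ring) (by
      have hs := qs_ne_zero q
      ext i j
      fin_cases i <;> fin_cases j <;>
        simp [o_ab, o_ac, o_bd, o_cd, o_bc, o_ad, o_da, smul_smul, ← qs_mul_qs, hs] <;>
        match_scalars <;> field_simp <;> ring) (by
      have hs := qs_ne_zero q
      ext i j
      fin_cases i <;> fin_cases j <;>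
        simp [o_ab, o_ac, o_bd, o_cd, o_bc, o_ad, o_da, smul_smul, ← qs_mul_qs, hs] <;>
        match_scalars <;> field_simp <;> ring) (by
      have hs := qs_ne_zero q
      ext i j
      fin_cases i <;> fin_cases j <;>
        simp [o_ab, o_ac, o_bd, o_cd, o_bc, o_ad, o_da, smul_smul, ← qs_mul_qs, hs] <;>
        match_scalars <;> field_simp <;> ring) (by
      have hs := qs_ne_zero q
      ext i j
      fin_cases i <;> fin_cases j <;>
        simp [o_ab, o_ac, o_bd, o_cd, o_bc, o_ad, o_da, smul_smul, ← qs_mul_qs, hs] <;>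
        match_scalars <;> field_simp <;> ring) (by
      have hs := qs_ne_zero q
      ext i j
      fin_cases i <;> fin_cases j <;>
        simp [o_ab, o_ac, o_bd, o_cd, o_bc, o_ad, o_da, smul_smul, ← qs_mul_qs, hs] <;>
        match_scalars <;> field_simp <;> ring)

/-- The homomorphism `x ↦ (K⁻¹ ▷ x, F ▷ x; 0, K ▷ x)`; on generators `F ▷ b = a`, `F ▷ d = c`,
`F ▷ a = F ▷ c = 0`. -/
def actFMat (q : QParam) : O q →ₐ[ℂ] Matrix (Fin 2) (Fin 2) (O q) :=
  oLift q
    (fun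
      | .a => !![qs q • oa q, 0; 0, (qs q)⁻¹ • oa q]
      | .b => !![(qs q)⁻¹ • ob q, oa q; 0, qs q • ob q]
      | .c => !![qs q • oc q, 0; 0, (qs q)⁻¹ • oc q]
      | .d => !![(qs q)⁻¹ • od q, oc q; 0, qs q • od q])
    (by
      have hs := qs_ne_zero q
      ext i j
      fin_cases i <;> fin_cases j <;>
        simp [o_ab, o_ac, o_bd, o_cd, o_bc, o_ad, o_da, smul_smul, ← qs_mul_qs, hs] <;>
        match_scalars <;> field_simp <;> ring) (by
      have hs := qs_ne_zero q
      ext i j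
      fin_cases i <;> fin_cases j <;>
        simp [o_ab, o_ac, o_bd, o_cd, o_bc, o_ad, o_da, smul_smul, ← qs_mul_qs, hs] <;>
        match_scalars <;> field_simp <;> ring) (by
      have hs := qs_ne_zero q
      ext i j
      fin_cases i <;> fin_cases j <;>
        simp [o_ab, o_ac, o_bd, o_cd, o_bc, o_ad, o_da, smul_smul, ← qs_mul_qs, hs] <;>
        match_scalars <;> field_simp <;> ring) (by
      have hs := qs_ne_zero q
      ext i j
      fin_cases i <;> fin_cases j <;>
        simp [o_ab, o_ac, o_bd, o_cd, o_bc, o_ad, o_da, smul_smul, ← qs_mul_qs, hs] <;>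
        match_scalars <;> field_simp <;> ring) (by
      have hs := qs_ne_zero q
      ext i j
      fin_cases i <;> fin_cases j <;>
        simp [o_ab, o_ac, o_bd, o_cd, o_bc, o_ad, o_da, smul_smul, ← qs_mul_qs, hs] <;>
        match_scalars <;> field_simp <;> ring) (by
      have hs := qs_ne_zero q
      ext i j
      fin_cases i <;> fin_cases j <;>
        simp [o_ab, o_ac, o_bd, o_cd, o_bc, o_ad, o_da, smul_smul, ← qs_mul_qs, hs] <;>
        match_scalars <;> field_simp <;> ring) (by
      have hs := qs_ne_zero q
      ext i j
      fin_cases i <;> fin_cases j <;>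
        simp [o_ab, o_ac, o_bd, o_cd, o_bc, o_ad, o_da, smul_smul, ← qs_mul_qs, hs] <;>
        match_scalars <;> field_simp <;> ring)

theorem actEMat_gen (q : QParam) (x : OGen) : actEMat q (oGen q x) = match x with
      | .a => !![qs q • oa q, ob q; 0, (qs q)⁻¹ • oa q]
      | .b => !![(qs q)⁻¹ • ob q, 0; 0, qs q • ob q]
      | .c => !![qs q • oc q, od q; 0, (qs q)⁻¹ • oc q]
      | .d => !![(qs q)⁻¹ • od q, 0; 0, qs q • od q] := by
  rw [actEMat, oLift_gen]

theorem actFMat_gen (q : QParam) (x : OGen) : actFMat q (oGen q x) = match x with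
      | .a => !![qs q • oa q, 0; 0, (qs q)⁻¹ • oa q]
      | .b => !![(qs q)⁻¹ • ob q, oa q; 0, qs q • ob q]
      | .c => !![qs q • oc q, 0; 0, (qs q)⁻¹ • oc q]
      | .d => !![(qs q)⁻¹ • od q, oc q; 0, qs q • od q] := by
  rw [actFMat, oLift_gen]

/-- Left action of `E`. -/
def actE (q : QParam) : O q →ₗ[ℂ] O q where
  toFun x := actEMat q x 0 1
  map_add' x y := by simp
  map_smul' r x := by simp

/-- Left action of `F`. -/
def actF (q : QParam) : O q →ₗ[ℂ] O q where
  toFun x := actFMat q x 0 1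
  map_add' x y := by simp
  map_smul' r x := by simp

theorem actK_gen (q : QParam) (x : OGen) : actK q (oGen q x) = match x with
      | .a => (qs q)⁻¹ • oa q
      | .b => qs q • ob q
      | .c => (qs q)⁻¹ • oc q
      | .d => qs q • od q := by
  rw [actK, oScale_gen]
  cases x <;> simp

theorem actKi_gen (q : QParam) (x : OGen) : actKi q (oGen q x) = match x with
      | .a => qs q • oa q
      | .b => (qs q)⁻¹ • ob q
      | .c => qs q • oc q
      | .d => (qs q)⁻¹ • od q := by
  rw [actKi, oScale_gen]
  cases x <;> simp

theorem actK_actKi (q : QParam) (x : O q) : actK q (actKi q x) = x := by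
  have h : (actK q).comp (actKi q) = AlgHom.id ℂ (O q) := by
    apply o_algHom_ext
    intro x
    have hs := qs_ne_zero q
    cases x <;> simp [actK_gen, actKi_gen, smul_smul, hs]
  exact congrArg (fun f : O q →ₐ[ℂ] O q => f x) h

theorem actKi_actK (q : QParam) (x : O q) : actKi q (actK q x) = x := by
  have h : (actKi q).comp (actK q) = AlgHom.id ℂ (O q) := by
    apply o_algHom_ext
    intro x
    have hs := qs_ne_zero q
    cases x <;> simp [actK_gen, actKi_gen, smul_smul, hs]
  exact congrArg (fun f : O q →ₐ[ℂ] O q => f x) h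

theorem actEMat_entries (q : QParam) (x : O q) :
    actEMat q x 0 0 = actKi q x ∧ actEMat q x 1 0 = 0 ∧ actEMat q x 1 1 = actK q x := by
  induction x using o_induction with
  | halg r => simp [Matrix.algebraMap_matrix_apply]
  | hgen x => cases x <;> simp [actEMat_gen, actK_gen, actKi_gen]
  | hmul x y hx hy =>
    obtain ⟨h1, h2, h3⟩ := hx
    obtain ⟨h4, h5, h6⟩ := hy
    simp [Matrix.mul_apply, Fin.sum_univ_two, h1, h2, h3, h4, h5, h6]
  | hadd x y hx hy =>
    obtain ⟨h1, h2, h3⟩ := hx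
    obtain ⟨h4, h5, h6⟩ := hy
    simp [h1, h2, h3, h4, h5, h6]

theorem actFMat_entries (q : QParam) (x : O q) :
    actFMat q x 0 0 = actKi q x ∧ actFMat q x 1 0 = 0 ∧ actFMat q x 1 1 = actK q x := by
  induction x using o_induction with
  | halg r => simp [Matrix.algebraMap_matrix_apply]
  | hgen x => cases x <;> simp [actFMat_gen, actK_gen, actKi_gen]
  | hmul x y hx hy =>
    obtain ⟨h1, h2, h3⟩ := hx
    obtain ⟨h4, h5, h6⟩ := hy
    simp [Matrix.mul_apply, Fin.sum_univ_two, h1, h2, h3, h4, h5, h6]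
  | hadd x y hx hy =>
    obtain ⟨h1, h2, h3⟩ := hx
    obtain ⟨h4, h5, h6⟩ := hy
    simp [h1, h2, h3, h4, h5, h6]

theorem actE_mul (q : QParam) (x y : O q) :
    actE q (x * y) = actE q x * actK q y + actKi q x * actE q y := by
  change actEMat q (x * y) 0 1 = _
  rw [map_mul, Matrix.mul_apply, Fin.sum_univ_two, (actEMat_entries q x).1,
    (actEMat_entries q y).2.2, add_comm]
  rfl

theorem actF_mul (q : QParam) (x y : O q) :
    actF q (x * y) = actF q x * actK q y + actKi q x * actF q y := by
  change actFMat q (x * y) 0 1 = _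
  rw [map_mul, Matrix.mul_apply, Fin.sum_univ_two, (actFMat_entries q x).1,
    (actFMat_entries q y).2.2, add_comm]
  rfl

theorem actE_algebraMap (q : QParam) (r : ℂ) : actE q (algebraMap ℂ _ r) = 0 := by
  simp [actE, Matrix.algebraMap_matrix_apply]

theorem actF_algebraMap (q : QParam) (r : ℂ) : actF q (algebraMap ℂ _ r) = 0 := by
  simp [actF, Matrix.algebraMap_matrix_apply]

theorem actE_gen (q : QParam) (x : OGen) : actE q (oGen q x) = match x with
      | .a => ob q
      | .b => 0
      | .c => od q
      | .d => 0 := by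
  cases x <;> simp [actE, actEMat_gen]

theorem actF_gen (q : QParam) (x : OGen) : actF q (oGen q x) = match x with
      | .a => 0
      | .b => oa q
      | .c => 0
      | .d => oc q := by
  cases x <;> simp [actF, actFMat_gen]

theorem actK_actE (q : QParam) (x : O q) : actK q (actE q x) = qc q • actE q (actK q x) := by
  induction x using o_induction with
  | halg r => simp [actE_algebraMap]
  | hgen x =>
    have hs := qs_ne_zero q
    cases x <;> simp [actE_gen, actK_gen, smul_smul, ← qs_mul_qs, hs]
  | hmul x y hx hy =>
    simp [actE_mul, hx, hy, actK_actKi, actKi_actK]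
  | hadd x y hx hy => simp [hx, hy]

theorem actF_actK (q : QParam) (x : O q) : actF q (actK q x) = qc q • actK q (actF q x) := by
  induction x using o_induction with
  | halg r => simp [actF_algebraMap]
  | hgen x =>
    have hs := qs_ne_zero q
    cases x <;> simp [actF_gen, actK_gen, smul_smul, ← qs_mul_qs, hs]
  | hmul x y hx hy =>
    simp [actF_mul, hx, hy, actK_actKi, actKi_actK]
  | hadd x y hx hy => simp [hx, hy]

theorem actE_actKi (q : QParam) (x : O q) :
    actE q (actKi q x) = qc q • actKi q (actE q x) := by
  have h := congrArg (actKi q) (actK_actE q (actKi q x))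
  rwa [actKi_actK, actK_actKi, map_smul] at h

theorem actKi_actF (q : QParam) (x : O q) :
    actKi q (actF q x) = qc q • actF q (actKi q x) := by
  have h := congrArg (actKi q) (actF_actK q (actKi q x))
  rwa [actK_actKi, map_smul, actKi_actK] at h

theorem actEF (q : QParam) (x : O q) :
    actE q (actF q x) = actF q (actE q x) +
      (qc q - (qc q)⁻¹)⁻¹ • (actK q (actK q x) - actKi q (actKi q x)) := by
  induction x using o_induction with
  | halg r => simp [actE_algebraMap, actF_algebraMap]
  | hgen x =>
    have hs := qs_ne_zero q
    have h := qc_sub_inv_ne_zero q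
    rw [← qs_mul_qs] at h
    have h1 : (qs q * qs q - (qs q * qs q)⁻¹)⁻¹ * (qs q * qs q - (qs q * qs q)⁻¹) = 1 :=
      inv_mul_cancel₀ h
    have h2 : (qs q * qs q - (qs q * qs q)⁻¹)⁻¹ * ((qs q)⁻¹ * (qs q)⁻¹ - qs q * qs q) = -1 := by
      rw [← h1, ← mul_inv]
      ring
    have h3 : (qs q * qs q - (qs q * qs q)⁻¹)⁻¹ * (qs q * qs q - (qs q)⁻¹ * (qs q)⁻¹) = 1 := by
      rw [← mul_inv]
      exact h1
    cases x <;>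
      simp only [actE_gen, actF_gen, actK_gen, actKi_gen, map_smul, smul_smul, ← qs_mul_qs,
        ← sub_smul, h2, h3, map_zero, zero_add, neg_smul, one_smul, add_neg_cancel]
  | hmul x y hx hy =>
    simp only [actE_mul, actF_mul, hx, hy, map_add, map_mul, actKi_actK, actK_actKi,
      actK_actE, actF_actK, actE_actKi, actKi_actF, mul_add, add_mul, smul_mul_assoc,
      mul_smul_comm, mul_sub, sub_mul, smul_sub]
    abel
  | hadd x y hx hy =>
    simp only [map_add, hx, hy, smul_sub, smul_add]
    abel

/-- The left action `f ▷ x` of `U_q(su_2)` on `O(SU_q(2))`. -/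
def act (q : QParam) : U q →ₐ[ℂ] Module.End ℂ (O q) :=
  uLift q
    (fun
      | .E => actE q
      | .F => actF q
      | .K => (actK q).toLinearMap
      | .Ki => (actKi q).toLinearMap)
    (by
      ext x
      exact actK_actKi q x)
    (by
      ext x
      exact actKi_actK q x)
    (by
      ext x
      exact actK_actE q x)
    (by
      ext x
      exact actF_actK q x)
    (by
      ext x
      have h := actEF q x
      exact sub_eq_iff_eq_add'.mpr h)

theorem act_E (q : QParam) (x : O q) : act q (uE q) x = actE q x := by
  rw [act, uLift_gen]

theorem act_F (q : QParam) (x : O q) : act q (uF q) x = actF q x := by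
  rw [act, uLift_gen]

theorem act_K (q : QParam) (x : O q) : act q (uK q) x = actK q x := by
  rw [act, uLift_gen]
  rfl

theorem act_Ki (q : QParam) (x : O q) : act q (uKi q) x = actKi q x := by
  rw [act, uLift_gen]
  rfl

/-! ### The standard Podleś sphere -/

/-- The standard Podleś sphere `O(S_q^2) = {x : ∂_{K²}(x) = x}` as a subalgebra. -/
def sphere (q : QParam) : Subalgebra ℂ (O q) := AlgHom.equalizer (dK2 q) (AlgHom.id ℂ (O q))

/-- The algebra `O(S_q^2)`. -/
abbrev S2 (q : QParam) : Type := ↥(sphere q)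

theorem mem_sphere (q : QParam) (x : O q) : x ∈ sphere q ↔ dK2 q x = x := Iff.rfl

theorem dK2_gen (q : QParam) (x : OGen) : dK2 q (oGen q x) = match x with
      | .a => qc q • oa q
      | .b => qc q • ob q
      | .c => (qc q)⁻¹ • oc q
      | .d => (qc q)⁻¹ • od q := by
  rw [dK2, oScale_gen]
  cases x <;> simp

theorem dK2_actK (q : QParam) (x : O q) : dK2 q (actK q x) = actK q (dK2 q x) := by
  have h : (dK2 q).comp (actK q) = (actK q).comp (dK2 q) := by
    apply o_algHom_ext
    intro x
    cases x <;> simp [actK_gen, dK2_gen, smul_smul, mul_comm]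
  exact congrArg (fun f : O q →ₐ[ℂ] O q => f x) h

theorem dK2_actKi (q : QParam) (x : O q) : dK2 q (actKi q x) = actKi q (dK2 q x) := by
  have h : (dK2 q).comp (actKi q) = (actKi q).comp (dK2 q) := by
    apply o_algHom_ext
    intro x
    cases x <;> simp [actKi_gen, dK2_gen, smul_smul, mul_comm]
  exact congrArg (fun f : O q →ₐ[ℂ] O q => f x) h

/-- The inverse modular automorphism `θ⁻¹(b) = K² ▷ b` of `O(S_q^2)`. -/
def thetaInv (q : QParam) : S2 q ≃ₐ[ℂ] S2 q :=
  AlgEquiv.ofAlgHom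
    (AlgHom.codRestrict (((actK q).comp (actK q)).comp (sphere q).val) (sphere q) fun x => by
      rw [mem_sphere]
      simp [dK2_actK, (mem_sphere q _).mp x.2])
    (AlgHom.codRestrict (((actKi q).comp (actKi q)).comp (sphere q).val) (sphere q) fun x => by
      rw [mem_sphere]
      simp [dK2_actKi, (mem_sphere q _).mp x.2])
    (by
      ext x
      simp [actK_actKi])
    (by
      ext x
      simp [actKi_actK])

theorem thetaInv_apply (q : QParam) (x : S2 q) :
    (thetaInv q x : O q) = act q (uK q * uK q) x := by
  rw [map_mul, Module.End.mul_apply, act_K, act_K]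
  rfl

theorem thetaInv_symm_apply (q : QParam) (x : S2 q) :
    ((thetaInv q).symm x : O q) = act q (uKi q * uKi q) x := by
  rw [map_mul, Module.End.mul_apply, act_Ki, act_Ki]
  rfl

theorem dK2_oStar_key (q : QParam) (y : O q) : dK2 q (oStar q (dK2 q y)) = oStar q y := by
  have hq := qc_ne_zero q
  induction y using o_induction with
  | halg r => simp [oStar_algebraMap]
  | hgen y =>
    cases y <;>
      simp [dK2_gen, Algebra.smul_def, oStar_mul, oStar_algebraMap, oStar_gen, oStarGen,
        conj_qc] <;>
      simp [← Algebra.smul_def, ← Algebra.commutes, smul_smul, hq, ← map_inv₀, ← map_mul,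
        mul_comm]
  | hmul x y hx hy => simp [oStar_mul, hx, hy]
  | hadd x y hx hy => simp [oStar_add, hx, hy]

/-- The involution of `O(S_q^2)`. -/
def s2Star (q : QParam) (x : S2 q) : S2 q :=
  ⟨oStar q x, by
    have h := dK2_oStar_key q (x : O q)
    rwa [(mem_sphere q _).mp x.2] at h⟩

theorem oStar_actK (q : QParam) (x : O q) : oStar q (actK q x) = actKi q (oStar q x) := by
  induction x using o_induction with
  | halg r => simp [oStar_algebraMap]
  | hgen x =>
    have hc : (starRingEnd ℂ) (qs q) = qs q := Complex.conj_ofReal _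
    cases x <;>
      simp [actK_gen, Algebra.smul_def, oStar_mul, oStar_algebraMap, oStar_gen, oStarGen, hc] <;>
      simp [← Algebra.smul_def, ← Algebra.commutes, smul_smul, ← map_inv₀, ← map_mul,
        mul_comm, actKi_gen]
  | hmul x y hx hy => simp [oStar_mul, hx, hy]
  | hadd x y hx hy => simp [oStar_add, hx, hy]

theorem s2Star_thetaInv (q : QParam) (x : S2 q) :
    thetaInv q (s2Star q (thetaInv q x)) = s2Star q x := by
  apply Subtype.ext
  change actK q (actK q (oStar q (actK q (actK q x)))) = oStar q x
  rw [oStar_actK, oStar_actK, actK_actKi, actK_actKi]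

theorem s2Star_mul (q : QParam) (x y : S2 q) : s2Star q (x * y) = s2Star q y * s2Star q x :=
  Subtype.ext (oStar_mul q x y)

theorem s2Star_add (q : QParam) (x y : S2 q) : s2Star q (x + y) = s2Star q x + s2Star q y :=
  Subtype.ext (oStar_add q x y)

theorem s2Star_zero (q : QParam) : s2Star q 0 = 0 :=
  Subtype.ext (oStar_zero q)

theorem s2Star_algebraMap (q : QParam) (r : ℂ) :
    s2Star q (algebraMap ℂ _ r) = algebraMap ℂ _ (starRingEnd ℂ r) :=
  Subtype.ext (oStar_algebraMap q r)

theorem s2Star_sum (q : QParam) {ι : Type*} (s : Finset ι) (f : ι → S2 q) :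
    s2Star q (∑ i ∈ s, f i) = ∑ i ∈ s, s2Star q (f i) :=
  map_sum (AddMonoidHom.mk' (s2Star q) (s2Star_add q)) f s

/-! ### The spin representations -/

theorem qInt_nonneg (q : QParam) (n : ℕ) : 0 ≤ qInt q n := by
  obtain ⟨q, h0, h1⟩ := q
  simp only [qInt, zpow_neg, zpow_natCast]
  rcases lt_or_gt_of_ne h1 with h | h
  · apply div_nonneg_of_nonpos
    · have h2 : q ^ n ≤ 1 := pow_le_one₀ h0.le h.le
      have h3 : 1 ≤ (q ^ n)⁻¹ := (one_le_inv₀ (pow_pos h0 n)).mpr h2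
      linarith
    · have h3 : 1 ≤ q⁻¹ := (one_le_inv₀ h0).mpr h.le
      linarith
  · apply div_nonneg
    · have h2 : 1 ≤ q ^ n := one_le_pow₀ h.le
      have h3 : (q ^ n)⁻¹ ≤ 1 := inv_le_one_of_one_le₀ h2
      linarith
    · have h3 : q⁻¹ ≤ 1 := inv_le_one_of_one_le₀ h.le
      linarith

/-- The number `α^l_k = ([l - k]_q [l + k + 1]_q)^(1/2)` for `l = n / 2`, `k = i - l`. -/
def alpha (q : QParam) (n i : ℕ) : ℂ :=
  ((Real.sqrt (qInt q ((n : ℤ) - i) * qInt q ((i : ℤ) + 1)) : ℝ) : ℂ)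

/-- The number `q ^ k` for `k = i - n / 2`. -/
def wt (q : QParam) (n i : ℕ) : ℂ := qs q ^ (2 * (i : ℤ) - n)

theorem wt_ne_zero (q : QParam) (n i : ℕ) : wt q n i ≠ 0 := zpow_ne_zero _ (qs_ne_zero q)

theorem wt_succ (q : QParam) (n i : ℕ) : wt q n (i + 1) = qc q * wt q n i := by
  have hs := qs_ne_zero q
  rw [wt, wt, ← qs_mul_qs]
  have : 2 * ((i + 1 : ℕ) : ℤ) - n = 2 + (2 * (i : ℤ) - n) := by push_cast; ring
  rw [this, zpow_add₀ hs]
  norm_cast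
  ring

theorem alpha_mul_alpha (q : QParam) (n i : ℕ) (h : i ≤ n) :
    alpha q n i * alpha q n i =
      ((qInt q ((n : ℤ) - i) * qInt q ((i : ℤ) + 1) : ℝ) : ℂ) := by
  rw [alpha, ← Complex.ofReal_mul, Real.mul_self_sqrt]
  apply mul_nonneg
  · have := qInt_nonneg q (n - i)
    rwa [Nat.cast_sub h] at this
  · exact_mod_cast qInt_nonneg q (i + 1)

theorem qInt_identity (q : QParam) (n i : ℤ) :
    qInt q (n - i + 1) * qInt q i - qInt q (n - i) * qInt q (i + 1) = qInt q (2 * i - n) := by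
  have h := real_sub_inv_ne_zero q
  have h0 : (q : ℝ) ≠ 0 := q.2.1.ne'
  have h2 : (q : ℝ) ^ 2 - 1 ≠ 0 := by
    intro h3
    apply h
    field_simp
    linarith
  simp only [qInt, div_mul_div_comm, ← sub_div]
  rw [div_eq_div_iff (mul_ne_zero h h) h]
  have e1 : (q : ℝ) ^ (n - i + 1) = (q : ℝ) ^ n * ((q : ℝ) ^ i)⁻¹ * q := by
    rw [zpow_add₀ h0, zpow_sub₀ h0, zpow_one]; ring
  have e2 : (q : ℝ) ^ (-(n - i + 1)) = ((q : ℝ) ^ n)⁻¹ * (q : ℝ) ^ i * (q : ℝ)⁻¹ := by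
    rw [zpow_neg, e1]; simp only [mul_inv, inv_inv]
  have e3 : (q : ℝ) ^ (n - i) = (q : ℝ) ^ n * ((q : ℝ) ^ i)⁻¹ := by
    rw [zpow_sub₀ h0]; ring
  have e4 : (q : ℝ) ^ (-(n - i)) = ((q : ℝ) ^ n)⁻¹ * (q : ℝ) ^ i := by
    rw [zpow_neg, e3]; simp only [mul_inv, inv_inv]
  have e5 : (q : ℝ) ^ (i + 1) = (q : ℝ) ^ i * q := by rw [zpow_add₀ h0, zpow_one]
  have e6 : (q : ℝ) ^ (-(i + 1)) = ((q : ℝ) ^ i)⁻¹ * (q : ℝ)⁻¹ := by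
    rw [zpow_neg, e5]; simp only [mul_inv, inv_inv]
  have e7 : (q : ℝ) ^ (2 * i - n) = (q : ℝ) ^ i * (q : ℝ) ^ i * ((q : ℝ) ^ n)⁻¹ := by
    rw [zpow_sub₀ h0, two_mul, zpow_add₀ h0]; ring
  have e8 : (q : ℝ) ^ (-(2 * i - n)) = ((q : ℝ) ^ i)⁻¹ * ((q : ℝ) ^ i)⁻¹ * (q : ℝ) ^ n := by
    rw [zpow_neg, e7]; simp only [mul_inv, inv_inv]
  rw [e1, e2, e3, e4, e5, e6, e7, e8, zpow_neg]
  have hx : (q : ℝ) ^ n ≠ 0 := zpow_ne_zero _ h0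
  have hy : (q : ℝ) ^ i ≠ 0 := zpow_ne_zero _ h0
  generalize (q : ℝ) ^ n = x at *
  generalize (q : ℝ) ^ i = y at *
  generalize (q : ℝ) = z at *
  field_simp
  ring

/-- The matrices of the spin-`n/2` representation; the index `i` corresponds to the weight
`k = i - n / 2`, with `E v_k = α_k v_{k+1}`, `F v_k = α_{k-1} v_{k-1}`, `K v_k = q ^ k v_k`. -/
def spinGen (q : QParam) (n : ℕ) : UGen → Matrix (Fin (n + 1)) (Fin (n + 1)) ℂ
  | .E => Matrix.of fun i j => if (i : ℕ) = j + 1 then alpha q n j else 0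
  | .F => Matrix.of fun i j => if (j : ℕ) = i + 1 then alpha q n i else 0
  | .K => Matrix.diagonal fun i => wt q n i
  | .Ki => Matrix.diagonal fun i => (wt q n i)⁻¹

theorem spin_EF_diag (q : QParam) (n : ℕ) (i : Fin (n + 1)) :
    (spinGen q n .E * spinGen q n .F) i i - (spinGen q n .F * spinGen q n .E) i i =
      (qc q - (qc q)⁻¹)⁻¹ * (wt q n i * wt q n i - (wt q n i)⁻¹ * (wt q n i)⁻¹) := by
  have hR : (qc q - (qc q)⁻¹)⁻¹ * (wt q n i * wt q n i - (wt q n i)⁻¹ * (wt q n i)⁻¹) =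
      ((qInt q (2 * (i : ℤ) - n) : ℝ) : ℂ) := by
    have hw : wt q n i * wt q n i = qc q ^ (2 * (i : ℤ) - n) := by
      rw [wt, ← mul_zpow, qs_mul_qs]
    rw [← mul_inv, hw, qInt, div_eq_inv_mul, zpow_neg]
    push_cast [qc]
    rfl
  have hE : (spinGen q n .E * spinGen q n .F) i i =
      ((qInt q ((n : ℤ) - i + 1) * qInt q i : ℝ) : ℂ) := by
    rw [Matrix.mul_apply]
    rcases Nat.eq_zero_or_pos (i : ℕ) with h | h
    · rw [Finset.sum_eq_zero]
      · rw [h]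
        simp [qInt]
      · intro j _
        simp only [spinGen, Matrix.of_apply]
        rw [if_neg (by omega), zero_mul]
    · have hj : (i : ℕ) - 1 < n + 1 := by omega
      rw [Finset.sum_eq_single (⟨(i : ℕ) - 1, hj⟩ : Fin (n + 1))]
      · simp only [spinGen, Matrix.of_apply]
        rw [if_pos (by omega), alpha_mul_alpha q n _ (by omega)]
        congr 3 <;> congr 1 <;> omega
      · intro j _ hne
        simp only [spinGen, Matrix.of_apply]
        rw [if_neg, zero_mul]
        intro h2
        apply hne
        apply Fin.ext
        simp only
        omega
      · simp
  have hF : (spinGen q n .F * spinGen q n .E) i i =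
      ((qInt q ((n : ℤ) - i) * qInt q ((i : ℤ) + 1) : ℝ) : ℂ) := by
    rw [Matrix.mul_apply]
    rcases Nat.lt_or_ge (i : ℕ) n with h | h
    · rw [Finset.sum_eq_single (⟨(i : ℕ) + 1, by omega⟩ : Fin (n + 1))]
      · simp only [spinGen, Matrix.of_apply]
        simp only [if_true]
        rw [alpha_mul_alpha q n _ (by omega)]
      · intro j _ hne
        simp only [spinGen, Matrix.of_apply]
        rw [if_neg, zero_mul]
        intro h2
        exact hne (Fin.ext h2)
      · simp
    · have hi : (i : ℕ) = n := by omega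
      rw [Finset.sum_eq_zero]
      · rw [hi]
        simp [qInt]
      · intro j _
        simp only [spinGen, Matrix.of_apply]
        rw [if_neg (by omega), zero_mul]
  rw [hE, hF, hR, ← Complex.ofReal_sub, qInt_identity]

/-- The spin-`n/2` representation of `U_q(su_2)`. -/
def spin (q : QParam) (n : ℕ) : U q →ₐ[ℂ] Matrix (Fin (n + 1)) (Fin (n + 1)) ℂ :=
  uLift q (spinGen q n)
    (by
      simp only [spinGen, Matrix.diagonal_mul_diagonal]
      rw [← Matrix.diagonal_one]
      congr 1
      ext i
      exact mul_inv_cancel₀ (wt_ne_zero q n i))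
    (by
      simp only [spinGen, Matrix.diagonal_mul_diagonal]
      rw [← Matrix.diagonal_one]
      congr 1
      ext i
      exact inv_mul_cancel₀ (wt_ne_zero q n i))
    (by
      ext i j
      simp only [spinGen, Matrix.diagonal_mul, Matrix.smul_apply, Matrix.mul_diagonal,
        Matrix.of_apply, smul_eq_mul]
      split_ifs with h
      · rw [h, wt_succ]
        ring
      · simp)
    (by
      ext i j
      simp only [spinGen, Matrix.diagonal_mul, Matrix.smul_apply, Matrix.mul_diagonal,
        Matrix.of_apply, smul_eq_mul]
      split_ifs with h
      · rw [h, wt_succ]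
        ring
      · simp)
    (by
      ext i j
      by_cases hij : i = j
      · subst hij
        have h := spin_EF_diag q n i
        simp only [Matrix.sub_apply, Matrix.smul_apply, smul_eq_mul]
        rw [h]
        simp [spinGen]
      · have hv : (i : ℕ) ≠ j := fun h => hij (Fin.ext h)
        have hK : (spinGen q n .K * spinGen q n .K) i j = 0 := by simp [spinGen, hij]
        have hKi : (spinGen q n .Ki * spinGen q n .Ki) i j = 0 := by simp [spinGen, hij]
        simp only [Matrix.sub_apply, Matrix.smul_apply, smul_eq_mul]
        rw [hK, hKi, Matrix.mul_apply, Matrix.mul_apply, Finset.sum_eq_zero, Finset.sum_eq_zero]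
        · simp
        · intro k _
          simp only [spinGen, Matrix.of_apply]
          split_ifs <;> first | omega | simp
        · intro k _
          simp only [spinGen, Matrix.of_apply]
          split_ifs <;> first | omega | simp)

/-- The antipode as a homomorphism from the opposite algebra. -/
def uAntipodeOp (q : QParam) : (U q)ᵐᵒᵖ →ₐ[ℂ] U q := AlgHom.opComm (uAntipode q)

/-- Conjugation `f ↦ K⁻¹ f K`. -/
def conjK (q : QParam) : U q →ₐ[ℂ] U q where
  toFun f := uKi q * f * uK q
  map_one' := by rw [mul_one, uKi_K]
  map_mul' f g := by
    calc uKi q * (f * g) * uK q = uKi q * f * 1 * g * uK q := by noncomm_ring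
      _ = uKi q * f * (uK q * uKi q) * g * uK q := by rw [uK_Ki]
      _ = _ := by noncomm_ring
  map_zero' := by simp
  map_add' f g := by noncomm_ring
  commutes' r := by rw [← Algebra.commutes, mul_assoc, uKi_K, mul_one]

/-- The representation `ρ°_l(f) = σ_l(K⁻¹ S(f) K)` of the opposite algebra of `U_q(su_2)`,
where `l = n / 2`. -/
def rhoSpin (q : QParam) (n : ℕ) : (U q)ᵐᵒᵖ →ₐ[ℂ] Matrix (Fin (n + 1)) (Fin (n + 1)) ℂ :=
  ((spin q n).comp (conjK q)).comp (uAntipodeOp q)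

theorem rhoSpin_apply (q : QParam) (n : ℕ) (f : U q) :
    rhoSpin q n (op f) = spin q n (uKi q * unop (uAntipode q f) * uK q) := rfl

/-! ### The matrices of the quantum line bundles -/

/-- The `q`-factorial `[n]_q!`. -/
def qFactorial (q : QParam) (n : ℕ) : ℝ := ∏ i ∈ Finset.range n, qInt q ((i : ℤ) + 1)

/-- The square root of the Gaussian binomial coefficient
`q ^ (-i (n - i)) [n]_q! / ([i]_q! [n - i]_q!)`, which is the `q^(-2)`-binomial coefficient of
`n` over `i`. -/
def binomSqrt (q : QParam) (n i : ℕ) : ℂ :=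
  ((Real.sqrt ((q : ℝ) ^ (-((i : ℤ) * ((n : ℤ) - i))) *
    (qFactorial q n / (qFactorial q i * qFactorial q (n - i)))) : ℝ) : ℂ)

/-- The row `(t^l_{N/2,-l}, …, t^l_{N/2,l})`, `l = |N| / 2`, of the matrix of the spin-`l`
corepresentation. This is the last row (if `N ≥ 0`) or the first row (if `N ≤ 0`), with entries
`t^l_{l,k} = binom^(1/2) c^(l-k) d^(l+k)` and `t^l_{-l,k} = binom^(1/2) a^(l-k) b^(l+k)`.
The index `i` stands for `k = i - l`. -/
def tRow (q : QParam) (N : ℤ) (i : Fin (N.natAbs + 1)) : O q :=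
  if 0 ≤ N then binomSqrt q N.natAbs i • (oc q ^ (N.natAbs - i) * od q ^ (i : ℕ))
  else binomSqrt q N.natAbs i • (oa q ^ (N.natAbs - i) * ob q ^ (i : ℕ))

theorem dK2_tRow (q : QParam) (N : ℤ) (i : Fin (N.natAbs + 1)) :
    dK2 q (tRow q N i) = qc q ^ (-N) • tRow q N i := by
  have hq := qc_ne_zero q
  have hi : (i : ℕ) ≤ N.natAbs := by omega
  rw [tRow]
  split_ifs with h
  · simp only [map_smul, map_mul, map_pow, dK2_gen, smul_pow, smul_mul_smul_comm]
    rw [smul_comm, ← pow_add, Nat.sub_add_cancel hi, zpow_neg, inv_pow]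
    congr 2
    rw [← zpow_natCast, Int.natAbs_of_nonneg h]
  · simp only [map_smul, map_mul, map_pow, dK2_gen, smul_pow, smul_mul_smul_comm]
    rw [smul_comm, ← pow_add, Nat.sub_add_cancel hi]
    congr 1
    rw [← zpow_natCast, Int.ofNat_natAbs_of_nonpos (by omega)]

theorem dK2_oStar (q : QParam) (x : O q) (r : ℂ) (hr : r ≠ 0) (hc : (starRingEnd ℂ) r = r)
    (h : dK2 q x = r • x) : dK2 q (oStar q x) = r⁻¹ • oStar q x := by
  have h1 := dK2_oStar_key q x
  rw [h, Algebra.smul_def, oStar_mul, oStar_algebraMap, hc, ← Algebra.commutes,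
    ← Algebra.smul_def, map_smul] at h1
  calc dK2 q (oStar q x) = r⁻¹ • (r • dK2 q (oStar q x)) := by
        rw [smul_smul, inv_mul_cancel₀ hr, one_smul]
    _ = _ := by rw [h1]

theorem tRow_mem (q : QParam) (N : ℤ) (i j : Fin (N.natAbs + 1)) :
    oStar q (tRow q N i) * tRow q N j ∈ sphere q := by
  have hr : qc q ^ (-N) ≠ 0 := zpow_ne_zero _ (qc_ne_zero q)
  rw [mem_sphere, map_mul, dK2_tRow,
    dK2_oStar q _ _ hr (by rw [map_zpow₀, conj_qc]) (dK2_tRow q N i), smul_mul_smul_comm,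
    inv_mul_cancel₀ hr, one_smul]

/-- The matrix `t* t` with entries `(t^l_{N/2,i})* t^l_{N/2,j}` in `O(S_q^2)`, `l = |N| / 2`. -/
def tStarT (q : QParam) (N : ℤ) :
    Matrix (Fin (N.natAbs + 1)) (Fin (N.natAbs + 1)) (S2 q) :=
  Matrix.of fun i j => ⟨oStar q (tRow q N i) * tRow q N j, tRow_mem q N i j⟩

/-- A complex matrix, regarded as a matrix over an algebra. -/
def scalarMat {m n : Type*} (A : Type*) [Ring A] [Algebra ℂ A] (M : Matrix m n ℂ) :
    Matrix m n A := M.map (algebraMap ℂ A)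

/-- The matrix `P_N = ρ°_l(K⁻¹) t* t ρ°_l(K)`, `l = |N| / 2`. -/
def lineBundle (q : QParam) (N : ℤ) :
    Matrix (Fin (N.natAbs + 1)) (Fin (N.natAbs + 1)) (S2 q) :=
  scalarMat (S2 q) (rhoSpin q N.natAbs (op (uKi q))) * tStarT q N *
    scalarMat (S2 q) (rhoSpin q N.natAbs (op (uK q)))

/-! ### Twisted Hochschild and cyclic (co)homology in degree two

Throughout, `A` is a complex unital algebra with an automorphism `lam`, and
`C_n = A ⊗ (A ⊗ ( … ⊗ A))` with `n + 1` factors. -/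

section Twisted

/-- The subquotient `Z / (Z ∩ B)`. -/
abbrev Subquot {V : Type*} [AddCommGroup V] [Module ℂ V] (Z B : Submodule ℂ V) : Type _ :=
  ↥Z ⧸ B.comap Z.subtype

/-- The projection onto the subquotient. -/
def Subquot.mk {V : Type*} [AddCommGroup V] [Module ℂ V] (Z B : Submodule ℂ V) :
    ↥Z →ₗ[ℂ] Subquot Z B := (B.comap Z.subtype).mkQ

/-- Multiplication of the first two tensor factors. -/
def mulFirst (A M : Type*) [Ring A] [Algebra ℂ A] [AddCommGroup M] [Module ℂ M] :
    A ⊗[ℂ] (A ⊗[ℂ] M) →ₗ[ℂ] A ⊗[ℂ] M :=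
  TensorProduct.map (LinearMap.mul' ℂ A) LinearMap.id ∘ₗ
    (TensorProduct.assoc ℂ A A M).symm.toLinearMap

theorem mulFirst_tmul {A M : Type*} [Ring A] [Algebra ℂ A] [AddCommGroup M] [Module ℂ M]
    (a b : A) (m : M) : mulFirst A M (a ⊗ₜ (b ⊗ₜ m)) = (a * b) ⊗ₜ m := rfl

variable {A : Type*} [Ring A] [Algebra ℂ A] (lam : A ≃ₐ[ℂ] A)

/-- The twisted cyclic operator `a₀ ⊗ a₁ ↦ λ(a₁) ⊗ a₀`. -/
def tau1 : A ⊗[ℂ] A →ₗ[ℂ] A ⊗[ℂ] A :=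
  TensorProduct.map lam.toLinearMap LinearMap.id ∘ₗ (TensorProduct.comm ℂ A A).toLinearMap

/-- The twisted cyclic operator `a₀ ⊗ a₁ ⊗ a₂ ↦ λ(a₂) ⊗ a₀ ⊗ a₁`. -/
def tau2 : A ⊗[ℂ] (A ⊗[ℂ] A) →ₗ[ℂ] A ⊗[ℂ] (A ⊗[ℂ] A) :=
  TensorProduct.map lam.toLinearMap LinearMap.id ∘ₗ
    (TensorProduct.leftComm ℂ A A A).toLinearMap ∘ₗ
    LinearMap.lTensor A (TensorProduct.comm ℂ A A).toLinearMap

/-- The twisted cyclic operator `a₀ ⊗ a₁ ⊗ a₂ ⊗ a₃ ↦ λ(a₃) ⊗ a₀ ⊗ a₁ ⊗ a₂`. -/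
def tau3 : A ⊗[ℂ] (A ⊗[ℂ] (A ⊗[ℂ] A)) →ₗ[ℂ] A ⊗[ℂ] (A ⊗[ℂ] (A ⊗[ℂ] A)) :=
  TensorProduct.map lam.toLinearMap LinearMap.id ∘ₗ
    (TensorProduct.leftComm ℂ A A (A ⊗[ℂ] A)).toLinearMap ∘ₗ
    LinearMap.lTensor A ((TensorProduct.leftComm ℂ A A A).toLinearMap ∘ₗ
      LinearMap.lTensor A (TensorProduct.comm ℂ A A).toLinearMap)

theorem tau1_tmul (a₀ a₁ : A) : tau1 lam (a₀ ⊗ₜ a₁) = lam a₁ ⊗ₜ a₀ := rfl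

theorem tau2_tmul (a₀ a₁ a₂ : A) :
    tau2 lam (a₀ ⊗ₜ (a₁ ⊗ₜ a₂)) = lam a₂ ⊗ₜ (a₀ ⊗ₜ a₁) := rfl

theorem tau3_tmul (a₀ a₁ a₂ a₃ : A) :
    tau3 lam (a₀ ⊗ₜ (a₁ ⊗ₜ (a₂ ⊗ₜ a₃))) = lam a₃ ⊗ₜ (a₀ ⊗ₜ (a₁ ⊗ₜ a₂)) := rfl

/-- The twisted Hochschild boundary `b₂ : C₂ → C₁`. -/
def hochB2 : A ⊗[ℂ] (A ⊗[ℂ] A) →ₗ[ℂ] A ⊗[ℂ] A :=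
  mulFirst A A - LinearMap.lTensor A (LinearMap.mul' ℂ A) + mulFirst A A ∘ₗ tau2 lam

/-- The twisted Hochschild boundary `b₃ : C₃ → C₂`. -/
def hochB3 : A ⊗[ℂ] (A ⊗[ℂ] (A ⊗[ℂ] A)) →ₗ[ℂ] A ⊗[ℂ] (A ⊗[ℂ] A) :=
  mulFirst A (A ⊗[ℂ] A) - LinearMap.lTensor A (mulFirst A A) +
    LinearMap.lTensor A (LinearMap.lTensor A (LinearMap.mul' ℂ A)) -
    mulFirst A (A ⊗[ℂ] A) ∘ₗ tau3 lam

theorem hochB2_tmul (a₀ a₁ a₂ : A) :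
    hochB2 lam (a₀ ⊗ₜ (a₁ ⊗ₜ a₂)) =
      (a₀ * a₁) ⊗ₜ a₂ - a₀ ⊗ₜ (a₁ * a₂) + (lam a₂ * a₀) ⊗ₜ a₁ := rfl

theorem hochB3_tmul (a₀ a₁ a₂ a₃ : A) :
    hochB3 lam (a₀ ⊗ₜ (a₁ ⊗ₜ (a₂ ⊗ₜ a₃))) =
      (a₀ * a₁) ⊗ₜ (a₂ ⊗ₜ a₃) - a₀ ⊗ₜ ((a₁ * a₂) ⊗ₜ a₃) + a₀ ⊗ₜ (a₁ ⊗ₜ (a₂ * a₃)) -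
        (lam a₃ * a₀) ⊗ₜ (a₁ ⊗ₜ a₂) := rfl

/-- Cycles in `C₂` for the complex with entries `C_n / im (id - τ_n ^ (n + 1))`. -/
def hochCycles2 : Submodule ℂ (A ⊗[ℂ] (A ⊗[ℂ] A)) :=
  (LinearMap.range (LinearMap.id - tau1 lam ∘ₗ tau1 lam)).comap (hochB2 lam)

/-- Boundaries in `C₂` for the complex with entries `C_n / im (id - τ_n ^ (n + 1))`. -/
def hochBoundaries2 : Submodule ℂ (A ⊗[ℂ] (A ⊗[ℂ] A)) :=
  LinearMap.range (hochB3 lam) ⊔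
    LinearMap.range (LinearMap.id - tau2 lam ∘ₗ tau2 lam ∘ₗ tau2 lam)

/-- The twisted Hochschild homology `HH₂^λ(A)`. -/
abbrev HH2 : Type _ := Subquot (hochCycles2 lam) (hochBoundaries2 lam)

/-- Twisted cyclic 1-cochains: bilinear forms with `ψ = -ψ ∘ τ₁`. -/
def cyclicCochains1 : Submodule ℂ (A ⊗[ℂ] A →ₗ[ℂ] ℂ) where
  carrier := {ψ | ψ = -(ψ ∘ₗ tau1 lam)}
  add_mem' := by
    intro φ ψ h1 h2
    rw [Set.mem_ofPred_eq] at *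
    rw [LinearMap.add_comp, neg_add, ← h1, ← h2]
  zero_mem' := by simp
  smul_mem' := by
    intro r ψ h
    rw [Set.mem_ofPred_eq] at *
    rw [LinearMap.smul_comp, ← smul_neg, ← h]

/-- Twisted cyclic 2-cocycles: trilinear forms with `φ = φ ∘ τ₂` and `φ ∘ b₃ = 0`. -/
def cyclicCocycles2 : Submodule ℂ (A ⊗[ℂ] (A ⊗[ℂ] A) →ₗ[ℂ] ℂ) where
  carrier := {φ | φ = φ ∘ₗ tau2 lam ∧ φ ∘ₗ hochB3 lam = 0}
  add_mem' := by
    intro φ ψ h1 h2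
    rw [Set.mem_ofPred_eq] at *
    rw [LinearMap.add_comp, LinearMap.add_comp, ← h1.1, ← h2.1, h1.2, h2.2]
    simp
  zero_mem' := by simp
  smul_mem' := by
    intro r ψ h
    rw [Set.mem_ofPred_eq] at *
    rw [LinearMap.smul_comp, LinearMap.smul_comp, ← h.1, h.2]
    simp

/-- Twisted cyclic 2-coboundaries `ψ ∘ b₂` of twisted cyclic 1-cochains `ψ`. -/
def cyclicCoboundaries2 : Submodule ℂ (A ⊗[ℂ] (A ⊗[ℂ] A) →ₗ[ℂ] ℂ) :=
  (cyclicCochains1 lam).map (LinearMap.lcomp ℂ ℂ (hochB2 lam))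

/-- The twisted cyclic cohomology `HC²_λ(A)`. -/
abbrev HC2 : Type _ := Subquot (cyclicCocycles2 lam) (cyclicCoboundaries2 lam)

/-- The class of a twisted cyclic 2-cocycle. -/
def HC2.mk (φ : A ⊗[ℂ] (A ⊗[ℂ] A) →ₗ[ℂ] ℂ) (h : φ ∈ cyclicCocycles2 lam) : HC2 lam :=
  Subquot.mk _ _ ⟨φ, h⟩

/-- The linear form `φ` on `C₂` descends to a non-zero functional on `HH₂^λ(A)`. -/
def NontrivialOnHH2 (φ : A ⊗[ℂ] (A ⊗[ℂ] A) →ₗ[ℂ] ℂ) : Prop :=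
  ∃ Φ : HH2 lam →ₗ[ℂ] ℂ, (∀ η, Φ (Subquot.mk _ _ η) = φ η.1) ∧ Φ ≠ 0

/-- The quantum trace `Tr_λ(X ⊗ X ⊗ X) = ∑ R_{j₃ j₀} X_{j₀ j₁} ⊗ X_{j₁ j₂} ⊗ X_{j₂ j₃}`, where
`R` is the matrix by which the group-like element describing `λ` acts. -/
def quantumTrace {n : Type*} [Fintype n] (R : Matrix n n ℂ) (X : Matrix n n A) :
    A ⊗[ℂ] (A ⊗[ℂ] A) :=
  ∑ j₀, ∑ j₁, ∑ j₂, ∑ j₃, R j₃ j₀ • (X j₀ j₁ ⊗ₜ[ℂ] (X j₁ j₂ ⊗ₜ[ℂ] X j₂ j₃))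

/-! Auxiliary facts needed for the pairing to be well defined. -/

theorem scalarMat_apply {m n : Type*} (M : Matrix m n ℂ) (i : m) (j : n) :
    scalarMat A M i j = algebraMap ℂ A (M i j) := rfl

/-- The untwisted trace `∑ X_{ij} ⊗ Y_{jk} ⊗ Z_{ki}`. -/
def trace3 {m n l : Type*} [Fintype m] [Fintype n] [Fintype l] (X : Matrix m n A)
    (Y : Matrix n l A) (Z : Matrix l m A) : A ⊗[ℂ] (A ⊗[ℂ] A) :=
  ∑ i, ∑ j, ∑ k, X i j ⊗ₜ[ℂ] (Y j k ⊗ₜ[ℂ] Z k i)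

theorem sum4_comm {M ι₁ ι₂ ι₃ ι₄ : Type*} [AddCommMonoid M] [Fintype ι₁] [Fintype ι₂] [Fintype ι₃]
    [Fintype ι₄] (f : ι₁ → ι₂ → ι₃ → ι₄ → M) :
    ∑ a, ∑ b, ∑ c, ∑ d, f a b c d = ∑ d, ∑ a, ∑ b, ∑ c, f a b c d := by
  rw [Finset.sum_comm (s := (Finset.univ : Finset ι₄))]
  refine Finset.sum_congr rfl fun a _ => ?_
  rw [Finset.sum_comm (s := (Finset.univ : Finset ι₄))]
  refine Finset.sum_congr rfl fun b _ => ?_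
  rw [Finset.sum_comm]

theorem sum3_comm {M ι₁ ι₂ ι₃ : Type*} [AddCommMonoid M] [Fintype ι₁] [Fintype ι₂] [Fintype ι₃]
    (f : ι₁ → ι₂ → ι₃ → M) :
    ∑ a, ∑ b, ∑ c, f a b c = ∑ c, ∑ a, ∑ b, f a b c := by
  rw [Finset.sum_comm (s := (Finset.univ : Finset ι₃))]
  refine Finset.sum_congr rfl fun a _ => ?_
  rw [Finset.sum_comm]

theorem quantumTrace_eq {n : Type*} [Fintype n] (R : Matrix n n ℂ) (X : Matrix n n A) :
    quantumTrace R X = trace3 (scalarMat A R * X) X X := by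
  simp only [quantumTrace, trace3, Matrix.mul_apply, scalarMat_apply, TensorProduct.sum_tmul,
    ← Algebra.smul_def, ← TensorProduct.smul_tmul']
  rw [sum4_comm]
  refine Finset.sum_congr rfl fun i _ => ?_
  rw [sum3_comm, sum3_comm]

variable {m n l p : Type*} [Fintype m] [Fintype n] [Fintype l] [Fintype p]

theorem trace3_scalar (X : Matrix m n A) (R : Matrix n p ℂ) (Y : Matrix p l A)
    (Z : Matrix l m A) :
    trace3 X (scalarMat A R * Y) Z = trace3 (X * scalarMat A R) Y Z := by
  simp only [trace3, Matrix.mul_apply, scalarMat_apply, TensorProduct.sum_tmul,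
    TensorProduct.tmul_sum, ← Algebra.smul_def, ← TensorProduct.smul_tmul', ← Algebra.commutes,
    TensorProduct.tmul_smul]
  refine Finset.sum_congr rfl fun i _ => ?_
  rw [sum3_comm]
  refine Finset.sum_congr rfl fun j _ => ?_
  rw [Finset.sum_comm]

theorem trace3_cyclic {φ : A ⊗[ℂ] (A ⊗[ℂ] A) →ₗ[ℂ] ℂ} (h : φ = φ ∘ₗ tau2 lam)
    (X : Matrix m n A) (Y : Matrix n l A) (Z : Matrix l m A) :
    φ (trace3 X Y Z) = φ (trace3 (Z.map lam) X Y) := by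
  rw [h, LinearMap.comp_apply, ← h]
  congr 1
  simp only [trace3, map_sum, tau2_tmul, Matrix.map_apply]
  rw [sum3_comm]

theorem trace3_cocycle {φ : A ⊗[ℂ] (A ⊗[ℂ] A) →ₗ[ℂ] ℂ} (h : φ ∘ₗ hochB3 lam = 0)
    (X : Matrix m n A) (Y : Matrix n l A) (Z : Matrix l p A) (W : Matrix p m A) :
    φ (trace3 (X * Y) Z W) - φ (trace3 X (Y * Z) W) + φ (trace3 X Y (Z * W)) -
      φ (trace3 (W.map lam * X) Y Z) = 0 := by
  have h1 := LinearMap.congr_fun h (∑ i, ∑ j, ∑ k, ∑ r,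
    X i j ⊗ₜ[ℂ] (Y j k ⊗ₜ[ℂ] (Z k r ⊗ₜ[ℂ] W r i)))
  simp only [LinearMap.comp_apply, map_sum, hochB3_tmul, LinearMap.zero_apply, map_sub, map_add,
    Finset.sum_sub_distrib, Finset.sum_add_distrib, Finset.sum_const_zero] at h1
  rw [← h1]
  simp only [trace3, Matrix.mul_apply, TensorProduct.sum_tmul, TensorProduct.tmul_sum, map_sum,
    Matrix.map_apply]
  congr 1
  · congr 1
    · congr 1
      · refine Finset.sum_congr rfl fun i _ => ?_
        rw [sum3_comm]
      · refine Finset.sum_congr rfl fun i _ => ?_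
        refine Finset.sum_congr rfl fun j _ => ?_
        rw [Finset.sum_comm]
  · conv_rhs => rw [sum4_comm]
    refine Finset.sum_congr rfl fun i _ => ?_
    rw [sum3_comm]

end Twisted

section Invariance

variable {A : Type*} [Ring A] [Algebra ℂ A] (lam : A ≃ₐ[ℂ] A)
variable {m n : Type*} [Fintype m] [Fintype n]

theorem trace3_equiv_aux {φ : A ⊗[ℂ] (A ⊗[ℂ] A) →ₗ[ℂ] ℂ} (h : φ ∈ cyclicCocycles2 lam)
    (R : Matrix m m ℂ) {x : Matrix m n A} {y : Matrix n m A} {Q : Matrix m m A}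
    (hxy : x * y = Q) (hQ : Q * Q = Q) (hQx : Q * x = x) (hyQ : y * Q = y)
    (hR : scalarMat A R * Q = Q.map lam * scalarMat A R) :
    φ (trace3 (scalarMat A R * Q) Q Q) = φ (trace3 (scalarMat A R * x) y Q) := by
  have h1 := trace3_cocycle lam h.2 (scalarMat A R * x) y Q Q
  rw [Matrix.mul_assoc, hxy, hyQ, hQ, ← Matrix.mul_assoc, ← hR, Matrix.mul_assoc, hQx] at h1
  linear_combination h1

theorem trace3_cyclic_scalar {φ : A ⊗[ℂ] (A ⊗[ℂ] A) →ₗ[ℂ] ℂ} (h : φ ∈ cyclicCocycles2 lam)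
    {l : Type*} [Fintype l]
    (R : Matrix m m ℂ) (S : Matrix l l ℂ) (X : Matrix m n A) (Y : Matrix n l A)
    (Z : Matrix l m A) (hZ : scalarMat A S * Z = Z.map lam * scalarMat A R) :
    φ (trace3 (scalarMat A R * X) Y Z) = φ (trace3 (scalarMat A S * Z) X Y) := by
  rw [trace3_cyclic lam h.1, trace3_scalar, hZ]

theorem quantumTrace_equiv {φ : A ⊗[ℂ] (A ⊗[ℂ] A) →ₗ[ℂ] ℂ} (h : φ ∈ cyclicCocycles2 lam)
    (R₁ : Matrix n n ℂ) (R₂ : Matrix m m ℂ) {x : Matrix m n A} {y : Matrix n m A}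
    {P : Matrix n n A} {Q : Matrix m m A}
    (hxy : x * y = Q) (hyx : y * x = P) (hP : P * P = P) (hQ : Q * Q = Q)
    (hQx : Q * x = x) (hyQ : y * Q = y) (hxP : x * P = x) (hPy : P * y = y)
    (hRP : scalarMat A R₁ * P = P.map lam * scalarMat A R₁)
    (hRQ : scalarMat A R₂ * Q = Q.map lam * scalarMat A R₂)
    (hRy : scalarMat A R₁ * y = y.map lam * scalarMat A R₂) :
    φ (quantumTrace R₁ P) = φ (quantumTrace R₂ Q) := by
  rw [quantumTrace_eq, quantumTrace_eq, trace3_equiv_aux lam h R₂ hxy hQ hQx hyQ hRQ,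
    trace3_equiv_aux lam h R₁ hyx hP hPy hxP hRP]
  have h1 := trace3_cocycle lam h.2 (scalarMat A R₂ * x) y x y
  rw [Matrix.mul_assoc, hxy, hyx, ← Matrix.mul_assoc, ← hRy, Matrix.mul_assoc, hyx] at h1
  have h2 := trace3_cyclic_scalar lam h R₂ R₂ x y Q hRQ
  have h3 := trace3_cyclic_scalar lam h R₂ R₁ x P y hRy
  have h4 := trace3_cyclic_scalar lam h R₁ R₁ y x P hRP
  linear_combination (-1 / 2 : ℂ) * h1 - (1 / 2 : ℂ) * h2 - (1 / 2 : ℂ) * h3 + (1 / 2 : ℂ) * h4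

/-- The untwisted trace `∑ X_{ij} ⊗ Y_{ji}`. -/
def trace2 (X : Matrix m n A) (Y : Matrix n m A) : A ⊗[ℂ] A :=
  ∑ i, ∑ j, X i j ⊗ₜ[ℂ] Y j i

theorem hochB2_trace3 {l : Type*} [Fintype l] (X : Matrix m n A) (Y : Matrix n l A)
    (Z : Matrix l m A) :
    hochB2 lam (trace3 X Y Z) =
      trace2 (X * Y) Z - trace2 X (Y * Z) + trace2 (Z.map lam * X) Y := by
  simp only [trace2, trace3, map_sum, hochB2_tmul, Matrix.mul_apply, TensorProduct.sum_tmul,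
    TensorProduct.tmul_sum, Matrix.map_apply, Finset.sum_sub_distrib, Finset.sum_add_distrib]
  congr 1
  · congr 1
    refine Finset.sum_congr rfl fun i _ => ?_
    rw [Finset.sum_comm]
  · rw [sum3_comm]
    refine Finset.sum_congr rfl fun i _ => ?_
    rw [Finset.sum_comm]

theorem trace2_scalar (X : Matrix m n A) (R : Matrix n n ℂ) (Y : Matrix n m A) :
    trace2 X (scalarMat A R * Y) = trace2 (X * scalarMat A R) Y := by
  simp only [trace2, Matrix.mul_apply, scalarMat_apply, TensorProduct.sum_tmul,
    TensorProduct.tmul_sum, ← Algebra.smul_def, ← TensorProduct.smul_tmul', ← Algebra.commutes,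
    TensorProduct.tmul_smul]
  refine Finset.sum_congr rfl fun i _ => ?_
  rw [Finset.sum_comm]

theorem quantumTrace_coboundary {φ : A ⊗[ℂ] (A ⊗[ℂ] A) →ₗ[ℂ] ℂ}
    (h : φ ∈ cyclicCoboundaries2 lam) (R : Matrix n n ℂ) {P : Matrix n n A} (hP : P * P = P)
    (hRP : scalarMat A R * P = P.map lam * scalarMat A R) : φ (quantumTrace R P) = 0 := by
  obtain ⟨ψ, hψ, rfl⟩ := h
  have hψ : ψ = -(ψ ∘ₗ tau1 lam) := hψ
  have h1 : ψ (trace2 (scalarMat A R * P) P) = -ψ (trace2 (scalarMat A R * P) P) := by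
    have h2 : trace2 (P.map lam) (scalarMat A R * P) = trace2 (scalarMat A R * P) P := by
      rw [trace2_scalar, hRP]
    conv_lhs => rw [hψ]
    rw [LinearMap.neg_apply, LinearMap.comp_apply]
    conv_rhs => rw [← h2]
    simp only [trace2, map_sum, tau1_tmul]
    rw [Finset.sum_comm]
    rfl
  rw [quantumTrace_eq, LinearMap.lcomp_apply, hochB2_trace3, Matrix.mul_assoc, hP,
    ← Matrix.mul_assoc, ← hRP, Matrix.mul_assoc, hP, sub_self, zero_add]
  linear_combination (1 / 2 : ℂ) * h1

theorem quantumTrace_reindex (e : m ≃ n) (R : Matrix m m ℂ) (X : Matrix m m A) :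
    quantumTrace (R.submatrix e.symm e.symm) (X.submatrix e.symm e.symm) =
      quantumTrace R X := by
  simp only [quantumTrace, Matrix.submatrix_apply]
  rw [Equiv.sum_comp e.symm fun j₀ => ∑ j₁, ∑ j₂, ∑ j₃,
    R (e.symm j₃) j₀ • (X j₀ (e.symm j₁) ⊗ₜ[ℂ] (X (e.symm j₁) (e.symm j₂) ⊗ₜ[ℂ]
      X (e.symm j₂) (e.symm j₃)))]
  refine Finset.sum_congr rfl fun j₀ _ => ?_
  rw [Equiv.sum_comp e.symm fun j₁ => ∑ j₂, ∑ j₃,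
    R (e.symm j₃) j₀ • (X j₀ j₁ ⊗ₜ[ℂ] (X j₁ (e.symm j₂) ⊗ₜ[ℂ] X (e.symm j₂) (e.symm j₃)))]
  refine Finset.sum_congr rfl fun j₁ _ => ?_
  rw [Equiv.sum_comp e.symm fun j₂ => ∑ j₃,
    R (e.symm j₃) j₀ • (X j₀ j₁ ⊗ₜ[ℂ] (X j₁ j₂ ⊗ₜ[ℂ] X j₂ (e.symm j₃)))]
  refine Finset.sum_congr rfl fun j₂ _ => ?_
  rw [Equiv.sum_comp e.symm fun j₃ => R j₃ j₀ • (X j₀ j₁ ⊗ₜ[ℂ] (X j₁ j₂ ⊗ₜ[ℂ] X j₂ j₃))]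

theorem quantumTrace_fromBlocks (R : Matrix m m ℂ) (X : Matrix m m A) (S : Matrix n n ℂ)
    (Y : Matrix n n A) :
    quantumTrace (Matrix.fromBlocks R 0 0 S) (Matrix.fromBlocks X 0 0 Y) =
      quantumTrace R X + quantumTrace S Y := by
  simp [quantumTrace, Fintype.sum_sum_type]

end Invariance

/-! ### Equivariant `K₀`-theory -/

/-- The inverse of the antipode as a linear map. -/
def sInv (q : QParam) : U q →ₗ[ℂ] U q :=
  (MulOpposite.opLinearEquiv ℂ).symm.toLinearMap ∘ₗ (uAntipodeInv q).toLinearMap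

/-- The iterated comultiplication `f ↦ f₍₁₎ ⊗ f₍₂₎ ⊗ f₍₃₎`. -/
def uComul2 (q : QParam) : U q →ₗ[ℂ] U q ⊗[ℂ] (U q ⊗[ℂ] U q) :=
  LinearMap.lTensor (U q) (uComul q).toLinearMap ∘ₗ (uComul q).toLinearMap

/-- The linear map `f ↦ ρ°(f)` with values in matrices over `O(SU_q(2))`. -/
def rhoMat {q : QParam} {n : ℕ} (rho : (U q)ᵐᵒᵖ →ₐ[ℂ] Matrix (Fin n) (Fin n) ℂ) :
    U q →ₗ[ℂ] Matrix (Fin n) (Fin n) (O q) where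
  toFun f := scalarMat (O q) (rho (op f))
  map_add' f g := by
    ext i j
    simp [scalarMat]
  map_smul' r f := by
    ext i j
    rw [MulOpposite.op_smul, map_smul]
    change algebraMap ℂ (O q) (r * rho (op f) i j) = r • algebraMap ℂ (O q) (rho (op f) i j)
    rw [map_mul, ← Algebra.smul_def]

/-- The entrywise action `f ↦ f ▷ X` on matrices. -/
def actMat {q : QParam} {m n : ℕ} (X : Matrix (Fin m) (Fin n) (S2 q)) :
    U q →ₗ[ℂ] Matrix (Fin m) (Fin n) (O q) where
  toFun f := X.map fun x => act q f (x : O q)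
  map_add' f g := by
    ext i j
    simp
  map_smul' r f := by
    ext i j
    simp

/-- The right adjoint action `ad_R°(f)(X) = ρ°(S⁻¹(f₍₁₎)) (S⁻²(f₍₂₎) ▷ X) ρ°(f₍₃₎)`. -/
def adR {q : QParam} {n : ℕ} (rho : (U q)ᵐᵒᵖ →ₐ[ℂ] Matrix (Fin n) (Fin n) ℂ)
    (X : Matrix (Fin n) (Fin n) (S2 q)) : U q →ₗ[ℂ] Matrix (Fin n) (Fin n) (O q) :=
  LinearMap.mul' ℂ _ ∘ₗ
    TensorProduct.map (rhoMat rho ∘ₗ sInv q)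
      (LinearMap.mul' ℂ _ ∘ₗ
        TensorProduct.map (actMat X ∘ₗ sInv q ∘ₗ sInv q) (rhoMat rho)) ∘ₗ
    uComul2 q

/-- The involution `X† = (θ⁻¹(X))*` of matrices over `O(S_q^2)`. -/
def dagger {q : QParam} {m n : ℕ} (X : Matrix (Fin m) (Fin n) (S2 q)) :
    Matrix (Fin n) (Fin m) (S2 q) :=
  Matrix.of fun i j => s2Star q (thetaInv q (X j i))

/-- `P` is an `ad_R°`-invariant projection with respect to the *-representation `ρ°` of the
opposite algebra of `U_q(su_2)`. -/
structure IsInvProj (q : QParam) {n : ℕ} (rho : (U q)ᵐᵒᵖ →ₐ[ℂ] Matrix (Fin n) (Fin n) ℂ)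
    (P : Matrix (Fin n) (Fin n) (S2 q)) : Prop where
  star_rep : ∀ f : U q, rho (op (uStar q f)) = (rho (op f)).conjTranspose
  idem : P * P = P
  selfAdj : dagger P = P
  inv : ∀ f : U q, adR rho P f = uCounit q f • P.map fun x => (x : O q)

/-- An invariant projection of any size, together with its *-representation. -/
structure InvProj (q : QParam) where
  n : ℕ
  rho : (U q)ᵐᵒᵖ →ₐ[ℂ] Matrix (Fin n) (Fin n) ℂ
  P : Matrix (Fin n) (Fin n) (S2 q)
  isInvProj : IsInvProj q rho P

/-- The action `π°(f)(b) = ρ°(f₍₂₎) (S⁻¹(f₍₁₎) ▷ b)` on column vectors. -/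
def piAct {q : QParam} {n : ℕ} (rho : (U q)ᵐᵒᵖ →ₐ[ℂ] Matrix (Fin n) (Fin n) ℂ)
    (b : Fin n → S2 q) : U q →ₗ[ℂ] (Fin n → O q) :=
  TensorProduct.lift
    (LinearMap.mk₂ ℂ (fun f g => (rhoMat rho g).mulVec fun i => act q (sInv q f) (b i : O q))
      (by
        intro f g h
        rw [← Matrix.mulVec_add]
        congr 1
        ext i
        simp)
      (by
        intro r f h
        rw [← Matrix.mulVec_smul]
        congr 1
        ext i
        simp)
      (by
        intro f g h
        rw [map_add, Matrix.add_mulVec])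
      (by
        intro r f h
        rw [map_smul, Matrix.smul_mulVec])) ∘ₗ (uComul q).toLinearMap

/-- Murray-von Neumann equivalence of invariant projections. -/
def MvN {q : QParam} (p₁ p₂ : InvProj q) : Prop :=
  ∃ V : Matrix (Fin p₂.n) (Fin p₁.n) (S2 q),
    dagger V * V = p₁.P ∧ V * dagger V = p₂.P ∧
      ∀ (f : U q) (b : Fin p₁.n → S2 q),
        piAct p₂.rho (V.mulVec b) f = (V.map fun x => (x : O q)).mulVec (piAct p₁.rho b f)

/-- `r` is the direct sum of `p₁` and `p₂` (with respect to some enumeration of the indices). -/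
def IsDirectSum {q : QParam} (p₁ p₂ r : InvProj q) : Prop :=
  ∃ e : Fin p₁.n ⊕ Fin p₂.n ≃ Fin r.n,
    (∀ f, r.rho f = (Matrix.fromBlocks (p₁.rho f) 0 0 (p₂.rho f)).submatrix e.symm e.symm) ∧
      r.P = (Matrix.fromBlocks p₁.P 0 0 p₂.P).submatrix e.symm e.symm

/-- The relations that turn the free abelian group on all invariant projections into the
Grothendieck group of the semigroup of Murray-von Neumann classes. -/
def k0Relations (q : QParam) : AddSubgroup (FreeAbelianGroup (InvProj q)) :=
  AddSubgroup.closure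
    ({x | ∃ p₁ p₂, MvN p₁ p₂ ∧ x = FreeAbelianGroup.of p₁ - FreeAbelianGroup.of p₂} ∪
      {x | ∃ p₁ p₂ r, IsDirectSum p₁ p₂ r ∧
        x = FreeAbelianGroup.of r - (FreeAbelianGroup.of p₁ + FreeAbelianGroup.of p₂)})

/-- The equivariant `K₀`-group of `O(S_q^2)`: the Grothendieck group of the additive semigroup
of Murray-von Neumann classes of invariant projections with addition `[P] + [Q] = [P ⊕ Q]`. -/
abbrev K0 (q : QParam) : Type := FreeAbelianGroup (InvProj q) ⧸ k0Relations q

/-- The class of an invariant projection. -/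
def K0.mk {q : QParam} (p : InvProj q) : K0 q :=
  QuotientAddGroup.mk (FreeAbelianGroup.of p)

/-! ### The Chern-Connes pairing -/

/-- The matrix `ρ°(K²)`. -/
def InvProj.R {q : QParam} (p : InvProj q) : Matrix (Fin p.n) (Fin p.n) ℂ :=
  p.rho (op (uK q * uK q))

theorem uComul_K2 (q : QParam) :
    uComul q (uK q * uK q) = (uK q * uK q) ⊗ₜ (uK q * uK q) := by
  rw [map_mul, uComul, uLift_gen, Algebra.TensorProduct.tmul_mul_tmul]

theorem sInv_K2 (q : QParam) : sInv q (uK q * uK q) = uKi q * uKi q := by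
  change unop (uAntipodeInv q (uK q * uK q)) = _
  rw [map_mul, uAntipodeInv, uLift_gen]
  rfl

theorem sInv_Ki2 (q : QParam) : sInv q (uKi q * uKi q) = uK q * uK q := by
  change unop (uAntipodeInv q (uKi q * uKi q)) = _
  rw [map_mul, uAntipodeInv, uLift_gen]
  rfl

theorem uCounit_K2 (q : QParam) : uCounit q (uK q * uK q) = 1 := by
  rw [map_mul, uCounit, uLift_gen]
  simp

theorem uStar_K2 (q : QParam) : uStar q (uK q * uK q) = uK q * uK q := by
  have h : uStarHom q (uK q) = op (uK q) := by
    change RingQuot.lift _ (RingQuot.mkAlgHom ℂ (URel q) (FreeAlgebra.ι ℂ UGen.K)) = _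
    rw [ringQuot_lift_mkAlgHom, conjLift_ι]
  rw [uStar, map_mul, h]
  rfl

theorem K2_mul_Ki2 (q : QParam) : (uK q * uK q) * (uKi q * uKi q) = 1 := by
  rw [mul_assoc, ← mul_assoc (uK q) (uKi q), uK_Ki, one_mul, uK_Ki]

theorem InvProj.R_conj {q : QParam} (p : InvProj q) : p.R.conjTranspose = p.R := by
  rw [InvProj.R, ← p.isInvProj.star_rep, uStar_K2]

theorem scalarMat_mul {l m n : Type*} [Fintype m] {A : Type*} [Ring A] [Algebra ℂ A]
    (M : Matrix l m ℂ) (N : Matrix m n ℂ) :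
    scalarMat A (M * N) = scalarMat A M * scalarMat A N := Matrix.map_mul

theorem InvProj.R_P {q : QParam} (p : InvProj q) :
    scalarMat (S2 q) p.R * p.P = p.P.map (thetaInv q) * scalarMat (S2 q) p.R := by
  have h := p.isInvProj.inv (uK q * uK q)
  have h1 : adR p.rho p.P (uK q * uK q) = scalarMat (O q) (p.rho (op (uKi q * uKi q))) *
      (p.P.map (fun x => act q (uK q * uK q) (x : O q)) * scalarMat (O q) p.R) := by
    have hc : uComul2 q (uK q * uK q) =
        (uK q * uK q) ⊗ₜ ((uK q * uK q) ⊗ₜ (uK q * uK q)) := by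
      rw [uComul2, LinearMap.comp_apply, AlgHom.toLinearMap_apply, uComul_K2,
        LinearMap.lTensor_tmul, AlgHom.toLinearMap_apply, uComul_K2]
    rw [adR, LinearMap.comp_apply, LinearMap.comp_apply, hc]
    change scalarMat (O q) (p.rho (op (sInv q _))) * (((p.P.map
      fun x => act q (sInv q (sInv q _)) (x : O q))) * scalarMat (O q) (p.rho (op _))) = _
    rw [sInv_K2, sInv_Ki2]
    rfl
  have h2 : p.R * p.rho (op (uKi q * uKi q)) = 1 := by
    rw [InvProj.R, ← map_mul, ← MulOpposite.op_mul]
    have : (uKi q * uKi q) * (uK q * uK q) = 1 := by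
      rw [mul_assoc, ← mul_assoc (uKi q) (uK q), uKi_K, one_mul, uKi_K]
    rw [this]
    simp
  rw [h1, uCounit_K2, one_smul] at h
  have h3 := congrArg (fun M => scalarMat (O q) p.R * M) h
  rw [← Matrix.mul_assoc, ← scalarMat_mul, h2] at h3
  have h4 : scalarMat (O q) (1 : Matrix (Fin p.n) (Fin p.n) ℂ) = 1 :=
    Matrix.map_one _ (map_zero _) (map_one _)
  rw [h4, one_mul] at h3
  ext i j
  change (sphere q).val _ = (sphere q).val _
  have h5 := congrFun (congrFun h3 i) j
  simp only [Matrix.mul_apply, map_sum, map_mul, Matrix.map_apply, scalarMat_apply,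
    AlgHom.commutes] at h5 ⊢
  simp only [Subalgebra.coe_val, thetaInv_apply, map_mul]
  exact h5.symm

theorem piAct_K2 {q : QParam} {n : ℕ} (rho : (U q)ᵐᵒᵖ →ₐ[ℂ] Matrix (Fin n) (Fin n) ℂ)
    (b : Fin n → S2 q) (i : Fin n) :
    piAct rho b (uK q * uK q) i =
      ∑ k, algebraMap ℂ (O q) (rho (op (uK q * uK q)) i k) *
        ((thetaInv q).symm (b k) : O q) := by
  rw [piAct, LinearMap.comp_apply, AlgHom.toLinearMap_apply, uComul_K2, TensorProduct.lift.tmul,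
    LinearMap.mk₂_apply, sInv_K2]
  simp only [thetaInv_symm_apply]
  rfl

theorem MvN.intertwine {q : QParam} {p₁ p₂ : InvProj q}
    {V : Matrix (Fin p₂.n) (Fin p₁.n) (S2 q)}
    (h : ∀ (f : U q) (b : Fin p₁.n → S2 q),
        piAct p₂.rho (V.mulVec b) f = (V.map fun x => (x : O q)).mulVec (piAct p₁.rho b f)) :
    scalarMat (S2 q) p₂.R * V = V.map (thetaInv q) * scalarMat (S2 q) p₁.R := by
  ext i j
  congr 1
  have h1 := congrFun (h (uK q * uK q) (Pi.single j 1)) i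
  rw [piAct_K2, Matrix.mulVec, dotProduct] at h1
  simp only [piAct_K2, Matrix.mulVec_single, Matrix.map_apply] at h1
  have h2 : ∑ k, algebraMap ℂ (S2 q) (p₂.R i k) * (thetaInv q).symm (V k j) =
      ∑ k, V i k * algebraMap ℂ (S2 q) (p₁.R k j) := by
    apply Subtype.ext
    change (sphere q).val _ = (sphere q).val _
    simp only [map_sum, map_mul, AlgHom.commutes]
    refine Eq.trans ?_ (h1.trans ?_)
    · refine Finset.sum_congr rfl fun k _ => ?_
      simp [InvProj.R]
    · refine Finset.sum_congr rfl fun k _ => ?_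
      rw [Finset.sum_eq_single j]
      · simp [InvProj.R]
      · intro l _ hl
        simp [hl]
      · simp
  have h3 := congrArg (thetaInv q) h2
  simpa [Matrix.mul_apply, scalarMat_apply] using h3

theorem dagger_intertwine {q : QParam} {m n : ℕ} {V : Matrix (Fin m) (Fin n) (S2 q)}
    {R₁ : Matrix (Fin n) (Fin n) ℂ} {R₂ : Matrix (Fin m) (Fin m) ℂ}
    (h₁ : R₁.conjTranspose = R₁) (h₂ : R₂.conjTranspose = R₂)
    (h : scalarMat (S2 q) R₂ * V = V.map (thetaInv q) * scalarMat (S2 q) R₁) :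
    scalarMat (S2 q) R₁ * dagger V = (dagger V).map (thetaInv q) * scalarMat (S2 q) R₂ := by
  ext j i
  have h3 := congrArg (s2Star q) (congrFun (congrFun h i) j)
  simp only [Matrix.mul_apply, s2Star_sum, s2Star_mul, scalarMat_apply, s2Star_algebraMap,
    Matrix.map_apply] at h3
  have h4 : ∀ a b, starRingEnd ℂ (R₁ a b) = R₁ b a := fun a b => by
    conv_rhs => rw [← h₁]
    rfl
  have h5 : ∀ a b, starRingEnd ℂ (R₂ a b) = R₂ b a := fun a b => by
    conv_rhs => rw [← h₂]
    rfl
  simp only [h4, h5] at h3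
  simp only [Matrix.mul_apply, scalarMat_apply, Matrix.map_apply, dagger, Matrix.of_apply,
    s2Star_thetaInv]
  exact congrArg Subtype.val h3.symm

/-- The value `-2 Φ(Tr_λ(P ⊗ P ⊗ P))` (with `λ = θ⁻¹` and `k = K²`) of the pairing as a linear
form in `Φ`. -/
def chernForm {q : QParam} (p : InvProj q) : (S2 q ⊗[ℂ] (S2 q ⊗[ℂ] S2 q) →ₗ[ℂ] ℂ) →ₗ[ℂ] ℂ :=
  (-2 : ℂ) • LinearMap.applyₗ (quantumTrace p.R p.P)

theorem chernForm_apply {q : QParam} (p : InvProj q)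
    (Φ : S2 q ⊗[ℂ] (S2 q ⊗[ℂ] S2 q) →ₗ[ℂ] ℂ) :
    chernForm p Φ = -2 * Φ (quantumTrace p.R p.P) := rfl

/-- The linear form `[Φ] ↦ -2 Φ(Tr_λ(P ⊗ P ⊗ P))` on twisted cyclic cohomology. -/
def chernClass {q : QParam} (p : InvProj q) : HC2 (thetaInv q) →ₗ[ℂ] ℂ :=
  Submodule.liftQ _ (chernForm p ∘ₗ (cyclicCocycles2 (thetaInv q)).subtype) (by
    intro Φ hΦ
    rw [LinearMap.mem_ker, LinearMap.comp_apply, chernForm_apply,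
      quantumTrace_coboundary (thetaInv q) hΦ p.R p.isInvProj.idem p.R_P, mul_zero])

theorem chernClass_mk {q : QParam} (p : InvProj q) (Φ : S2 q ⊗[ℂ] (S2 q ⊗[ℂ] S2 q) →ₗ[ℂ] ℂ)
    (h : Φ ∈ cyclicCocycles2 (thetaInv q)) :
    chernClass p (HC2.mk _ Φ h) = -2 * Φ (quantumTrace p.R p.P) := rfl

theorem chernClass_MvN {q : QParam} {p₁ p₂ : InvProj q} (h : MvN p₁ p₂) :
    chernClass p₁ = chernClass p₂ := by
  obtain ⟨V, h1, h2, h3⟩ := h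
  have hV := MvN.intertwine h3
  have hVd := dagger_intertwine p₁.R_conj p₂.R_conj hV
  have i1 := p₁.isInvProj.idem
  have i2 := p₂.isInvProj.idem
  have e : ∀ Φ ∈ cyclicCocycles2 (thetaInv q),
      Φ (quantumTrace p₁.R p₁.P) = Φ (quantumTrace p₂.R p₂.P) := by
    intro Φ hΦ
    have a1 : V * p₁.P = p₂.P * V := by rw [← h1, ← h2, Matrix.mul_assoc]
    have a2 : p₁.P * dagger V = dagger V * p₂.P := by rw [← h1, ← h2, Matrix.mul_assoc]
    refine quantumTrace_equiv (thetaInv q) hΦ p₁.R p₂.R (x := p₂.P * V) (y := dagger V * p₂.P)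
      ?_ ?_ i1 i2 ?_ ?_ ?_ ?_ p₁.R_P p₂.R_P ?_
    · rw [Matrix.mul_assoc, ← Matrix.mul_assoc V, h2, i2, i2]
    · rw [Matrix.mul_assoc, ← Matrix.mul_assoc p₂.P, i2, ← a1, ← Matrix.mul_assoc, h1, i1]
    · rw [← Matrix.mul_assoc, i2]
    · rw [Matrix.mul_assoc, i2]
    · rw [Matrix.mul_assoc, a1, ← Matrix.mul_assoc, i2]
    · rw [← Matrix.mul_assoc, a2, Matrix.mul_assoc, i2]
    · have hm : (dagger V * p₂.P).map (thetaInv q) =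
          (dagger V).map (thetaInv q) * p₂.P.map (thetaInv q) := Matrix.map_mul
      rw [hm, ← Matrix.mul_assoc, hVd, Matrix.mul_assoc, p₂.R_P, Matrix.mul_assoc]
  apply LinearMap.ext
  intro x
  obtain ⟨⟨Φ, hΦ⟩, rfl⟩ := Submodule.Quotient.mk_surjective _ x
  change -2 * Φ (quantumTrace p₁.R p₁.P) = -2 * Φ (quantumTrace p₂.R p₂.P)
  rw [e Φ hΦ]

theorem chernClass_directSum {q : QParam} {p₁ p₂ r : InvProj q} (h : IsDirectSum p₁ p₂ r) :
    chernClass r = chernClass p₁ + chernClass p₂ := by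
  obtain ⟨e, h1, h2⟩ := h
  have e : quantumTrace r.R r.P = quantumTrace p₁.R p₁.P + quantumTrace p₂.R p₂.P := by
    rw [InvProj.R, h1, h2, quantumTrace_reindex, quantumTrace_fromBlocks]
    rfl
  apply LinearMap.ext
  intro x
  obtain ⟨⟨Φ, hΦ⟩, rfl⟩ := Submodule.Quotient.mk_surjective _ x
  change -2 * Φ (quantumTrace r.R r.P) =
    -2 * Φ (quantumTrace p₁.R p₁.P) + -2 * Φ (quantumTrace p₂.R p₂.P)
  rw [e, map_add, mul_add]

/-- The pairing as an additive map on `K₀`. -/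
def pairingHom (q : QParam) : K0 q →+ (HC2 (thetaInv q) →ₗ[ℂ] ℂ) :=
  QuotientAddGroup.lift _ (FreeAbelianGroup.lift chernClass) (by
    rw [k0Relations, AddSubgroup.closure_le]
    rintro x (⟨p₁, p₂, h, rfl⟩ | ⟨p₁, p₂, r, h, rfl⟩)
    · simp [chernClass_MvN h]
    · simp [chernClass_directSum h])

/-- The Chern-Connes pairing `HC²_{θ⁻¹}(O(S_q^2)) × K₀(O(S_q^2)) → ℂ`. -/
def pairing {q : QParam} (x : HC2 (thetaInv q)) (y : K0 q) : ℂ := pairingHom q y x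

theorem pairing_mk_mk {q : QParam} (Φ : S2 q ⊗[ℂ] (S2 q ⊗[ℂ] S2 q) →ₗ[ℂ] ℂ)
    (h : Φ ∈ cyclicCocycles2 (thetaInv q)) (p : InvProj q) :
    pairing (HC2.mk _ Φ h) (K0.mk p) = -2 * Φ (quantumTrace (p.rho (op (uK q * uK q))) p.P) := by
  have h1 : pairingHom q (K0.mk p) = chernClass p := by
    change FreeAbelianGroup.lift chernClass (FreeAbelianGroup.of p) = _
    simp
  rw [pairing, h1]
  rfl

/-! ### The cocycle -/

/-- The form `ϕ(a₀, a₁, a₂) = q ε(a₀ (K⁻¹E ▷ a₁) (K⁻¹F ▷ a₂))`. -/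
def varphi (q : QParam) : S2 q ⊗[ℂ] (S2 q ⊗[ℂ] S2 q) →ₗ[ℂ] ℂ :=
  qc q • ((oCounit q).toLinearMap ∘ₗ LinearMap.mul' ℂ (O q) ∘ₗ
    TensorProduct.map (sphere q).val.toLinearMap
      (LinearMap.mul' ℂ (O q) ∘ₗ
        TensorProduct.map (act q (uKi q * uE q) ∘ₗ (sphere q).val.toLinearMap)
          (act q (uKi q * uF q) ∘ₗ (sphere q).val.toLinearMap)))

theorem varphi_tmul (q : QParam) (a₀ a₁ a₂ : S2 q) :
    varphi q (a₀ ⊗ₜ (a₁ ⊗ₜ a₂)) =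
      qc q * oCounit q ((a₀ : O q) * (act q (uKi q * uE q) a₁ * act q (uKi q * uF q) a₂)) := rfl

/-- The form `φ = ϕ + b₂* χ` for a bilinear form `χ`. -/
def krahmer (q : QParam) (χ : S2 q ⊗[ℂ] S2 q →ₗ[ℂ] ℂ) : S2 q ⊗[ℂ] (S2 q ⊗[ℂ] S2 q) →ₗ[ℂ] ℂ :=
  varphi q + χ ∘ₗ hochB2 (thetaInv q)

/-- The normalization `(ϕ + b₂* χ)(1, a₁, a₂) = 0` of the bilinear form `χ`. -/
def IsNormalizing (q : QParam) (χ : S2 q ⊗[ℂ] S2 q →ₗ[ℂ] ℂ) : Prop :=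
  ∀ a₁ a₂ : S2 q, krahmer q χ (1 ⊗ₜ (a₁ ⊗ₜ a₂)) = 0


end
end Podles

namespace Podles

noncomputable section

/-! ### The counit and the two derivations on the Podleś sphere -/

/-! Everything takes place at the classical point `ε`. On `B` the counit is a character, and `x ↦
ε(K⁻¹E ▷ x)`, `x ↦ ε(K⁻¹F ▷ x)` are derivations over it (`derE`, `derF`), because `K⁻¹E` and `K⁻¹F`
are primitive up to `K⁻²` and `ε ∘ K⁻² = ε` on `B`. Hence `ϕ = q ε ⊗ derE ⊗ derF` is a cup product
of derivations at a character fixed by `θ⁻¹`, and so a twisted Hochschild cocycle. A Hochschild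
cocycle that vanishes on `1 ⊗ a ⊗ b` is automatically cyclic: apply it to `b₃(1 ⊗ a ⊗ b ⊗ c)`
(`mem_cyclicCocycles2_of_normalized`). So any normalizing `χ` gives a cyclic cocycle.

Existence of `χ` comes down to a linear form `g` on `B` with `g(1) = 0` whose twisted commutator
`g(xy) - g(θ⁻¹(y)x)` is `q derE(x) derF(y) - q⁻¹ derF(x) derE(y)` (`normForm_mul`). It is found in a
representation on sequences of polynomials in which `a` shifts and `bc` multiplies by `X` up to
powers of `q`: `g(x)` is a linear functional applied to the `(0,0)` matrix entry of `x`. As `B` is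
generated by `ac`, `bc`, `bd`, it suffices to check the commutator for these three, where it becomes
a two-term recursion for the values on `Xⁿ` (`normPoly_rel`). The recursion is solvable because `q`
is not a root of unity.

The pairing does not depend on `χ`. Write `R = ρ°(K²)` and `T = Tr(RP ⊗ P)` for an equivariant
idempotent `P`. Then `b₂ Tr(RP ⊗ P ⊗ P) = T`, `T` is invariant under the twisted flip, and `b₂(1 ⊗
T) = 2T - 1 ⊗ Tr(RP)`. If the quantum trace `Tr(RP)` is a scalar `κ`, then `2 Tr(RP ⊗ P ⊗ P) - 1 ⊗
(T + κ 1 ⊗ 1)` is a true Hochschild cycle (`hochB2_traceCycle`). On it the coboundary of `χ` is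
zero, while the normalized cocycle does not see the correction; so `2 φ(Tr(RP ⊗ P ⊗ P)) = 2 ϕ(Tr(RP
⊗ P ⊗ P)) - ϕ(1 ⊗ T)` (`two_mul_krahmer_quantumTrace`).

For `P_N` the right-hand side is a finite matrix computation. The two orthogonality relations of a
spin row, proved by Pascal's rule, make `P_N` idempotent and `Tr(RP_N)` scalar; covariance of the
row makes it invariant. At `ε` the matrix `P_N` becomes the matrix unit of the highest weight for `N
≥ 0`, of the lowest weight for `N < 0`, and its derivatives are a row or a column of the matrices of
`E` and `F`. Both terms reduce to the value of `EF - FE` at that extremal weight: `ϕ(1 ⊗ T) =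
-[|N|]` always, whereas `ϕ(Tr(RP ⊗ P ⊗ P))` is `-[|N|]` for `N ≥ 0` and `0` for `N < 0`. This yields
`[N]` for either sign. For `N = 1` the value is `1`, and as it is taken on a cycle, `φ` is non-zero
on `HH₂`. -/

theorem s2_ext {q : QParam} {x y : S2 q} (h : (x : O q) = y) : x = y := Subtype.ext h

/-- The counit of the quantum sphere. -/
def eps (q : QParam) : S2 q →ₐ[ℂ] ℂ := (oCounit q).comp (sphere q).val

theorem oCounit_gen (q : QParam) (x : OGen) : oCounit q (oGen q x) = match x with
      | .a => 1
      | .b => 0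
      | .c => 0
      | .d => 1 := by
  cases x <;> rw [oCounit, oLift_gen]

/-- The counit cannot distinguish translation by a group-like element on the two sides: it kills `b`
and `c`, and on `a` and `d` both automorphisms scale alike. On the sphere this turns into invariance
of `ε` under `K²`. -/
theorem oCounit_actKi_actKi (q : QParam) (x : O q) :
    oCounit q (actKi q (actKi q x)) = oCounit q (dK2 q x) := by
  have h : (oCounit q).comp ((actKi q).comp (actKi q)) = (oCounit q).comp (dK2 q) := by
    apply o_algHom_ext
    intro x
    have hs := qs_ne_zero q
    cases x <;> simp [actKi_gen, dK2_gen, oCounit_gen, ← qs_mul_qs]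
  exact congrArg (fun f : O q →ₐ[ℂ] ℂ => f x) h

theorem oCounit_actKi_actKi_of_mem {q : QParam} {x : O q} (hx : dK2 q x = x) :
    oCounit q (actKi q (actKi q x)) = oCounit q x := by
  rw [oCounit_actKi_actKi, hx]

theorem oCounit_actK_actK_of_mem {q : QParam} {x : O q} (hx : dK2 q x = x) :
    oCounit q (actK q (actK q x)) = oCounit q x := by
  have h := oCounit_actKi_actKi_of_mem (x := actK q (actK q x)) (by simp [dK2_actK, hx])
  rw [actKi_actK, actKi_actK] at h
  exact h.symm

theorem coe_thetaInv (q : QParam) (x : S2 q) : (thetaInv q x : O q) = actK q (actK q x) := rfl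

theorem eps_thetaInv (q : QParam) (x : S2 q) : eps q (thetaInv q x) = eps q x :=
  oCounit_actK_actK_of_mem x.2

theorem dK2_actE (q : QParam) (x : O q) : dK2 q (actE q x) = actE q (dK2 q x) := by
  induction x using o_induction with
  | halg r => simp [actE_algebraMap]
  | hgen x => cases x <;> simp [actE_gen, dK2_gen]
  | hmul x y hx hy => simp [actE_mul, hx, hy, dK2_actK, dK2_actKi]
  | hadd x y hx hy => simp [hx, hy]

theorem dK2_actF (q : QParam) (x : O q) : dK2 q (actF q x) = actF q (dK2 q x) := by
  induction x using o_induction with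
  | halg r => simp [actF_algebraMap]
  | hgen x => cases x <;> simp [actF_gen, dK2_gen]
  | hmul x y hx hy => simp [actF_mul, hx, hy, dK2_actK, dK2_actKi]
  | hadd x y hx hy => simp [hx, hy]

/-- The derivation `x ↦ ε(K⁻¹E ▷ x)` at the counit. -/
def derE (q : QParam) : S2 q →ₗ[ℂ] ℂ :=
  (oCounit q).toLinearMap ∘ₗ (actKi q).toLinearMap ∘ₗ actE q ∘ₗ (sphere q).val.toLinearMap

/-- The derivation `x ↦ ε(K⁻¹F ▷ x)` at the counit. -/
def derF (q : QParam) : S2 q →ₗ[ℂ] ℂ :=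
  (oCounit q).toLinearMap ∘ₗ (actKi q).toLinearMap ∘ₗ actF q ∘ₗ (sphere q).val.toLinearMap

theorem eps_apply (q : QParam) (x : S2 q) : eps q x = oCounit q x := rfl

theorem derE_apply (q : QParam) (x : S2 q) : derE q x = oCounit q (actKi q (actE q x)) := rfl

theorem derF_apply (q : QParam) (x : S2 q) : derF q x = oCounit q (actKi q (actF q x)) := rfl

/-- Applying `K⁻¹` to the Leibniz rule of `E` gives `(K⁻¹E ▷ x) y + (K⁻² ▷ x)(K⁻¹E ▷ y)`, and `ε`
does not see `K⁻²` on the sphere. On all of `O(SU_q(2))` this would only be a skew derivation. -/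
theorem derE_mul (q : QParam) (x y : S2 q) :
    derE q (x * y) = derE q x * eps q y + eps q x * derE q y := by
  rw [derE_apply, derE_apply, derE_apply, eps_apply, eps_apply, Subalgebra.coe_mul, actE_mul]
  simp only [map_add, map_mul, actKi_actK, oCounit_actKi_actKi_of_mem x.2]

theorem derF_mul (q : QParam) (x y : S2 q) :
    derF q (x * y) = derF q x * eps q y + eps q x * derF q y := by
  rw [derF_apply, derF_apply, derF_apply, eps_apply, eps_apply, Subalgebra.coe_mul, actF_mul]
  simp only [map_add, map_mul, actKi_actK, oCounit_actKi_actKi_of_mem x.2]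

theorem derE_algebraMap (q : QParam) (r : ℂ) : derE q (algebraMap ℂ _ r) = 0 := by
  rw [derE_apply]
  change oCounit q (actKi q (actE q (algebraMap ℂ (O q) r))) = 0
  rw [actE_algebraMap, map_zero, map_zero]

theorem derF_algebraMap (q : QParam) (r : ℂ) : derF q (algebraMap ℂ _ r) = 0 := by
  rw [derF_apply]
  change oCounit q (actKi q (actF q (algebraMap ℂ (O q) r))) = 0
  rw [actF_algebraMap, map_zero, map_zero]

theorem derE_one (q : QParam) : derE q 1 = 0 := by
  simpa using derE_algebraMap q 1

theorem derF_one (q : QParam) : derF q 1 = 0 := by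
  simpa using derF_algebraMap q 1

/-- `K⁻¹E ▷ x` stays in the sphere, so `K²` may be inserted under `ε` and then moved past `E` at the
cost of `q²`. For `F` the same factor appears on the other side. -/
theorem derE_thetaInv (q : QParam) (x : S2 q) :
    derE q x = qc q ^ 2 * derE q (thetaInv q x) := by
  have h : oCounit q (actK q (actK q (actKi q (actE q x)))) = derE q x :=
    oCounit_actK_actK_of_mem (by rw [dK2_actKi, dK2_actE, x.2]; rfl)
  rw [← h, derE_apply, coe_thetaInv, actK_actKi]
  conv_lhs => rw [← actKi_actK q (actK q (actE q x)), actK_actE, map_smul, actK_actE]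
  simp only [map_smul, smul_eq_mul]
  ring

theorem derF_thetaInv (q : QParam) (x : S2 q) :
    derF q (thetaInv q x) = qc q ^ 2 * derF q x := by
  have h : oCounit q (actK q (actK q (actKi q (actF q x)))) = derF q x :=
    oCounit_actK_actK_of_mem (by rw [dK2_actKi, dK2_actF, x.2]; rfl)
  rw [← h, derF_apply, coe_thetaInv, actK_actKi, actF_actK, actF_actK]
  simp only [map_smul, smul_eq_mul, actKi_actK]
  ring

/-- Multiplicativity of the counit splits the cochain into one factor per slot; from here on only
`eps`, `derE` and `derF` matter. -/
theorem varphi_eq (q : QParam) (a₀ a₁ a₂ : S2 q) :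
    varphi q (a₀ ⊗ₜ (a₁ ⊗ₜ a₂)) = qc q * (eps q a₀ * (derE q a₁ * derF q a₂)) := by
  rw [varphi_tmul, map_mul, map_mul, map_mul (act q), map_mul (act q), Module.End.mul_apply,
    Module.End.mul_apply, act_Ki, act_Ki, act_E, act_F]
  rfl

/-! ### Cocycles -/

theorem tensor4_ext {A : Type*} [Ring A] [Algebra ℂ A]
    {φ ψ : A ⊗[ℂ] (A ⊗[ℂ] (A ⊗[ℂ] A)) →ₗ[ℂ] ℂ}
    (h : ∀ a b c d : A, φ (a ⊗ₜ (b ⊗ₜ (c ⊗ₜ d))) = ψ (a ⊗ₜ (b ⊗ₜ (c ⊗ₜ d)))) : φ = ψ := by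
  apply TensorProduct.ext
  ext a : 1
  apply TensorProduct.ext
  ext b : 1
  apply TensorProduct.ext
  ext c d
  exact h a b c d

theorem tensor3_ext {A : Type*} [Ring A] [Algebra ℂ A]
    {φ ψ : A ⊗[ℂ] (A ⊗[ℂ] A) →ₗ[ℂ] ℂ}
    (h : ∀ a b c : A, φ (a ⊗ₜ (b ⊗ₜ c)) = ψ (a ⊗ₜ (b ⊗ₜ c))) : φ = ψ := by
  apply TensorProduct.ext
  ext a : 1
  apply TensorProduct.ext
  ext b c
  exact h a b c

/-- `b₂ b₃ = 0` already on `C₃`, before any quotient, since only multiplicativity of the twist is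
used. -/
theorem comp_hochB2_comp_hochB3 {A : Type*} [Ring A] [Algebra ℂ A] (lam : A ≃ₐ[ℂ] A)
    (χ : A ⊗[ℂ] A →ₗ[ℂ] ℂ) : (χ ∘ₗ hochB2 lam) ∘ₗ hochB3 lam = 0 := by
  apply tensor4_ext
  intro a b c d
  simp only [LinearMap.comp_apply, hochB3_tmul, hochB2_tmul, map_sub, map_add, map_mul,
    LinearMap.zero_apply, mul_assoc]
  ring

/-- The Leibniz terms of the inner faces cancel in pairs; the last face fits because `ε ∘ θ⁻¹ = ε`.
-/
theorem varphi_comp_hochB3 (q : QParam) : varphi q ∘ₗ hochB3 (thetaInv q) = 0 := by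
  apply tensor4_ext
  intro a b c d
  simp only [LinearMap.comp_apply, hochB3_tmul, map_sub, map_add, varphi_eq, map_mul, derE_mul,
    derF_mul, LinearMap.zero_apply, eps_thetaInv]
  ring

theorem krahmer_comp_hochB3 (q : QParam) (χ : S2 q ⊗[ℂ] S2 q →ₗ[ℂ] ℂ) :
    krahmer q χ ∘ₗ hochB3 (thetaInv q) = 0 := by
  rw [krahmer, LinearMap.add_comp, varphi_comp_hochB3, comp_hochB2_comp_hochB3, add_zero]

/-- Cyclicity is free for a normalized cocycle: in `b₃(1 ⊗ a ⊗ b ⊗ c)` the two inner faces keep the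
leading `1` and drop out, leaving `φ(a ⊗ b ⊗ c) - φ(λ(c) ⊗ a ⊗ b)`. -/
theorem mem_cyclicCocycles2_of_normalized {A : Type*} [Ring A] [Algebra ℂ A] (lam : A ≃ₐ[ℂ] A)
    {φ : A ⊗[ℂ] (A ⊗[ℂ] A) →ₗ[ℂ] ℂ} (h : φ ∘ₗ hochB3 lam = 0)
    (h1 : ∀ a b : A, φ (1 ⊗ₜ (a ⊗ₜ b)) = 0) : φ ∈ cyclicCocycles2 lam := by
  refine ⟨?_, h⟩
  apply tensor3_ext
  intro a b c
  have h2 := LinearMap.congr_fun h (1 ⊗ₜ (a ⊗ₜ (b ⊗ₜ c)))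
  simp only [LinearMap.comp_apply, hochB3_tmul, map_sub, map_add, h1, one_mul, mul_one,
    LinearMap.zero_apply, sub_zero, add_zero] at h2
  exact sub_eq_zero.mp h2

theorem krahmer_mem_cyclicCocycles2 {q : QParam} {χ : S2 q ⊗[ℂ] S2 q →ₗ[ℂ] ℂ}
    (h : IsNormalizing q χ) : krahmer q χ ∈ cyclicCocycles2 (thetaInv q) :=
  mem_cyclicCocycles2_of_normalized _ (krahmer_comp_hochB3 q χ) h

/-! ### Cyclic cocycles as functionals on twisted Hochschild homology. -/

theorem vanish_hochBoundaries2 {A : Type*} [Ring A] [Algebra ℂ A] (lam : A ≃ₐ[ℂ] A)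
    {φ : A ⊗[ℂ] (A ⊗[ℂ] A) →ₗ[ℂ] ℂ} (h : φ ∈ cyclicCocycles2 lam)
    {x : A ⊗[ℂ] (A ⊗[ℂ] A)} (hx : x ∈ hochBoundaries2 lam) : φ x = 0 := by
  have h1 : ∀ y, φ (tau2 lam y) = φ y := fun y => (LinearMap.congr_fun h.1 y).symm
  have h2 : hochBoundaries2 lam ≤ LinearMap.ker φ := by
    refine sup_le ?_ ?_
    · rintro _ ⟨y, rfl⟩
      exact LinearMap.congr_fun h.2 y
    · rintro _ ⟨y, rfl⟩
      simp only [LinearMap.mem_ker, LinearMap.sub_apply, LinearMap.comp_apply, map_sub, h1,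
        LinearMap.id_apply, sub_self]
  exact h2 hx

/-- A chain with `b₂ η = 0` exactly is in particular a cycle modulo `im(id - τ₁²)`, so one such
chain with non-zero value suffices. -/
theorem nontrivialOnHH2_of_cycle {A : Type*} [Ring A] [Algebra ℂ A] (lam : A ≃ₐ[ℂ] A)
    {φ : A ⊗[ℂ] (A ⊗[ℂ] A) →ₗ[ℂ] ℂ} (h : φ ∈ cyclicCocycles2 lam)
    {η : A ⊗[ℂ] (A ⊗[ℂ] A)} (hη : hochB2 lam η = 0) (h0 : φ η ≠ 0) :
    NontrivialOnHH2 lam φ := by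
  refine ⟨Submodule.liftQ _ (φ ∘ₗ (hochCycles2 lam).subtype)
    (fun x hx => vanish_hochBoundaries2 lam h hx), fun η => rfl, ?_⟩
  intro h1
  apply h0
  have hm : η ∈ hochCycles2 lam := by
    rw [hochCycles2, Submodule.mem_comap, hη]
    exact Submodule.zero_mem _
  exact LinearMap.congr_fun h1 (Subquot.mk _ _ ⟨η, hm⟩)


/-! ### Generators of the Podleś sphere -/

/-- The span of `a` and `b`. -/
def posSpan (q : QParam) : Submodule ℂ (O q) := Submodule.span ℂ {oa q, ob q}

/-- The span of `c` and `d`. -/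
def negSpan (q : QParam) : Submodule ℂ (O q) := Submodule.span ℂ {oc q, od q}

/-- The algebra generated by `ac`, `bc`, `bd`. -/
def sphereGen (q : QParam) : Subalgebra ℂ (O q) :=
  Algebra.adjoin ℂ {oa q * oc q, ob q * oc q, ob q * od q}

theorem posSpan_mul_negSpan (q : QParam) : posSpan q * negSpan q =
    Submodule.span ℂ {oa q * oc q, oa q * od q, ob q * oc q, ob q * od q} := by
  rw [posSpan, negSpan, Submodule.span_mul_span]
  congr 1
  ext x
  simp only [Set.mem_mul, Set.mem_insert_iff, Set.mem_singleton_iff, exists_eq_or_imp,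
    exists_eq_left]
  tauto

theorem negSpan_mul_posSpan (q : QParam) : negSpan q * posSpan q =
    Submodule.span ℂ {oc q * oa q, oc q * ob q, od q * oa q, od q * ob q} := by
  rw [posSpan, negSpan, Submodule.span_mul_span]
  congr 1
  ext x
  simp only [Set.mem_mul, Set.mem_insert_iff, Set.mem_singleton_iff, exists_eq_or_imp,
    exists_eq_left]
  tauto

theorem one_mem_posSpan_mul_negSpan (q : QParam) : (1 : O q) ∈ posSpan q * negSpan q := by
  have h : (1 : O q) = oa q * od q - qc q • (ob q * oc q) := by rw [o_ad]; abel
  rw [h, posSpan_mul_negSpan]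
  exact Submodule.sub_mem _ (Submodule.subset_span (by simp))
    (Submodule.smul_mem _ _ (Submodule.subset_span (by simp)))

theorem one_mem_negSpan_mul_posSpan (q : QParam) : (1 : O q) ∈ negSpan q * posSpan q := by
  have h : (1 : O q) = od q * oa q - (qc q)⁻¹ • (oc q * ob q) := by rw [o_da, o_bc]; abel
  rw [h, negSpan_mul_posSpan]
  exact Submodule.sub_mem _ (Submodule.subset_span (by simp))
    (Submodule.smul_mem _ _ (Submodule.subset_span (by simp)))

/-- As subspaces, the products in the two orders agree: the quadratic relations exchange the factors
up to scalars, and the constants arising from `ad` and `da` are harmless because both products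
contain `1`. -/
theorem commute_posSpan_negSpan (q : QParam) : Commute (posSpan q) (negSpan q) := by
  have hq := qc_ne_zero q
  apply le_antisymm
  · have h1 := one_mem_negSpan_mul_posSpan q
    rw [posSpan_mul_negSpan, Submodule.span_le]
    rw [negSpan_mul_posSpan] at h1 ⊢
    rintro x (rfl | rfl | rfl | rfl)
    · rw [o_ac]
      exact Submodule.smul_mem _ _ (Submodule.subset_span (by simp))
    · rw [o_ad, o_bc]
      exact Submodule.add_mem _ h1 (Submodule.smul_mem _ _ (Submodule.subset_span (by simp)))
    · rw [o_bc]
      exact Submodule.subset_span (by simp)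
    · rw [o_bd]
      exact Submodule.smul_mem _ _ (Submodule.subset_span (by simp))
  · have h1 := one_mem_posSpan_mul_negSpan q
    rw [negSpan_mul_posSpan, Submodule.span_le]
    rw [posSpan_mul_negSpan] at h1 ⊢
    have h2 : oc q * oa q = (qc q)⁻¹ • (oa q * oc q) := by
      rw [o_ac, smul_smul, inv_mul_cancel₀ hq, one_smul]
    have h3 : od q * ob q = (qc q)⁻¹ • (ob q * od q) := by
      rw [o_bd, smul_smul, inv_mul_cancel₀ hq, one_smul]
    rintro x (rfl | rfl | rfl | rfl)
    · rw [h2]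
      exact Submodule.smul_mem _ _ (Submodule.subset_span (by simp))
    · rw [← o_bc]
      exact Submodule.subset_span (by simp)
    · rw [o_da]
      exact Submodule.add_mem _ h1 (Submodule.smul_mem _ _ (Submodule.subset_span (by simp)))
    · rw [h3]
      exact Submodule.smul_mem _ _ (Submodule.subset_span (by simp))

theorem posSpan_mul_negSpan_le (q : QParam) :
    posSpan q * negSpan q ≤ Subalgebra.toSubmodule (sphereGen q) := by
  rw [posSpan_mul_negSpan, Submodule.span_le]
  have hbc : ob q * oc q ∈ sphereGen q := Algebra.subset_adjoin (by simp)
  rintro x (rfl | rfl | rfl | rfl)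
  · exact Algebra.subset_adjoin (by simp)
  · rw [o_ad]
    exact (sphereGen q).add_mem (sphereGen q).one_mem ((sphereGen q).smul_mem hbc _)
  · exact hbc
  · exact Algebra.subset_adjoin (by simp)

/-- Since the two subspaces commute, the product of the powers is a power of `posSpan * negSpan`,
whose spanning products `ac`, `ad = 1 + q bc`, `bc`, `bd` lie in the generated algebra. -/
theorem posSpan_pow_mul_negSpan_pow_le (q : QParam) (i : ℕ) :
    posSpan q ^ i * negSpan q ^ i ≤ Subalgebra.toSubmodule (sphereGen q) := by
  rw [← (commute_posSpan_negSpan q).mul_pow]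
  induction i with
  | zero =>
    rw [pow_zero, Submodule.one_le]
    exact (sphereGen q).one_mem
  | succ i ih =>
    rw [pow_succ]
    refine Submodule.mul_le.mpr fun x hx y hy => ?_
    exact (sphereGen q).mul_mem (ih hx) (posSpan_mul_negSpan_le q hy)

/-- Commutation of the two subspaces makes the sum of all `posSpan^i * negSpan^j` closed under
multiplication, and it contains `1` and the generators. -/
theorem mem_iSup_posSpan_negSpan (q : QParam) (x : O q) :
    x ∈ ⨆ p : ℕ × ℕ, posSpan q ^ p.1 * negSpan q ^ p.2 := by
  set S : Submodule ℂ (O q) := ⨆ p : ℕ × ℕ, posSpan q ^ p.1 * negSpan q ^ p.2 with hS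
  have hle : ∀ i j, posSpan q ^ i * negSpan q ^ j ≤ S := fun i j =>
    le_iSup (fun p : ℕ × ℕ => posSpan q ^ p.1 * negSpan q ^ p.2) (i, j)
  have hmul : S * S ≤ S := by
    conv_lhs => rw [hS]
    rw [Submodule.iSup_mul]
    refine iSup_le fun p => ?_
    rw [Submodule.mul_iSup]
    refine iSup_le fun r => ?_
    have h := ((commute_posSpan_negSpan q).pow_pow r.1 p.2).eq
    calc posSpan q ^ p.1 * negSpan q ^ p.2 * (posSpan q ^ r.1 * negSpan q ^ r.2)
        = posSpan q ^ p.1 * (negSpan q ^ p.2 * posSpan q ^ r.1) * negSpan q ^ r.2 := by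
          simp only [mul_assoc]
      _ = posSpan q ^ (p.1 + r.1) * negSpan q ^ (p.2 + r.2) := by
          rw [← h, pow_add, pow_add]
          simp only [mul_assoc]
      _ ≤ S := hle _ _
  have h0 := hle 0 0
  have hp := hle 1 0
  have hn := hle 0 1
  rw [pow_zero, pow_zero, one_mul, Submodule.one_le] at h0
  rw [pow_one, pow_zero, mul_one] at hp
  rw [pow_one, pow_zero, one_mul] at hn
  induction x using o_induction with
  | halg r =>
    rw [Algebra.algebraMap_eq_smul_one]
    exact S.smul_mem _ h0
  | hgen x =>
    cases x
    · exact hp (Submodule.subset_span (by simp))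
    · exact hp (Submodule.subset_span (by simp))
    · exact hn (Submodule.subset_span (by simp))
    · exact hn (Submodule.subset_span (by simp))
  | hmul x y hx hy => exact hmul (Submodule.mul_mem_mul hx hy)
  | hadd x y hx hy => exact S.add_mem hx hy

theorem dK2_posSpan {q : QParam} {x : O q} (hx : x ∈ posSpan q) : dK2 q x = qc q • x := by
  rw [posSpan, Submodule.mem_span_pair] at hx
  obtain ⟨r, s, rfl⟩ := hx
  simp [dK2_gen, smul_comm _ (qc q)]

theorem dK2_negSpan {q : QParam} {x : O q} (hx : x ∈ negSpan q) : dK2 q x = (qc q)⁻¹ • x := by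
  rw [negSpan, Submodule.mem_span_pair] at hx
  obtain ⟨r, s, rfl⟩ := hx
  simp [dK2_gen, smul_comm _ (qc q)⁻¹]

/-! ### The grading by eigenvalues of `∂_{K²}`. -/

theorem eigen_mul {A : Type*} [Ring A] [Algebra ℂ A] (D : A →ₐ[ℂ] A) (r s : ℂ) :
    Module.End.eigenspace D.toLinearMap r * Module.End.eigenspace D.toLinearMap s ≤
      Module.End.eigenspace D.toLinearMap (r * s) := by
  refine Submodule.mul_le.mpr fun x hx y hy => ?_
  rw [Module.End.mem_eigenspace_iff, AlgHom.toLinearMap_apply] at *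
  rw [map_mul, hx, hy, smul_mul_smul_comm]

theorem eigen_pow {A : Type*} [Ring A] [Algebra ℂ A] (D : A →ₐ[ℂ] A) (r : ℂ)
    {M : Submodule ℂ A} (h : M ≤ Module.End.eigenspace D.toLinearMap r) (n : ℕ) :
    M ^ n ≤ Module.End.eigenspace D.toLinearMap (r ^ n) := by
  induction n with
  | zero =>
    rw [pow_zero, pow_zero, Submodule.one_le, Module.End.mem_eigenspace_iff]
    simp
  | succ n ih =>
    rw [pow_succ, pow_succ]
    exact (mul_le_mul' ih h).trans (eigen_mul D _ _)

/-- A positive real `q ≠ 1` is not a root of unity; this separates the degrees of the grading and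
later keeps the denominators of a recursion away from zero. -/
theorem qc_zpow_ne_one (q : QParam) {n : ℤ} (hn : n ≠ 0) : qc q ^ n ≠ 1 := by
  intro h
  have h1 : ((q : ℝ) ^ n : ℝ) = 1 := by
    rw [qc] at h
    exact_mod_cast h
  exact hn ((zpow_eq_one_iff_right₀ q.2.1.le q.2.2).mp h1)

/-- `posSpan^i * negSpan^j` has `∂_{K²}`-eigenvalue `q^(i-j)`, which is `1` only for `i = j`; those
pieces lie in the algebra generated by `ac`, `bc`, `bd`. -/
theorem sphere_le_sphereGen (q : QParam) : sphere q ≤ sphereGen q := by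
  intro x hx
  set D : Module.End ℂ (O q) := (dK2 q).toLinearMap
  set M : ℕ × ℕ → Submodule ℂ (O q) := fun p => posSpan q ^ p.1 * negSpan q ^ p.2
  have hM : ∀ p, M p ≤ D.eigenspace (qc q ^ ((p.1 : ℤ) - p.2)) := by
    intro p
    have h1 := eigen_pow (dK2 q) (qc q) (M := posSpan q)
      (fun x hx => Module.End.mem_eigenspace_iff.mpr (dK2_posSpan hx)) p.1
    have h2 := eigen_pow (dK2 q) (qc q)⁻¹ (M := negSpan q)
      (fun x hx => Module.End.mem_eigenspace_iff.mpr (dK2_negSpan hx)) p.2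
    have h3 : qc q ^ ((p.1 : ℤ) - p.2) = qc q ^ p.1 * (qc q)⁻¹ ^ p.2 := by
      rw [zpow_sub₀ (qc_ne_zero q), zpow_natCast, zpow_natCast, inv_pow, div_eq_mul_inv]
    rw [h3]
    exact (mul_le_mul' h1 h2).trans (eigen_mul (dK2 q) _ _)
  -- The diagonal pieces are recorded both as generated by the three elements and as fixed by
  -- `∂_{K²}`; all the others go to eigenvalues different from `1`.
  have hle : (⨆ p, M p) ≤ Subalgebra.toSubmodule (sphereGen q) ⊓ D.eigenspace 1 ⊔
      ⨆ r : ℂ, ⨆ _ : r ≠ 1, D.eigenspace r := by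
    refine iSup_le fun p => ?_
    by_cases hp : p.1 = p.2
    · refine le_sup_of_le_left (le_inf ?_ ?_)
      · have := posSpan_pow_mul_negSpan_pow_le q p.1
        simp only [M, ← hp]
        exact this
      · have := hM p
        rwa [hp, sub_self, zpow_zero] at this
    · refine le_sup_of_le_right ((hM p).trans ?_)
      exact le_iSup₂_of_le _ (qc_zpow_ne_one q (by omega)) le_rfl
  obtain ⟨y, hy, z, hz, rfl⟩ := Submodule.mem_sup.mp (hle (mem_iSup_posSpan_negSpan q x))
  have hx1 : y + z ∈ D.eigenspace 1 := by
    rw [Module.End.mem_eigenspace_iff, one_smul]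
    exact hx
  have hz1 : z ∈ D.eigenspace 1 := by
    have := Submodule.sub_mem _ hx1 hy.2
    rwa [add_sub_cancel_left] at this
  -- `z` is fixed by `∂_{K²}` and is also a sum of vectors from other eigenspaces, which are
  -- independent of the one for `1`.
  have hz0 : z = 0 := by
    have h := (Module.End.eigenspaces_iSupIndep D) 1
    exact Submodule.disjoint_def.mp h z hz1 hz
  rw [hz0, add_zero]
  exact hy.1

theorem mul_mem_sphere {q : QParam} {x y : O q} (hx : x ∈ posSpan q) (hy : y ∈ negSpan q) :
    x * y ∈ sphere q := by
  rw [mem_sphere, map_mul, dK2_posSpan hx, dK2_negSpan hy, smul_mul_smul_comm,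
    mul_inv_cancel₀ (qc_ne_zero q), one_smul]

/-- The element `ac` of the quantum sphere. -/
def sac (q : QParam) : S2 q := ⟨oa q * oc q, mul_mem_sphere (Submodule.subset_span (by simp))
  (Submodule.subset_span (by simp))⟩

/-- The element `bc` of the quantum sphere. -/
def sbc (q : QParam) : S2 q := ⟨ob q * oc q, mul_mem_sphere (Submodule.subset_span (by simp))
  (Submodule.subset_span (by simp))⟩

/-- The element `bd` of the quantum sphere. -/
def sbd (q : QParam) : S2 q := ⟨ob q * od q, mul_mem_sphere (Submodule.subset_span (by simp))
  (Submodule.subset_span (by simp))⟩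

theorem s2_induction (q : QParam) {C : S2 q → Prop} (halg : ∀ r : ℂ, C (algebraMap ℂ (S2 q) r))
    (hac : C (sac q)) (hbc : C (sbc q)) (hbd : C (sbd q))
    (hmul : ∀ x y, C x → C y → C (x * y)) (hadd : ∀ x y, C x → C y → C (x + y)) (x : S2 q) :
    C x := by
  -- The generated algebra lives in `O(SU_q(2))`, whereas `C` is defined on the subtype; membership
  -- is therefore carried along through the induction.
  have h : ∀ y ∈ sphereGen q, ∃ hy : y ∈ sphere q, C ⟨y, hy⟩ := by
    intro y hy
    induction hy using Algebra.adjoin_induction with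
    | mem y hy =>
      rcases hy with rfl | rfl | rfl
      · exact ⟨(sac q).2, hac⟩
      · exact ⟨(sbc q).2, hbc⟩
      · exact ⟨(sbd q).2, hbd⟩
    | algebraMap r => exact ⟨(sphere q).algebraMap_mem r, halg r⟩
    | add x y _ _ hx hy =>
      obtain ⟨hx, h1⟩ := hx
      obtain ⟨hy, h2⟩ := hy
      exact ⟨(sphere q).add_mem hx hy, hadd _ _ h1 h2⟩
    | mul x y _ _ hx hy =>
      obtain ⟨hx, h1⟩ := hx
      obtain ⟨hy, h2⟩ := hy
      exact ⟨(sphere q).mul_mem hx hy, hmul _ _ h1 h2⟩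
  exact (h x (sphere_le_sphereGen q x.2)).2


/-! ### A representation of `O(SU_q(2))` on sequences of polynomials -/

open Polynomial in
/-- The operators that represent the generators of `O(SU_q(2))` on sequences of polynomials. -/
def seqRepGen (q : QParam) : OGen → Module.End ℂ[X] (ℤ → ℂ[X])
  | .a => { toFun := fun f k => f (k - 1), map_add' := fun _ _ => rfl, map_smul' := fun _ _ => rfl }
  | .b =>
    { toFun := fun f k => C (qc q ^ (-k)) * X * f k
      map_add' := fun _ _ => funext fun _ => mul_add _ _ _
      map_smul' := fun _ _ => funext fun _ => mul_left_comm _ _ _ }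
  | .c =>
    { toFun := fun f k => C (qc q ^ (-k)) * f k
      map_add' := fun _ _ => funext fun _ => mul_add _ _ _
      map_smul' := fun _ _ => funext fun _ => mul_left_comm _ _ _ }
  | .d =>
    -- The factor is forced by `ad = 1 + q bc`, since `bc` multiplies the entry at `k` by `q^(-2k)
    -- X` and `a` is the shift.
    { toFun := fun f k => (1 + C (qc q ^ (-2 * k - 1)) * X) * f (k + 1)
      map_add' := fun _ _ => funext fun _ => mul_add _ _ _
      map_smul' := fun _ _ => funext fun _ => mul_left_comm _ _ _ }

open Polynomial in
theorem seqRepGen_a (q : QParam) (f : ℤ → ℂ[X]) (k : ℤ) : seqRepGen q .a f k = f (k - 1) := rfl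

open Polynomial in
theorem seqRepGen_b (q : QParam) (f : ℤ → ℂ[X]) (k : ℤ) :
    seqRepGen q .b f k = C (qc q ^ (-k)) * X * f k := rfl

open Polynomial in
theorem seqRepGen_c (q : QParam) (f : ℤ → ℂ[X]) (k : ℤ) :
    seqRepGen q .c f k = C (qc q ^ (-k)) * f k := rfl

open Polynomial in
theorem seqRepGen_d (q : QParam) (f : ℤ → ℂ[X]) (k : ℤ) :
    seqRepGen q .d f k = (1 + C (qc q ^ (-2 * k - 1)) * X) * f (k + 1) := rfl

open Polynomial in
theorem C_mul_zpow_eq (q : QParam) (m : ℤ) :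
    (C (qc q) * C (qc q ^ m) : ℂ[X]) = C (qc q ^ (m + 1)) := by
  rw [← C_mul, zpow_add₀ (qc_ne_zero q), zpow_one, mul_comm]

open Polynomial in
theorem C_inv_mul_zpow_eq (q : QParam) (m : ℤ) :
    (C (qc q)⁻¹ * C (qc q ^ m) : ℂ[X]) = C (qc q ^ (m - 1)) := by
  rw [← C_mul, zpow_sub₀ (qc_ne_zero q), zpow_one, mul_comm, div_eq_mul_inv]

open Polynomial in
theorem C_zpow_mul_C_zpow (q : QParam) (m n : ℤ) :
    (C (qc q ^ m) * C (qc q ^ n) : ℂ[X]) = C (qc q ^ (m + n)) := by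
  rw [← C_mul, zpow_add₀ (qc_ne_zero q)]

open Polynomial in
/-- The representation of `O(SU_q(2))` on sequences of polynomials, in which `a` is the shift, `c`
is diagonal with entries `q ^ (-k)` and `b = X c`. -/
def seqRep (q : QParam) : O q →ₐ[ℂ] Module.End ℂ[X] (ℤ → ℂ[X]) :=
  oLift q (seqRepGen q)
    (by
      refine LinearMap.ext fun f => funext fun k => ?_
      simp only [Module.End.mul_apply, LinearMap.smul_apply, Pi.smul_apply, seqRepGen_a,
        seqRepGen_b, smul_eq_C_mul]
      have h := C_mul_zpow_eq q (-k)
      rw [show -(k - 1) = -k + 1 by ring, ← h]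
      ring)
    (by
      refine LinearMap.ext fun f => funext fun k => ?_
      simp only [Module.End.mul_apply, LinearMap.smul_apply, Pi.smul_apply, seqRepGen_a,
        seqRepGen_c, smul_eq_C_mul]
      have h := C_mul_zpow_eq q (-k)
      rw [show -(k - 1) = -k + 1 by ring, ← h]
      ring)
    (by
      refine LinearMap.ext fun f => funext fun k => ?_
      simp only [Module.End.mul_apply, LinearMap.smul_apply, Pi.smul_apply, seqRepGen_d,
        seqRepGen_b, smul_eq_C_mul]
      have h := C_mul_zpow_eq q (-(k + 1))
      rw [show -(k + 1) + 1 = -k by ring] at h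
      rw [← h]
      ring)
    (by
      refine LinearMap.ext fun f => funext fun k => ?_
      simp only [Module.End.mul_apply, LinearMap.smul_apply, Pi.smul_apply, seqRepGen_d,
        seqRepGen_c, smul_eq_C_mul]
      have h := C_mul_zpow_eq q (-(k + 1))
      rw [show -(k + 1) + 1 = -k by ring] at h
      rw [← h]
      ring)
    (by
      refine LinearMap.ext fun f => funext fun k => ?_
      simp only [Module.End.mul_apply, seqRepGen_b, seqRepGen_c]
      ring)
    (by
      refine LinearMap.ext fun f => funext fun k => ?_
      simp only [Module.End.mul_apply, LinearMap.smul_apply, Pi.smul_apply, LinearMap.add_apply,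
        Pi.add_apply, Module.End.one_apply, seqRepGen_a, seqRepGen_b, seqRepGen_c, seqRepGen_d,
        smul_eq_C_mul, sub_add_cancel]
      have h := C_mul_zpow_eq q (-k + -k)
      rw [← C_zpow_mul_C_zpow] at h
      rw [show -2 * (k - 1) - 1 = -k + -k + 1 by ring, ← h]
      ring)
    (by
      refine LinearMap.ext fun f => funext fun k => ?_
      simp only [Module.End.mul_apply, LinearMap.smul_apply, Pi.smul_apply, LinearMap.add_apply,
        Pi.add_apply, Module.End.one_apply, seqRepGen_a, seqRepGen_b, seqRepGen_c, seqRepGen_d,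
        smul_eq_C_mul, add_sub_cancel_right]
      have h := C_inv_mul_zpow_eq q (-k + -k)
      rw [← C_zpow_mul_C_zpow] at h
      rw [show -2 * k - 1 = -k + -k - 1 by ring, ← h]
      ring)

theorem seqRep_gen (q : QParam) (x : OGen) : seqRep q (oGen q x) = seqRepGen q x := by
  rw [seqRep, oLift_gen]

open Polynomial in
/-- The representation of the quantum sphere on sequences of polynomials. -/
def sphRep (q : QParam) : S2 q →ₐ[ℂ] Module.End ℂ[X] (ℤ → ℂ[X]) :=
  (seqRep q).comp (sphere q).val

open Polynomial in
theorem sphRep_ac (q : QParam) (f : ℤ → ℂ[X]) (k : ℤ) :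
    sphRep q (sac q) f k = C (qc q ^ (1 - k)) * f (k - 1) := by
  change seqRep q (oa q * oc q) f k = _
  rw [map_mul, Module.End.mul_apply, seqRep_gen, seqRep_gen, seqRepGen_a, seqRepGen_c,
    show -(k - 1) = 1 - k by ring]

open Polynomial in
theorem sphRep_bc (q : QParam) (f : ℤ → ℂ[X]) (k : ℤ) :
    sphRep q (sbc q) f k = C (qc q ^ (-2 * k)) * X * f k := by
  change seqRep q (ob q * oc q) f k = _
  rw [map_mul, Module.End.mul_apply, seqRep_gen, seqRep_gen, seqRepGen_b, seqRepGen_c,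
    show -2 * k = -k + -k by ring, ← C_zpow_mul_C_zpow]
  ring

open Polynomial in
theorem sphRep_bd (q : QParam) (f : ℤ → ℂ[X]) (k : ℤ) :
    sphRep q (sbd q) f k =
      C (qc q ^ (-k)) * X * (1 + C (qc q ^ (-2 * k - 1)) * X) * f (k + 1) := by
  change seqRep q (ob q * od q) f k = _
  rw [map_mul, Module.End.mul_apply, seqRep_gen, seqRep_gen, seqRepGen_b, seqRepGen_d]
  ring

open Polynomial in
theorem sphRep_algebraMap (q : QParam) (r : ℂ) (f : ℤ → ℂ[X]) (k : ℤ) :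
    sphRep q (algebraMap ℂ _ r) f k = C r * f k := by
  rw [AlgHom.commutes, Algebra.algebraMap_eq_smul_one, LinearMap.smul_apply,
    Module.End.one_apply, Pi.smul_apply, smul_eq_C_mul]

open Polynomial in
/-- A shift of sequences, combined with a rescaling, that commutes with the sphere. -/
def twist (q : QParam) (f : ℤ → ℂ[X]) (k : ℤ) : ℂ[X] :=
  C (qc q ^ (-k)) * (f (k - 1)).comp (C (qc q ^ (-2 : ℤ)) * X)

open Polynomial in
-- `twist` satisfies `x T = T ∂_{K²}(x)` on the generators of `O(SU_q(2))`, so it commutes with the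
-- fixed points. For the sphere, the matrix entry at `(k+1, j+1)` is thus the one at `(k, j)` with
-- `X` replaced by `q⁻² X`, up to a power of `q`.
theorem sphRep_twist (q : QParam) (x : S2 q) (f : ℤ → ℂ[X]) :
    sphRep q x (twist q f) = twist q (sphRep q x f) := by
  have hz : ∀ m n : ℤ, qc q ^ (m + n) = qc q ^ m * qc q ^ n := zpow_add₀ (qc_ne_zero q)
  induction x using s2_induction generalizing f with
  | halg r =>
    funext k
    simp only [twist, sphRep_algebraMap, mul_comp, C_comp]
    ring
  | hac =>
    funext k
    simp only [twist, sphRep_ac, mul_comp, C_comp]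
    rw [← mul_assoc, ← mul_assoc, C_zpow_mul_C_zpow, C_zpow_mul_C_zpow]
    congr 3
    ring
  | hbc =>
    funext k
    simp only [twist, sphRep_bc, mul_comp, C_comp, X_comp]
    have h : (C (qc q ^ (-2 * k)) : ℂ[X]) = C (qc q ^ (-2 * (k - 1))) * C (qc q ^ (-2 : ℤ)) := by
      rw [C_zpow_mul_C_zpow]
      congr 2
      ring
    rw [h]
    ring
  | hbd =>
    funext k
    simp only [twist, sphRep_bd, mul_comp, C_comp, X_comp, add_comp, one_comp]
    have h : (C (qc q ^ (-2 * k - 1)) : ℂ[X]) =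
        C (qc q ^ (-2 * (k - 1) - 1)) * C (qc q ^ (-2 : ℤ)) := by
      rw [C_zpow_mul_C_zpow]
      congr 2
      ring
    have h1 : (C (qc q ^ (-(k + 1))) : ℂ[X]) =
        C (qc q ^ (-(k - 1))) * C (qc q ^ (-2 : ℤ)) := by
      rw [C_zpow_mul_C_zpow]
      congr 2
      ring
    rw [h, h1, show k + 1 - 1 = k - 1 + 1 by ring]
    ring
  | hmul x y hx hy => rw [map_mul, Module.End.mul_apply, hy, hx, Module.End.mul_apply]
  | hadd x y hx hy =>
    rw [map_add, LinearMap.add_apply, LinearMap.add_apply, hx, hy]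
    funext k
    simp only [twist, Pi.add_apply, add_comp, mul_add]

/-! ### The counit, the derivations and `θ⁻¹` on the generators of the sphere. -/

theorem oCounit_a (q : QParam) : oCounit q (oa q) = 1 := oCounit_gen q .a
theorem oCounit_b (q : QParam) : oCounit q (ob q) = 0 := oCounit_gen q .b
theorem oCounit_c (q : QParam) : oCounit q (oc q) = 0 := oCounit_gen q .c
theorem oCounit_d (q : QParam) : oCounit q (od q) = 1 := oCounit_gen q .d

theorem eps_gens (q : QParam) : eps q (sac q) = 0 ∧ eps q (sbc q) = 0 ∧ eps q (sbd q) = 0 := by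
  refine ⟨?_, ?_, ?_⟩
  · change oCounit q (oa q * oc q) = 0
    rw [map_mul, oCounit_c, mul_zero]
  · change oCounit q (ob q * oc q) = 0
    rw [map_mul, oCounit_c, mul_zero]
  · change oCounit q (ob q * od q) = 0
    rw [map_mul, oCounit_b, zero_mul]

/-- At the counit only `ac` has an `E`-derivative and only `bd` an `F`-derivative; this is what the
shifts up and down in the representation will detect. -/
theorem derE_gens (q : QParam) :
    derE q (sac q) = qs q ∧ derE q (sbc q) = 0 ∧ derE q (sbd q) = 0 := by
  have hs := qs_ne_zero q
  refine ⟨?_, ?_, ?_⟩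
  · change oCounit q (actKi q (actE q (oa q * oc q))) = _
    simp [actE_mul, actE_gen, actKi_gen, actK_gen, oCounit_gen, hs]
  · change oCounit q (actKi q (actE q (ob q * oc q))) = _
    simp [actE_mul, actE_gen, actKi_gen, actK_gen, oCounit_gen]
  · change oCounit q (actKi q (actE q (ob q * od q))) = _
    simp [actE_mul, actE_gen, actKi_gen, actK_gen]

theorem derF_gens (q : QParam) :
    derF q (sac q) = 0 ∧ derF q (sbc q) = 0 ∧ derF q (sbd q) = qs q := by
  have hs := qs_ne_zero q
  refine ⟨?_, ?_, ?_⟩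
  · change oCounit q (actKi q (actF q (oa q * oc q))) = _
    simp [actF_mul, actF_gen, actKi_gen, actK_gen]
  · change oCounit q (actKi q (actF q (ob q * oc q))) = _
    simp [actF_mul, actF_gen, actKi_gen, actK_gen, oCounit_gen]
  · change oCounit q (actKi q (actF q (ob q * od q))) = _
    simp [actF_mul, actF_gen, actKi_gen, actK_gen, oCounit_gen, hs]

theorem thetaInv_gens (q : QParam) : thetaInv q (sac q) = (qc q)⁻¹ ^ 2 • sac q ∧
    thetaInv q (sbc q) = sbc q ∧ thetaInv q (sbd q) = qc q ^ 2 • sbd q := by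
  have hs := qs_ne_zero q
  refine ⟨s2_ext ?_, s2_ext ?_, s2_ext ?_⟩
  · change actK q (actK q (oa q * oc q)) = (qc q)⁻¹ ^ 2 • (oa q * oc q)
    simp only [map_mul, actK_gen, map_smul, smul_smul, smul_mul_smul_comm, ← qs_mul_qs]
    congr 1
    field_simp
  · change actK q (actK q (ob q * oc q)) = ob q * oc q
    simp only [map_mul, actK_gen, map_smul, smul_smul, smul_mul_smul_comm]
    rw [mul_inv_cancel₀ hs, mul_one, one_smul]
  · change actK q (actK q (ob q * od q)) = qc q ^ 2 • (ob q * od q)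
    simp only [map_mul, actK_gen, map_smul, smul_smul, smul_mul_smul_comm, ← qs_mul_qs]
    congr 1
    ring


/-! ### Existence of a normalizing bilinear form -/

/-- The values of a linear form on the powers of `bc`. -/
def normSeq (q : QParam) : ℕ → ℂ
  -- The recursion leaves two values free: for `m = 0` the coefficient of the value at `1` vanishes.
  -- The value `0` in degree zero makes the linear form vanish on the unit.
  | 0 => 0
  | 1 => 0
  | m + 2 => ((if m = 0 then 1 else 0) - (1 - (qc q ^ (-2 : ℤ)) ^ m) * normSeq q (m + 1)) /
      (qc q - (qc q)⁻¹ * (qc q ^ (-2 : ℤ)) ^ m)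

/-- Vanishing would mean `q^(2m+2) = 1`. -/
theorem normSeq_denom_ne_zero (q : QParam) (m : ℕ) :
    qc q - (qc q)⁻¹ * (qc q ^ (-2 : ℤ)) ^ m ≠ 0 := by
  have hq := qc_ne_zero q
  intro h
  apply qc_zpow_ne_one q (n := 2 * m + 2) (by omega)
  have h1 : qc q = (qc q)⁻¹ * (qc q ^ (-2 : ℤ)) ^ m := sub_eq_zero.mp h
  rw [← zpow_natCast, ← zpow_mul] at h1
  rw [zpow_add₀ hq]
  calc qc q ^ (2 * (m : ℤ)) * qc q ^ (2 : ℤ)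
      = qc q ^ (2 * (m : ℤ)) * qc q * qc q := by
        rw [zpow_two]
        ring
    _ = qc q ^ (2 * (m : ℤ)) * qc q * ((qc q)⁻¹ * qc q ^ (-2 * (m : ℤ))) := by rw [← h1]
    _ = qc q ^ (2 * (m : ℤ)) * qc q ^ (-2 * (m : ℤ)) * (qc q * (qc q)⁻¹) := by ring
    _ = 1 := by
        rw [← zpow_add₀ hq, mul_inv_cancel₀ hq, mul_one]
        ring_nf
        exact zpow_zero _

theorem normSeq_rec (q : QParam) (m : ℕ) :
    (1 - (qc q ^ (-2 : ℤ)) ^ m) * normSeq q (m + 1) +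
      (qc q - (qc q)⁻¹ * (qc q ^ (-2 : ℤ)) ^ m) * normSeq q (m + 2) = if m = 0 then 1 else 0 := by
  rw [normSeq, mul_div_cancel₀ _ (normSeq_denom_ne_zero q m)]
  ring

open Polynomial in
/-- The linear form on polynomials with values `normSeq`. -/
def normPoly (q : QParam) : ℂ[X] →ₗ[ℂ] ℂ :=
  Polynomial.lsum fun n => normSeq q n • LinearMap.id

open Polynomial in
theorem normPoly_monomial (q : QParam) (n : ℕ) (r : ℂ) :
    normPoly q (monomial n r) = normSeq q n * r := by
  rw [normPoly, Polynomial.lsum_apply, Polynomial.sum_monomial_index]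
  · rfl
  · simp

open Polynomial in
-- This single functional equation accounts for both the commutators with `bd` and those with `ac`;
-- on monomials it is exactly the recursion `normSeq_rec`, and the Kronecker delta there becomes
-- evaluation at `0`.
theorem normPoly_rel (q : QParam) (p : ℂ[X]) :
    normPoly q (X * (1 + C (qc q) * X) * p) -
      normPoly q (X * (1 + C (qc q)⁻¹ * X) * p.comp (C (qc q ^ (-2 : ℤ)) * X)) = p.eval 0 := by
  induction p using Polynomial.induction_on' with
  | add p r hp hr =>
    simp only [mul_add, add_comp, map_add, eval_add, ← hp, ← hr]
    ring
  | monomial m r =>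
    have h1 : X * (1 + C (qc q) * X) * monomial m r =
        monomial (m + 1) r + monomial (m + 2) (qc q * r) := by
      simp only [← C_mul_X_pow_eq_monomial, C_mul]
      ring
    have h2 : X * (1 + C (qc q)⁻¹ * X) * (monomial m r).comp (C (qc q ^ (-2 : ℤ)) * X) =
        monomial (m + 1) ((qc q ^ (-2 : ℤ)) ^ m * r) +
          monomial (m + 2) ((qc q)⁻¹ * (qc q ^ (-2 : ℤ)) ^ m * r) := by
      rw [monomial_comp]
      simp only [← C_mul_X_pow_eq_monomial, C_mul, C_pow]
      ring
    have h3 : (monomial m r).eval 0 = (if m = 0 then 1 else 0) * r := by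
      rw [eval_monomial]
      split_ifs with h
      · simp [h]
      · simp [h]
    rw [h1, h2, h3, ← normSeq_rec]
    simp only [map_add, normPoly_monomial]
    ring

/-! ### Reading the derivations off the representation at `X = 0`. -/

open Polynomial in
-- At `X = 0` the operators of `bc` and `bd` vanish and only `ac` moves, by one step up. On
-- sequences starting at `-1` the first two entries therefore transform under a triangular matrix
-- with diagonal `ε` and corner `derE`; the factor `√q` reconciles the entry `q` of `ac` with its
-- derivative `√q`.
theorem sphRep_derE (q : QParam) (x : S2 q) (f : ℤ → ℂ[X]) (hf : ∀ k < -1, (f k).eval 0 = 0) :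
    (∀ k < -1, (sphRep q x f k).eval 0 = 0) ∧
      (sphRep q x f (-1)).eval 0 = eps q x * (f (-1)).eval 0 ∧
      (sphRep q x f 0).eval 0 =
        eps q x * (f 0).eval 0 + qs q * derE q x * (f (-1)).eval 0 := by
  obtain ⟨e1, e2, e3⟩ := eps_gens q
  obtain ⟨d1, d2, d3⟩ := derE_gens q
  induction x using s2_induction generalizing f with
  | halg r =>
    refine ⟨fun k hk => ?_, ?_, ?_⟩
    · rw [sphRep_algebraMap, eval_mul, hf k hk, mul_zero]
    · rw [sphRep_algebraMap, eval_mul, eval_C, AlgHom.commutes]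
      rfl
    · rw [sphRep_algebraMap, eval_mul, eval_C, AlgHom.commutes, derE_algebraMap, mul_zero,
        zero_mul, add_zero]
      rfl
  | hac =>
    simp only [sphRep_ac, eval_mul, eval_C, e1, d1, zero_mul, zero_add, qs_mul_qs]
    refine ⟨fun k hk => ?_, ?_, ?_⟩
    · rw [hf _ (by omega), mul_zero]
    · rw [hf _ (by omega), mul_zero]
    · norm_num
  | hbc => simp [sphRep_bc, e2, d2]
  | hbd => simp [sphRep_bd, e3, d3]
  | hmul x y hx hy =>
    obtain ⟨h1, h2, h3⟩ := hy f hf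
    obtain ⟨h4, h5, h6⟩ := hx _ h1
    rw [map_mul, Module.End.mul_apply, h5, h6, h2, h3, derE_mul, map_mul]
    refine ⟨h4, ?_, ?_⟩ <;> ring
  | hadd x y hx hy =>
    obtain ⟨h1, h2, h3⟩ := hy f hf
    obtain ⟨h4, h5, h6⟩ := hx f hf
    simp only [map_add, LinearMap.add_apply, Pi.add_apply, eval_add, h2, h3, h5, h6]
    refine ⟨fun k hk => ?_, ?_, ?_⟩
    · rw [h1 k hk, h4 k hk, add_zero]
    · ring
    · ring

open Polynomial in
-- Each step down is made by `bd` and costs a factor `X`. So entries at negative positions are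
-- divisible by `X (1 + q X)`, the coefficient of the first step `0 → -1`; after division the value
-- at `X = 0` shows the first-order term `derF`, and positions below `-1` still carry a further `X`.
theorem sphRep_derF (q : QParam) (x : S2 q) (f r : ℤ → ℂ[X])
    (hf : ∀ k < 0, f k = X * (1 + C (qc q) * X) * r k) (hr : ∀ k < -1, (r k).eval 0 = 0) :
    ∃ s : ℤ → ℂ[X], (∀ k < 0, sphRep q x f k = X * (1 + C (qc q) * X) * s k) ∧
      (∀ k < -1, (s k).eval 0 = 0) ∧
      (s (-1)).eval 0 = eps q x * (r (-1)).eval 0 + qs q * derF q x * (f 0).eval 0 ∧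
      (sphRep q x f 0).eval 0 = eps q x * (f 0).eval 0 := by
  obtain ⟨e1, e2, e3⟩ := eps_gens q
  obtain ⟨d1, d2, d3⟩ := derF_gens q
  induction x using s2_induction generalizing f r with
  | halg z =>
    refine ⟨fun k => C z * r k, fun k hk => ?_, fun k hk => ?_, ?_, ?_⟩
    · rw [sphRep_algebraMap, hf k hk]
      ring
    · rw [eval_mul, hr k hk, mul_zero]
    · simp [derF_algebraMap]
    · simp
  | hac =>
    refine ⟨fun k => C (qc q ^ (1 - k)) * r (k - 1), fun k hk => ?_, fun k hk => ?_, ?_, ?_⟩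
    · rw [sphRep_ac, hf _ (by omega)]
      ring
    · rw [eval_mul, hr _ (by omega), mul_zero]
    · rw [eval_mul, hr _ (by omega), e1, d1]
      ring
    · rw [sphRep_ac, hf _ (by omega), e1]
      simp
  | hbc =>
    refine ⟨fun k => C (qc q ^ (-2 * k)) * X * r k, fun k hk => ?_, fun k hk => ?_, ?_, ?_⟩
    · rw [sphRep_bc, hf k hk]
      ring
    · simp
    · simp [e2, d2]
    · simp [sphRep_bc, e2]
  | hbd =>
    -- At `-1` the divisor is the coefficient of `bd` itself, so nothing is needed of `f 0`. Further
    -- down the divisor is inherited from `f (k + 1)`, and the coefficient of `bd` supplies the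
    -- extra `X`.
    refine ⟨fun k => if k = -1 then C (qc q) * f 0 else
      C (qc q ^ (-k)) * X * (1 + C (qc q ^ (-2 * k - 1)) * X) * r (k + 1),
      fun k hk => ?_, fun k hk => ?_, ?_, ?_⟩
    · rw [sphRep_bd]
      beta_reduce
      split_ifs with h
      · subst h
        norm_num
        ring
      · rw [hf _ (by omega)]
        ring
    · beta_reduce
      rw [if_neg (by omega)]
      simp
    · beta_reduce
      rw [if_pos rfl, e3, d3, qs_mul_qs]
      simp
    · simp [sphRep_bd, e3]
  | hmul x y hx hy =>
    obtain ⟨s, h1, h2, h3, h4⟩ := hy f r hf hr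
    obtain ⟨t, h5, h6, h7, h8⟩ := hx _ s h1 h2
    rw [map_mul, Module.End.mul_apply]
    refine ⟨t, h5, h6, ?_, ?_⟩
    · rw [h7, h3, h4, derF_mul, map_mul]
      ring
    · rw [h8, h4, map_mul]
      ring
  | hadd x y hx hy =>
    obtain ⟨s, h1, h2, h3, h4⟩ := hy f r hf hr
    obtain ⟨t, h5, h6, h7, h8⟩ := hx f r hf hr
    refine ⟨fun k => t k + s k, fun k hk => ?_, fun k hk => ?_, ?_, ?_⟩
    · rw [map_add, LinearMap.add_apply, Pi.add_apply, h1 k hk, h5 k hk]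
      ring
    · rw [eval_add, h2 k hk, h6 k hk, add_zero]
    · rw [eval_add, h3, h7, map_add, map_add]
      ring
    · rw [map_add, LinearMap.add_apply, Pi.add_apply, eval_add, h4, h8, map_add]
      ring

/-! ### The linear form `g` and its twisted commutators. -/

open Polynomial in
/-- A twisted trace up to a twisted 1-cocycle: a linear form `g` on the quantum sphere with
`g(xy) - g(θ⁻¹(y)x) = q ε(K⁻¹E ▷ x) ε(K⁻¹F ▷ y) - q⁻¹ ε(K⁻¹F ▷ x) ε(K⁻¹E ▷ y)`. -/
def normForm (q : QParam) : S2 q →ₗ[ℂ] ℂ where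
  toFun x := normPoly q (sphRep q x (Pi.single 0 1) 0)
  map_add' x y := by simp
  map_smul' r x := by simp

open Polynomial in
theorem normForm_apply (q : QParam) (x : S2 q) :
    normForm q x = normPoly q (sphRep q x (Pi.single 0 1) 0) := rfl

open Polynomial in
theorem normForm_one (q : QParam) : normForm q 1 = 0 := by
  rw [normForm_apply, map_one, Module.End.one_apply, Pi.single_eq_same, ← monomial_zero_one,
    normPoly_monomial, normSeq, zero_mul]

open Polynomial in
theorem twist_single (q : QParam) (j : ℤ) :
    twist q (Pi.single j 1) = C (qc q ^ (-(j + 1))) • (Pi.single (j + 1) 1 : ℤ → ℂ[X]) := by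
  funext k
  rw [twist, Pi.smul_apply, smul_eq_mul]
  by_cases h : k = j + 1
  · subst h
    simp
  · rw [Pi.single_eq_of_ne h, Pi.single_eq_of_ne (by omega)]
    simp

open Polynomial in
-- At position `0` the element `bc` is multiplication by `X`, and the operators are `ℂ[X]`-linear,
-- so the order does not matter.
theorem normForm_mul_bc (q : QParam) (w : S2 q) :
    normForm q (w * sbc q) = normForm q (sbc q * w) := by
  have h : sphRep q (sbc q) (Pi.single 0 1) = (X : ℂ[X]) • Pi.single 0 1 := by
    funext k
    rw [sphRep_bc, Pi.smul_apply, smul_eq_mul]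
    by_cases h : k = 0
    · subst h
      simp
    · simp [Pi.single_eq_of_ne h]
  rw [normForm_apply, normForm_apply, map_mul, map_mul, Module.End.mul_apply,
    Module.End.mul_apply, h, map_smul, sphRep_bc, Pi.smul_apply]
  simp

open Polynomial in
-- With `p` the `(0,-1)` entry of `w`, one product contributes `q X (1 + q X) p` and the other `X (1
-- + q⁻¹ X)` times the `(1,0)` entry, which is the twist of `p`. Then `normPoly_rel` leaves `p(0)`,
-- which is `√q derE(w)`.
theorem normForm_mul_bd (q : QParam) (w : S2 q) :
    normForm q (w * sbd q) - qc q ^ 2 * normForm q (sbd q * w) =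
      qc q * (derE q w * qs q) := by
  have hq := qc_ne_zero q
  have h : sphRep q (sbd q) (Pi.single 0 1) =
      (C (qc q) * (X * (1 + C (qc q) * X)) : ℂ[X]) • Pi.single (-1) 1 := by
    funext k
    rw [sphRep_bd, Pi.smul_apply, smul_eq_mul]
    by_cases h : k = -1
    · subst h
      norm_num
      ring
    · rw [Pi.single_eq_of_ne h, Pi.single_eq_of_ne (by omega)]
      simp
  set p := sphRep q w (Pi.single (-1) 1) 0 with hp
  -- The `(1,0)` entry is the `(0,-1)` entry moved along the diagonal by the commuting operator
  -- `twist`.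
  have h1 : sphRep q w (Pi.single 0 1) 1 =
      C (qc q)⁻¹ * p.comp (C (qc q ^ (-2 : ℤ)) * X) := by
    have := congrFun (sphRep_twist q w (Pi.single (-1) 1)) 1
    rw [twist_single, map_smul, Pi.smul_apply, twist] at this
    simpa using this
  have h2 : p.eval 0 = qs q * derE q w := by
    have := (sphRep_derE q w (Pi.single (-1) 1)
      (fun k hk => by rw [Pi.single_eq_of_ne (by omega), eval_zero])).2.2
    rw [← hp] at this
    simpa using this
  have h3 := normPoly_rel q p
  rw [normForm_apply, normForm_apply, map_mul, map_mul, Module.End.mul_apply,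
    Module.End.mul_apply, h, map_smul, sphRep_bd, Pi.smul_apply, ← hp, smul_eq_mul, zero_add, h1]
  have e1 : C (qc q) * (X * (1 + C (qc q) * X)) * p =
      qc q • (X * (1 + C (qc q) * X) * p) := by
    rw [smul_eq_C_mul]
    ring
  have e2 : C (qc q ^ (-0 : ℤ)) * X * (1 + C (qc q ^ (-2 * (0 : ℤ) - 1)) * X) *
      (C (qc q)⁻¹ * p.comp (C (qc q ^ (-2 : ℤ)) * X)) =
      (qc q)⁻¹ • (X * (1 + C (qc q)⁻¹ * X) * p.comp (C (qc q ^ (-2 : ℤ)) * X)) := by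
    rw [smul_eq_C_mul]
    norm_num
    ring
  rw [e1, e2, map_smul, map_smul, smul_eq_mul, smul_eq_mul]
  rw [h2] at h3
  have h4 : qc q ^ 2 * ((qc q)⁻¹ *
      normPoly q (X * (1 + C (qc q)⁻¹ * X) * p.comp (C (qc q ^ (-2 : ℤ)) * X))) =
      qc q * normPoly q (X * (1 + C (qc q)⁻¹ * X) * p.comp (C (qc q ^ (-2 : ℤ)) * X)) := by
    field_simp
  rw [h4]
  linear_combination qc q * h3

open Polynomial in
-- Here `p` is the `(-1,0)` entry of `w`. It is divisible by `X (1 + q X)`, and `normPoly_rel` is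
-- applied to the quotient, whose value at `0` is `√q derF(w)`.
theorem normForm_mul_ac (q : QParam) (w : S2 q) :
    normForm q (w * sac q) - (qc q)⁻¹ ^ 2 * normForm q (sac q * w) =
      -((qc q)⁻¹ * (derF q w * qs q)) := by
  have hq := qc_ne_zero q
  have h : sphRep q (sac q) (Pi.single 0 1) = Pi.single 1 1 := by
    funext k
    rw [sphRep_ac]
    by_cases h : k = 1
    · subst h
      simp
    · rw [Pi.single_eq_of_ne h, Pi.single_eq_of_ne (by omega), mul_zero]
  set p := sphRep q w (Pi.single 0 1) (-1) with hp
  have h1 : sphRep q w (Pi.single 1 1) 0 = C (qc q) * p.comp (C (qc q ^ (-2 : ℤ)) * X) := by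
    have h2 := congrFun (sphRep_twist q w (Pi.single 0 1)) 0
    rw [twist_single, map_smul, Pi.smul_apply, twist, smul_eq_mul] at h2
    have h3 := congrArg (fun p => C (qc q) * p) h2
    simp only [← mul_assoc, ← C_mul] at h3
    simpa [hq] using h3
  -- The start vector sits at position `0`, so its negative entries vanish and the zero quotient
  -- serves as initial datum.
  obtain ⟨s, h2, h3, h4, -⟩ := sphRep_derF q w (Pi.single 0 1) 0
    (fun k hk => by rw [Pi.single_eq_of_ne (by omega)]; simp) (fun k hk => by simp)
  have h5 : p = X * (1 + C (qc q) * X) * s (-1) := h2 (-1) (by norm_num)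
  have h6 : (s (-1)).eval 0 = qs q * derF q w := by simpa using h4
  have h7 := normPoly_rel q (s (-1))
  rw [normForm_apply, normForm_apply, map_mul, map_mul, Module.End.mul_apply,
    Module.End.mul_apply, h, sphRep_ac, h1, zero_sub, ← hp]
  have e1 : C (qc q) * p.comp (C (qc q ^ (-2 : ℤ)) * X) = (qc q)⁻¹ •
      (X * (1 + C (qc q)⁻¹ * X) * (s (-1)).comp (C (qc q ^ (-2 : ℤ)) * X)) := by
    have e3 : (C (qc q)⁻¹ : ℂ[X]) = C (qc q) * C (qc q ^ (-2 : ℤ)) := by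
      rw [← C_mul]
      congr 1
      rw [zpow_neg, zpow_two]
      field_simp
    rw [h5, smul_eq_C_mul, e3]
    simp only [mul_comp, add_comp, one_comp, C_comp, X_comp]
    have e4 : (C (qc q) * C (qc q) * C (qc q ^ (-2 : ℤ)) : ℂ[X]) = 1 := by
      rw [← C_mul, ← C_mul, ← C_1]
      congr 1
      rw [zpow_neg, zpow_two]
      field_simp
    ring
  have e2 : C (qc q ^ (1 - 0 : ℤ)) * p = qc q • (X * (1 + C (qc q) * X) * s (-1)) := by
    rw [smul_eq_C_mul, ← h5]
    simp
  rw [e1, e2, map_smul, map_smul, smul_eq_mul, smul_eq_mul]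
  rw [h6] at h7
  have h8 : (qc q)⁻¹ ^ 2 * (qc q * normPoly q (X * (1 + C (qc q) * X) * s (-1))) =
      (qc q)⁻¹ * normPoly q (X * (1 + C (qc q) * X) * s (-1)) := by
    field_simp
  rw [h8]
  linear_combination -(qc q)⁻¹ * h7

/-- Both sides are compatible with products in `y`: the twisted commutator with `yz` is taken in two
turns, `z` first and then `y`, and the right-hand side obeys the same rule by Leibniz and the
scaling of `derE`, `derF` under `θ⁻¹`. Hence generators are enough. -/
theorem normForm_mul (q : QParam) (x y : S2 q) :
    normForm q (x * y) - normForm q (thetaInv q y * x) =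
      qc q * (derE q x * derF q y) - (qc q)⁻¹ * (derF q x * derE q y) := by
  have hq := qc_ne_zero q
  obtain ⟨t1, t2, t3⟩ := thetaInv_gens q
  obtain ⟨d1, d2, d3⟩ := derE_gens q
  obtain ⟨f1, f2, f3⟩ := derF_gens q
  induction y using s2_induction generalizing x with
  | halg r => rw [AlgEquiv.commutes, Algebra.commutes, derE_algebraMap, derF_algebraMap]; ring
  | hac =>
    rw [t1, smul_mul_assoc, map_smul, smul_eq_mul, normForm_mul_ac, d1, f1]
    ring
  | hbc =>
    rw [t2, normForm_mul_bc, d2, f2]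
    ring
  | hbd =>
    rw [t3, smul_mul_assoc, map_smul, smul_eq_mul, normForm_mul_bd, d3, f3]
    ring
  | hmul y z hy hz =>
    have h1 := hz (x * y)
    have h2 := hy (thetaInv q z * x)
    have h3 := derE_thetaInv q z
    have h4 := derF_thetaInv q z
    have h5 : derE q (thetaInv q z) = (qc q)⁻¹ ^ 2 * derE q z := by
      rw [h3]
      field_simp
    simp only [derE_mul, derF_mul, h4, h5, eps_thetaInv, mul_assoc] at h1 h2
    rw [map_mul (thetaInv q), mul_assoc, derE_mul, derF_mul]
    -- The mixed terms in which `y` and `z` are both differentiated appear in each turn; rescaled by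
    -- `θ⁻¹(z)` they acquire opposite signs and cancel.
    have h6 : qc q * ((qc q)⁻¹ ^ 2 * (derE q z * (eps q x * derF q y))) =
        (qc q)⁻¹ * (derE q z * (eps q x * derF q y)) := by
      field_simp
    have h7 : (qc q)⁻¹ * (qc q ^ 2 * (derF q z * (eps q x * derE q y))) =
        qc q * (derF q z * (eps q x * derE q y)) := by
      field_simp
    linear_combination h1 + h2 + h6 - h7
  | hadd y z hy hz =>
    simp only [mul_add, map_add, add_mul]
    linear_combination hy x + hz x

theorem normForm_thetaInv (q : QParam) (x : S2 q) :
    normForm q (thetaInv q x) = normForm q x := by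
  have h := normForm_mul q 1 x
  rw [one_mul, mul_one, derE_one, derF_one] at h
  linear_combination -h

/-- The condition on `χ` only restricts its twisted symmetrization. The term `g(xy)` converts the
antisymmetric combination of `derE`, `derF` in `normForm_mul` into what is needed, and the last term
of `χ` adds the symmetric one. -/
theorem exists_isNormalizing (q : QParam) :
    ∃ χ : S2 q ⊗[ℂ] S2 q →ₗ[ℂ] ℂ, IsNormalizing q χ := by
  have hq := qc_ne_zero q
  -- The terms with `eps` cancel against each other under the flip, but they give `χ(1, z) = g(z)`
  -- instead of half of it.
  refine ⟨(1 / 2 : ℂ) • (normForm q ∘ₗ LinearMap.mul' ℂ (S2 q) +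
    LinearMap.mul' ℂ ℂ ∘ₗ TensorProduct.map (eps q).toLinearMap (normForm q) -
    LinearMap.mul' ℂ ℂ ∘ₗ TensorProduct.map (normForm q) (eps q).toLinearMap -
    qc q • (LinearMap.mul' ℂ ℂ ∘ₗ TensorProduct.map (derE q) (derF q))), ?_⟩
  intro x y
  have h := normForm_mul q x y
  have h1 := derE_thetaInv q y
  have h2 : qc q * derE q (thetaInv q y) = (qc q)⁻¹ * derE q y := by
    rw [h1]
    field_simp
  rw [krahmer, LinearMap.add_apply, varphi_eq, LinearMap.comp_apply, hochB2_tmul]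
  simp only [map_sub, map_add, LinearMap.smul_apply, LinearMap.sub_apply, LinearMap.add_apply,
    LinearMap.comp_apply, LinearMap.mul'_apply, TensorProduct.map_tmul, smul_eq_mul, one_mul,
    mul_one, AlgHom.toLinearMap_apply, map_one, normForm_one, derE_one, eps_thetaInv,
    normForm_thetaInv, map_mul]
  linear_combination (-1 / 2 : ℂ) * h - (1 / 2 : ℂ) * derF q x * h2


/-! ### Gaussian binomial coefficients -/

theorem qInt_add (q : QParam) (a b : ℕ) :
    qInt q ((a + b : ℕ) : ℤ) = (q : ℝ)⁻¹ ^ a * qInt q b + (q : ℝ) ^ b * qInt q a := by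
  have h := real_sub_inv_ne_zero q
  have h0 : (q : ℝ) ≠ 0 := q.2.1.ne'
  simp only [qInt, zpow_neg, zpow_natCast, ← mul_div_assoc, ← add_div]
  congr 1
  rw [pow_add, inv_pow]
  field_simp
  ring

theorem qInt_one (q : QParam) : qInt q 1 = 1 := by
  rw [qInt, zpow_neg, zpow_one, div_self (real_sub_inv_ne_zero q)]

theorem qInt_zero (q : QParam) : qInt q 0 = 0 := by simp [qInt]

theorem qInt_pos (q : QParam) (n : ℕ) : 0 < qInt q ((n : ℤ) + 1) := by
  have h1 := qInt_add q n 1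
  have h2 := qInt_nonneg q n
  have h3 := q.2.1
  push_cast at h1
  rw [h1, qInt_one]
  positivity

theorem qFactorial_succ (q : QParam) (n : ℕ) :
    qFactorial q (n + 1) = qFactorial q n * qInt q ((n : ℤ) + 1) :=
  Finset.prod_range_succ _ _

theorem qFactorial_zero (q : QParam) : qFactorial q 0 = 1 := Finset.prod_range_zero _

theorem qFactorial_pos (q : QParam) (n : ℕ) : 0 < qFactorial q n :=
  Finset.prod_pos fun i _ => qInt_pos q i

/-- The Gaussian binomial coefficient with parameter `q ^ (-2)`, by Pascal's recursion. -/
def gaussBinom (q : QParam) : ℕ → ℕ → ℝ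
  | _, 0 => 1
  | 0, _ + 1 => 0
  | n + 1, i + 1 => ((q : ℝ)⁻¹ ^ 2) ^ (i + 1) * gaussBinom q n (i + 1) + gaussBinom q n i

theorem gaussBinom_zero_right (q : QParam) (n : ℕ) : gaussBinom q n 0 = 1 := by
  cases n <;> rfl

theorem gaussBinom_succ_succ (q : QParam) (n i : ℕ) : gaussBinom q (n + 1) (i + 1) =
    ((q : ℝ)⁻¹ ^ 2) ^ (i + 1) * gaussBinom q n (i + 1) + gaussBinom q n i := by
  rw [gaussBinom]

theorem gaussBinom_of_lt (q : QParam) {n i : ℕ} (h : n < i) : gaussBinom q n i = 0 := by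
  induction n generalizing i with
  | zero =>
    obtain ⟨j, rfl⟩ : ∃ j, i = j + 1 := ⟨i - 1, by omega⟩
    rfl
  | succ n ih =>
    obtain ⟨j, rfl⟩ : ∃ j, i = j + 1 := ⟨i - 1, by omega⟩
    rw [gaussBinom_succ_succ, ih (by omega), ih (by omega), mul_zero, add_zero]

theorem gaussBinom_self (q : QParam) (n : ℕ) : gaussBinom q n n = 1 := by
  induction n with
  | zero => rfl
  | succ n ih =>
    rw [gaussBinom_succ_succ, ih, gaussBinom_of_lt q (Nat.lt_succ_self n), mul_zero, zero_add]

/-- Pascal's recursion matches the splitting `[i+d+2] = q^(-(i+1)) [d+1] + q^(d+1) [i+1]` of the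
last factor of the factorial; the induction runs over the sum of the two indices. -/
theorem gaussBinom_mul_qFactorial (q : QParam) (i d : ℕ) :
    gaussBinom q (i + d) i * (qFactorial q i * qFactorial q d) =
      (q : ℝ)⁻¹ ^ (i * d) * qFactorial q (i + d) := by
  have h0 : (q : ℝ) ≠ 0 := q.2.1.ne'
  induction hn : i + d generalizing i d with
  | zero =>
    obtain ⟨rfl, rfl⟩ : i = 0 ∧ d = 0 := by omega
    simp [gaussBinom_zero_right, qFactorial_zero]
  | succ n ih =>
    rcases i with _ | i
    · obtain rfl : d = n + 1 := by omega
      simp [gaussBinom_zero_right, qFactorial_zero]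
    rcases d with _ | d
    · obtain rfl : i = n := by omega
      simp [gaussBinom_self, qFactorial_zero]
    obtain rfl : n = i + d + 1 := by omega
    have h1 := ih (i + 1) d (by omega)
    have h2 := ih i (d + 1) (by omega)
    have h3 := qInt_add q (i + 1) (d + 1)
    rw [show ((i + 1 + (d + 1) : ℕ) : ℤ) = ((i + d + 1 : ℕ) : ℤ) + 1 by push_cast; ring] at h3
    push_cast at h3
    rw [gaussBinom_succ_succ, qFactorial_succ q (i + d + 1)]
    push_cast
    rw [h3]
    have e1 : (q : ℝ)⁻¹ ^ ((i + 1) * (d + 1)) * (q : ℝ)⁻¹ ^ (i + 1) =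
        ((q : ℝ)⁻¹ ^ 2) ^ (i + 1) * (q : ℝ)⁻¹ ^ ((i + 1) * d) := by
      ring
    have e2 : (q : ℝ)⁻¹ ^ ((i + 1) * (d + 1)) * (q : ℝ) ^ (d + 1) =
        (q : ℝ)⁻¹ ^ (i * (d + 1)) := by
      rw [add_mul, one_mul, pow_add, mul_assoc, ← mul_pow, inv_mul_cancel₀ h0, one_pow, mul_one]
    have e3 := qFactorial_succ q i
    have e4 := qFactorial_succ q d
    calc (((q : ℝ)⁻¹ ^ 2) ^ (i + 1) * gaussBinom q (i + d + 1) (i + 1) +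
          gaussBinom q (i + d + 1) i) * (qFactorial q (i + 1) * qFactorial q (d + 1))
        = ((q : ℝ)⁻¹ ^ 2) ^ (i + 1) * (gaussBinom q (i + d + 1) (i + 1) *
            (qFactorial q (i + 1) * qFactorial q d)) * qInt q (d + 1) +
          (gaussBinom q (i + d + 1) i * (qFactorial q i * qFactorial q (d + 1))) *
            qInt q (i + 1) := by
          rw [e3, e4]
          ring
      _ = _ := by
          rw [h1, h2, ← e2]
          linear_combination -(qFactorial q (i + d + 1) * qInt q (d + 1)) * e1

theorem binomSqrt_radicand (q : QParam) {n i : ℕ} (h : i ≤ n) :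
    (q : ℝ) ^ (-((i : ℤ) * ((n : ℤ) - i))) *
      (qFactorial q n / (qFactorial q i * qFactorial q (n - i))) = gaussBinom q n i := by
  obtain ⟨d, rfl⟩ := Nat.exists_eq_add_of_le h
  have h1 := qFactorial_pos q i
  have h2 := qFactorial_pos q d
  have h3 := gaussBinom_mul_qFactorial q i d
  rw [Nat.add_sub_cancel_left, mul_div_assoc', div_eq_iff (by positivity), h3]
  congr 1
  rw [zpow_neg, inv_pow, ← zpow_natCast]
  congr 2
  push_cast
  ring

theorem gaussBinom_pos (q : QParam) {n i : ℕ} (h : i ≤ n) : 0 < gaussBinom q n i := by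
  have h1 := qFactorial_pos q i
  have h2 := qFactorial_pos q (n - i)
  have h3 := qFactorial_pos q n
  have h4 := q.2.1
  rw [← binomSqrt_radicand q h]
  positivity

theorem binomSqrt_eq (q : QParam) {n i : ℕ} (h : i ≤ n) :
    binomSqrt q n i = ((Real.sqrt (gaussBinom q n i) : ℝ) : ℂ) := by
  rw [binomSqrt, binomSqrt_radicand q h]

theorem binomSqrt_mul_self (q : QParam) {n i : ℕ} (h : i ≤ n) :
    binomSqrt q n i * binomSqrt q n i = (gaussBinom q n i : ℂ) := by
  rw [binomSqrt_eq q h, ← Complex.ofReal_mul, Real.mul_self_sqrt (gaussBinom_pos q h).le]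

theorem binomSqrt_zero_right (q : QParam) (n : ℕ) : binomSqrt q n 0 = 1 := by
  rw [binomSqrt_eq q (Nat.zero_le n), gaussBinom_zero_right]
  simp

theorem binomSqrt_self (q : QParam) (n : ℕ) : binomSqrt q n n = 1 := by
  rw [binomSqrt_eq q le_rfl, gaussBinom_self]
  simp

theorem conj_binomSqrt (q : QParam) (n i : ℕ) :
    (starRingEnd ℂ) (binomSqrt q n i) = binomSqrt q n i := Complex.conj_ofReal _

/-- The quotient of neighbouring coefficients. Its square root is what links adjacent entries of a
spin row to the matrix elements `alpha` of `E` and `F`. -/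
theorem gaussBinom_ratio (q : QParam) (i d : ℕ) :
    gaussBinom q (i + d + 1) (i + 1) * qInt q ((i : ℤ) + 1) * (q : ℝ) ^ d =
      gaussBinom q (i + d + 1) i * qInt q ((d : ℤ) + 1) * (q : ℝ) ^ i := by
  have h0 : (q : ℝ) ≠ 0 := q.2.1.ne'
  have h1 := gaussBinom_mul_qFactorial q (i + 1) d
  have h2 := gaussBinom_mul_qFactorial q i (d + 1)
  rw [show i + 1 + d = i + d + 1 by ring, qFactorial_succ q i] at h1
  rw [show i + (d + 1) = i + d + 1 by ring, qFactorial_succ q d] at h2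
  have h3 := (qFactorial_pos q i).ne'
  have h4 := (qFactorial_pos q d).ne'
  have e1 : (q : ℝ)⁻¹ ^ ((i + 1) * d) * (q : ℝ) ^ d = (q : ℝ)⁻¹ ^ (i * d) := by
    rw [add_mul, one_mul, pow_add, mul_assoc, ← mul_pow, inv_mul_cancel₀ h0, one_pow, mul_one]
  have e2 : (q : ℝ)⁻¹ ^ (i * (d + 1)) * (q : ℝ) ^ i = (q : ℝ)⁻¹ ^ (i * d) := by
    rw [mul_add, mul_one, pow_add, mul_assoc, ← mul_pow, inv_mul_cancel₀ h0, one_pow, mul_one]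
  apply mul_right_cancel₀ (mul_ne_zero h3 h4)
  linear_combination (q : ℝ) ^ d * h1 - (q : ℝ) ^ i * h2 +
    qFactorial q (i + d + 1) * e1 - qFactorial q (i + d + 1) * e2

theorem qs_pow_sq (q : QParam) (i : ℕ) : (Real.sqrt q ^ i) ^ 2 = (q : ℝ) ^ i := by
  rw [← pow_mul, mul_comm, pow_mul, Real.sq_sqrt q.2.1.le]

theorem binomSqrt_ratio_real (q : QParam) (i d : ℕ) :
    Real.sqrt (gaussBinom q (i + d + 1) (i + 1)) * Real.sqrt (qInt q ((i : ℤ) + 1)) *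
        Real.sqrt q ^ d =
      Real.sqrt (gaussBinom q (i + d + 1) i) * Real.sqrt (qInt q ((d : ℤ) + 1)) *
        Real.sqrt q ^ i := by
  have h1 := (gaussBinom_pos q (show i + 1 ≤ i + d + 1 by omega)).le
  have h2 := (gaussBinom_pos q (show i ≤ i + d + 1 by omega)).le
  have h3 := (qInt_pos q i).le
  have h4 := (qInt_pos q d).le
  rw [← sq_eq_sq₀ (by positivity) (by positivity)]
  simp only [mul_pow _ _ 2, Real.sq_sqrt h1, Real.sq_sqrt h2, Real.sq_sqrt h3, Real.sq_sqrt h4,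
    qs_pow_sq]
  exact gaussBinom_ratio q i d

theorem alpha_eq (q : QParam) (i d : ℕ) : alpha q (i + d + 1) i =
    ((Real.sqrt (qInt q ((d : ℤ) + 1)) * Real.sqrt (qInt q ((i : ℤ) + 1)) : ℝ) : ℂ) := by
  rw [alpha, ← Real.sqrt_mul (qInt_pos q d).le]
  congr 4
  push_cast
  ring

theorem alpha_mul_binomSqrt_succ (q : QParam) (i d : ℕ) :
    alpha q (i + d + 1) i * binomSqrt q (i + d + 1) (i + 1) * qs q ^ d =
      binomSqrt q (i + d + 1) i * (qInt q ((d : ℤ) + 1) : ℝ) * qs q ^ i := by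
  have h := binomSqrt_ratio_real q i d
  have h1 := Real.mul_self_sqrt (qInt_pos q d).le
  rw [alpha_eq, binomSqrt_eq q (by omega), binomSqrt_eq q (by omega), qs]
  simp only [← Complex.ofReal_mul, ← Complex.ofReal_pow]
  congr 1
  linear_combination Real.sqrt (qInt q ((d : ℤ) + 1)) * h +
    Real.sqrt (gaussBinom q (i + d + 1) i) * Real.sqrt q ^ i * h1

theorem alpha_mul_binomSqrt (q : QParam) (i d : ℕ) :
    alpha q (i + d + 1) i * binomSqrt q (i + d + 1) i * qs q ^ i =
      binomSqrt q (i + d + 1) (i + 1) * (qInt q ((i : ℤ) + 1) : ℝ) * qs q ^ d := by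
  have h := binomSqrt_ratio_real q i d
  have h1 := Real.mul_self_sqrt (qInt_pos q i).le
  rw [alpha_eq, binomSqrt_eq q (by omega), binomSqrt_eq q (by omega), qs]
  simp only [← Complex.ofReal_mul, ← Complex.ofReal_pow]
  congr 1
  linear_combination -Real.sqrt (qInt q ((i : ℤ) + 1)) * h +
    Real.sqrt (gaussBinom q (i + d + 1) (i + 1)) * Real.sqrt q ^ d * h1

theorem alpha_top (q : QParam) (n : ℕ) : alpha q n n = 0 := by
  simp [alpha, qInt_zero]

/-- Pascal's rule in summed form, with values in any module, so that both orthogonality relations of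
a row can use it. -/
theorem sum_gaussBinom_succ {M : Type*} [AddCommGroup M] [Module ℂ M] (q : QParam) (n : ℕ)
    (f : ℕ → M) : ∑ i ∈ Finset.range (n + 2), (gaussBinom q (n + 1) i : ℂ) • f i =
      ∑ i ∈ Finset.range (n + 1),
        (gaussBinom q n i : ℂ) • ((((qc q)⁻¹ ^ 2) ^ i) • f i + f (i + 1)) := by
  have hc : ∀ i, (gaussBinom q (n + 1) (i + 1) : ℂ) =
      ((qc q)⁻¹ ^ 2) ^ (i + 1) * gaussBinom q n (i + 1) + gaussBinom q n i := by
    intro i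
    rw [gaussBinom_succ_succ, qc]
    push_cast
    rfl
  rw [Finset.sum_range_succ']
  simp only [hc, add_smul, Finset.sum_add_distrib, smul_add]
  rw [gaussBinom_zero_right, ← gaussBinom_zero_right q n, add_right_comm]
  congr 1
  have h := Finset.sum_range_succ' (fun i => (((qc q)⁻¹ ^ 2) ^ i * gaussBinom q n i : ℂ) • f i)
    (n + 1)
  rw [pow_zero, one_mul] at h
  rw [← h, Finset.sum_range_succ, gaussBinom_of_lt q (Nat.lt_succ_self n)]
  simp only [Complex.ofReal_zero, mul_zero, zero_smul, add_zero, smul_smul]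
  exact Finset.sum_congr rfl fun i _ => by rw [mul_comm]


/-! ### Rows of the spin corepresentations -/

theorem oStar_smul (q : QParam) (r : ℂ) (x : O q) :
    oStar q (r • x) = (starRingEnd ℂ r) • oStar q x := by
  rw [Algebra.smul_def, oStar_mul, oStar_algebraMap, ← Algebra.commutes, ← Algebra.smul_def]

theorem oStar_pow (q : QParam) (x : O q) (n : ℕ) : oStar q (x ^ n) = oStar q x ^ n := by
  induction n with
  | zero => rw [pow_zero, pow_zero, oStar_one]
  | succ n ih => rw [pow_succ, pow_succ', oStar_mul, ih]

theorem oStar_neg (q : QParam) (x : O q) : oStar q (-x) = -oStar q x := by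
  simp [oStar]

theorem conj_qs (q : QParam) : (starRingEnd ℂ) (qs q) = qs q := Complex.conj_ofReal _

/-- An instance of `f ▷ x* = (S(f)* ▷ x)*`, with `S(E)* = -q F`. -/
theorem actE_oStar (q : QParam) (x : O q) :
    actE q (oStar q x) = -(qc q • oStar q (actF q x)) := by
  have hq := qc_ne_zero q
  have hK : ∀ y, actK q (oStar q y) = oStar q (actKi q y) := fun y => by
    rw [← actK_actKi q (oStar q (actKi q y)), ← oStar_actK, actK_actKi]
  induction x using o_induction with
  | halg r => simp [oStar_algebraMap, actE_algebraMap, actF_algebraMap, oStar_zero]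
  | hgen x =>
    cases x <;>
      simp [actE_gen, actF_gen, oStar_gen, oStarGen, oStar_zero, hq]
  | hmul x y hx hy =>
    rw [oStar_mul, actE_mul, actF_mul, hx, hy, oStar_add, oStar_mul, oStar_mul, hK, oStar_actK]
    simp only [mul_neg, neg_mul, smul_add, smul_mul_assoc, mul_smul_comm]
    abel
  | hadd x y hx hy =>
    simp only [oStar_add, map_add, hx, hy, smul_add]
    abel

theorem actF_oStar (q : QParam) (x : O q) :
    actF q (oStar q x) = -((qc q)⁻¹ • oStar q (actE q x)) := by
  have hq := qc_ne_zero q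
  have hK : ∀ y, actK q (oStar q y) = oStar q (actKi q y) := fun y => by
    rw [← actK_actKi q (oStar q (actKi q y)), ← oStar_actK, actK_actKi]
  induction x using o_induction with
  | halg r => simp [oStar_algebraMap, actE_algebraMap, actF_algebraMap, oStar_zero]
  | hgen x =>
    cases x <;>
      simp [actE_gen, actF_gen, oStar_gen, oStarGen, oStar_zero, hq]
  | hmul x y hx hy =>
    rw [oStar_mul, actF_mul, actE_mul, hx, hy, oStar_add, oStar_mul, oStar_mul, hK, oStar_actK]
    simp only [mul_neg, neg_mul, smul_add, smul_mul_assoc, mul_smul_comm]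
    abel
  | hadd x y hx hy =>
    simp only [oStar_add, map_add, hx, hy, smul_add]
    abel

/-- A row of the fundamental corepresentation. -/
structure SpinPair (q : QParam) (κ : ℂ) (u v : O q) : Prop where
  comm : u * v = qc q • (v * u)
  K_u : actK q u = (qs q)⁻¹ • u
  K_v : actK q v = qs q • v
  E_u : actE q u = v
  E_v : actE q v = 0
  F_u : actF q u = 0
  F_v : actF q v = u
  unit : u * oStar q u + v * oStar q v = 1
  trace : qc q • (oStar q u * u) + (qc q)⁻¹ • (oStar q v * v) = κ • 1

theorem spinPair_cd (q : QParam) : SpinPair q (qc q)⁻¹ (oc q) (od q) where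
  comm := o_cd q
  K_u := actK_gen q .c
  K_v := actK_gen q .d
  E_u := actE_gen q .c
  E_v := actE_gen q .d
  F_u := actF_gen q .c
  F_v := actF_gen q .d
  unit := by
    rw [oStar_gen, oStar_gen, oStarGen, oStarGen, o_da, o_bc, mul_neg, mul_smul_comm]
    abel
  trace := by
    have hq := qc_ne_zero q
    rw [oStar_gen, oStar_gen, oStarGen, oStarGen, o_ad, neg_mul, smul_mul_assoc, smul_neg,
      smul_smul, smul_add, smul_smul, mul_inv_cancel₀ hq, inv_mul_cancel₀ hq]
    abel

theorem spinPair_ab (q : QParam) : SpinPair q (qc q) (oa q) (ob q) where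
  comm := o_ab q
  K_u := actK_gen q .a
  K_v := actK_gen q .b
  E_u := actE_gen q .a
  E_v := actE_gen q .b
  F_u := actF_gen q .a
  F_v := actF_gen q .b
  unit := by
    rw [oStar_gen, oStar_gen, oStarGen, oStarGen, o_ad, mul_neg, mul_smul_comm]
    abel
  trace := by
    have hq := qc_ne_zero q
    rw [oStar_gen, oStar_gen, oStarGen, oStarGen, o_da, neg_mul, smul_mul_assoc, smul_neg,
      smul_smul, smul_add, smul_smul, mul_inv_cancel₀ hq, inv_mul_cancel₀ hq, o_bc]
    abel

theorem mul_pow_of_qcomm {A : Type*} [Ring A] [Algebra ℂ A] {u v : A} {r : ℂ}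
    (h : u * v = r • (v * u)) (i : ℕ) : u * v ^ i = r ^ i • (v ^ i * u) := by
  induction i with
  | zero => simp
  | succ i ih =>
    rw [pow_succ, ← mul_assoc, ih, smul_mul_assoc, mul_assoc, h, mul_smul_comm, smul_smul,
      ← pow_succ, mul_assoc]

theorem pow_mul_of_qcomm {A : Type*} [Ring A] [Algebra ℂ A] {u v : A} {r : ℂ}
    (h : u * v = r • (v * u)) (i : ℕ) : u ^ i * v = r ^ i • (v * u ^ i) := by
  induction i with
  | zero => simp
  | succ i ih =>
    rw [pow_succ, mul_assoc, h, mul_smul_comm, ← mul_assoc, ih, smul_mul_assoc, smul_smul,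
      mul_assoc, ← pow_succ, ← pow_succ']

/-- The row of matrix elements of the spin-`n/2` corepresentation that is built from a row of the
fundamental corepresentation. -/
def spinRow (q : QParam) (u v : O q) (n i : ℕ) : O q := binomSqrt q n i • (u ^ (n - i) * v ^ i)

variable {q : QParam} {κ : ℂ} {u v : O q}

theorem oStar_spinRow (n i : ℕ) : oStar q (spinRow q u v n i) =
    binomSqrt q n i • (oStar q v ^ i * oStar q u ^ (n - i)) := by
  rw [spinRow, oStar_smul, oStar_mul, oStar_pow, oStar_pow, conj_binomSqrt]

namespace SpinPair

theorem star_comm (h : SpinPair q κ u v) :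
    oStar q v * oStar q u = qc q • (oStar q u * oStar q v) := by
  rw [← oStar_mul, h.comm, oStar_smul, oStar_mul, conj_qc]

theorem Ki_u (h : SpinPair q κ u v) : actKi q u = qs q • u := by
  have h1 := congrArg (fun x => qs q • actKi q x) h.K_u
  simp only [actKi_actK, map_smul, smul_smul, mul_inv_cancel₀ (qs_ne_zero q), one_smul] at h1
  exact h1.symm

theorem Ki_v (h : SpinPair q κ u v) : actKi q v = (qs q)⁻¹ • v := by
  have h1 := congrArg (fun x => (qs q)⁻¹ • actKi q x) h.K_v
  simp only [actKi_actK, map_smul, smul_smul, inv_mul_cancel₀ (qs_ne_zero q), one_smul] at h1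
  exact h1.symm

theorem K_row (h : SpinPair q κ u v) {n i : ℕ} (hi : i ≤ n) :
    actK q (spinRow q u v n i) = wt q n i • spinRow q u v n i := by
  have hs := qs_ne_zero q
  obtain ⟨d, rfl⟩ := Nat.exists_eq_add_of_le hi
  rw [spinRow, Nat.add_sub_cancel_left, map_smul, map_mul, map_pow, map_pow, h.K_u, h.K_v,
    smul_pow, smul_pow, smul_mul_smul_comm, smul_comm, wt]
  congr 2
  rw [show 2 * (i : ℤ) - ((i + d : ℕ) : ℤ) = (i : ℤ) - d by push_cast; ring, zpow_sub₀ hs,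
    zpow_natCast, zpow_natCast, inv_pow]
  field_simp

/-- Moving the new `v` to the right through one `u` costs `q⁻¹`, and the weights of `K^{±1}` sum to
the `q`-number via `qInt_add`. -/
theorem E_pow (h : SpinPair q κ u v) (m : ℕ) :
    actE q (u ^ (m + 1)) = ((qs q)⁻¹ ^ m * (qInt q ((m : ℤ) + 1) : ℝ)) • (u ^ m * v) := by
  have hs := qs_ne_zero q
  have hq := qc_ne_zero q
  have hvu : v * u = (qc q)⁻¹ • (u * v) := by
    rw [h.comm, smul_smul, inv_mul_cancel₀ hq, one_smul]
  induction m with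
  | zero => simp [h.E_u, qInt_one]
  | succ m ih =>
    have h1 := qInt_add q 1 (m + 1)
    rw [pow_succ u (m + 1), actE_mul, ih, h.K_u, h.E_u, map_pow, h.Ki_u, smul_pow,
      smul_mul_smul_comm, mul_assoc (u ^ m) v, hvu, mul_smul_comm, smul_smul, ← mul_assoc, ← pow_succ,
      smul_mul_assoc, ← add_smul]
    congr 1
    push_cast at h1 ⊢
    rw [show (m : ℤ) + 1 + 1 = 1 + (m + 1) by ring, h1, qInt_one]
    push_cast
    change (qs q)⁻¹ ^ m * _ * (qs q)⁻¹ * (qc q)⁻¹ + _ = (qs q)⁻¹ ^ (m + 1) *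
      ((qc q)⁻¹ ^ 1 * _ + qc q ^ (m + 1) * 1)
    have h2 : (qs q) ^ (m + 1) = (qs q)⁻¹ ^ (m + 1) * qc q ^ (m + 1) := by
      rw [← mul_pow, ← qs_mul_qs, inv_mul_cancel_left₀ hs]
    rw [h2]
    ring

theorem F_pow (h : SpinPair q κ u v) (m : ℕ) :
    actF q (v ^ (m + 1)) = ((qs q)⁻¹ ^ m * (qInt q ((m : ℤ) + 1) : ℝ)) • (u * v ^ m) := by
  have hs := qs_ne_zero q
  have hq := qc_ne_zero q
  have hvu : v * u = (qc q)⁻¹ • (u * v) := by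
    rw [h.comm, smul_smul, inv_mul_cancel₀ hq, one_smul]
  induction m with
  | zero => simp [h.F_v, qInt_one]
  | succ m ih =>
    have h1 := qInt_add q 1 (m + 1)
    rw [pow_succ' v (m + 1), actF_mul, ih, h.F_v, h.Ki_v, map_pow, h.K_v, smul_pow,
      smul_mul_smul_comm, mul_smul_comm, ← mul_assoc v u, hvu, smul_mul_assoc, smul_smul,
      mul_assoc u v, ← pow_succ', ← add_smul]
    congr 1
    push_cast at h1 ⊢
    rw [show (m : ℤ) + 1 + 1 = 1 + (m + 1) by ring, h1, qInt_one]
    push_cast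
    change _ + (qs q)⁻¹ * ((qs q)⁻¹ ^ m * _) * (qc q)⁻¹ = (qs q)⁻¹ ^ (m + 1) *
      ((qc q)⁻¹ ^ 1 * _ + qc q ^ (m + 1) * 1)
    have h2 : (qs q) ^ (m + 1) = (qs q)⁻¹ ^ (m + 1) * qc q ^ (m + 1) := by
      rw [← mul_pow, ← qs_mul_qs, inv_mul_cancel_left₀ hs]
    rw [h2]
    ring

theorem E_row (h : SpinPair q κ u v) {n i : ℕ} (hi : i ≤ n) :
    actE q (spinRow q u v n i) = alpha q n i • spinRow q u v n (i + 1) := by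
  have hs := qs_ne_zero q
  have hv : ∀ j, actE q (v ^ j) = 0 := by
    intro j
    induction j with
    | zero => simpa using actE_algebraMap q 1
    | succ j ih => rw [pow_succ, actE_mul, ih, h.E_v, zero_mul, mul_zero, add_zero]
  rcases Nat.lt_or_ge i n with h1 | h1
  · obtain ⟨d, rfl⟩ := Nat.exists_eq_add_of_lt h1
    have h2 := alpha_mul_binomSqrt_succ q i d
    rw [spinRow, spinRow, show i + d + 1 - i = d + 1 by omega,
      show i + d + 1 - (i + 1) = d by omega, map_smul, actE_mul, hv, mul_zero, add_zero, h.E_pow,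
      map_pow, h.K_v, smul_pow, smul_mul_smul_comm, smul_smul, smul_smul,
      mul_assoc (u ^ d) v, ← pow_succ']
    congr 1
    apply mul_right_cancel₀ (pow_ne_zero d hs)
    rw [h2, inv_pow]
    field_simp
  · obtain rfl : i = n := le_antisymm hi h1
    rw [alpha_top, zero_smul, spinRow, map_smul, Nat.sub_self, pow_zero, one_mul, hv, smul_zero]

theorem F_row_zero (h : SpinPair q κ u v) (n : ℕ) : actF q (spinRow q u v n 0) = 0 := by
  have hu : ∀ j, actF q (u ^ j) = 0 := by
    intro j
    induction j with
    | zero => simpa using actF_algebraMap q 1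
    | succ j ih => rw [pow_succ, actF_mul, ih, h.F_u, zero_mul, mul_zero, add_zero]
  rw [spinRow, map_smul, pow_zero, mul_one, hu, smul_zero]

theorem F_row (h : SpinPair q κ u v) {n i : ℕ} (hi : i < n) :
    actF q (spinRow q u v n (i + 1)) = alpha q n i • spinRow q u v n i := by
  have hs := qs_ne_zero q
  have hu : ∀ j, actF q (u ^ j) = 0 := by
    intro j
    induction j with
    | zero => simpa using actF_algebraMap q 1
    | succ j ih => rw [pow_succ, actF_mul, ih, h.F_u, zero_mul, mul_zero, add_zero]
  obtain ⟨d, rfl⟩ := Nat.exists_eq_add_of_lt hi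
  have h2 := alpha_mul_binomSqrt q i d
  rw [spinRow, spinRow, show i + d + 1 - i = d + 1 by omega,
    show i + d + 1 - (i + 1) = d by omega, map_smul, actF_mul, hu, zero_mul, zero_add, h.F_pow,
    map_pow, h.Ki_u, smul_pow, smul_mul_smul_comm, smul_smul, smul_smul,
    ← mul_assoc (u ^ d) u, ← pow_succ]
  congr 1
  apply mul_right_cancel₀ (pow_ne_zero i hs)
  rw [h2, inv_pow]
  field_simp

/-- Pascal's rule opens up the innermost pair of factors, where `u u* + v v* = 1` collapses the sum;
the `q`-powers from moving `u` and `u*` inward cancel the weight in Pascal's rule. -/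
theorem sum_row_mul_star (h : SpinPair q κ u v) (n : ℕ) :
    ∑ i ∈ Finset.range (n + 1), spinRow q u v n i * oStar q (spinRow q u v n i) = 1 := by
  have hq := qc_ne_zero q
  have h1 : ∀ n, ∑ i ∈ Finset.range (n + 1), (gaussBinom q n i : ℂ) •
      (u ^ (n - i) * v ^ i * (oStar q v ^ i * oStar q u ^ (n - i))) = 1 := by
    intro n
    induction n with
    | zero => simp [gaussBinom_self]
    | succ n ih =>
      rw [sum_gaussBinom_succ, ← ih]
      refine Finset.sum_congr rfl fun i hi => ?_
      have hi : i ≤ n := by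
        rw [Finset.mem_range] at hi
        omega
      congr 1
      rw [show n + 1 - i = n - i + 1 by omega, show n + 1 - (i + 1) = n - i by omega]
      have e1 : u ^ (n - i + 1) * v ^ i = qc q ^ i • (u ^ (n - i) * v ^ i * u) := by
        rw [pow_succ, mul_assoc, mul_pow_of_qcomm h.comm, mul_smul_comm, mul_assoc]
      have e2 : oStar q v ^ i * oStar q u ^ (n - i + 1) =
          qc q ^ i • (oStar q u * (oStar q v ^ i * oStar q u ^ (n - i))) := by
        rw [pow_succ', ← mul_assoc, pow_mul_of_qcomm h.star_comm, smul_mul_assoc, mul_assoc]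
      have e3 : ((qc q)⁻¹ ^ 2) ^ i * (qc q ^ i * qc q ^ i) = 1 := by
        rw [← mul_pow, ← mul_pow, sq, mul_mul_mul_comm, inv_mul_cancel₀ hq, one_mul, one_pow]
      rw [e1, e2, smul_mul_smul_comm, smul_smul, e3, one_smul, pow_succ v, pow_succ' (oStar q v)]
      calc u ^ (n - i) * v ^ i * u * (oStar q u * (oStar q v ^ i * oStar q u ^ (n - i))) +
            u ^ (n - i) * (v ^ i * v) * (oStar q v * oStar q v ^ i * oStar q u ^ (n - i))
          = u ^ (n - i) * v ^ i * (u * oStar q u + v * oStar q v) *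
              (oStar q v ^ i * oStar q u ^ (n - i)) := by noncomm_ring
        _ = _ := by rw [h.unit, mul_one]
  rw [← h1 n]
  refine Finset.sum_congr rfl fun i hi => ?_
  have hi : i ≤ n := by
    rw [Finset.mem_range] at hi
    omega
  rw [oStar_spinRow, spinRow, smul_mul_smul_comm, binomSqrt_mul_self q hi]

/-- Now the outermost factors are peeled off: the sum for `n + 1` is the sum for `n` enclosed
between `u*, u` and between `v*, v`. As the enclosed sum is a scalar, the weighted relation `trace`
of the pair applies, with one factor `κ` per step. -/
theorem sum_star_mul_row (h : SpinPair q κ u v) (n : ℕ) :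
    ∑ i ∈ Finset.range (n + 1), ((wt q n i)⁻¹ * (wt q n i)⁻¹) •
      (oStar q (spinRow q u v n i) * spinRow q u v n i) = κ ^ n • 1 := by
  have hq := qc_ne_zero q
  have hw : ∀ n i, (wt q n i)⁻¹ * (wt q n i)⁻¹ = qc q ^ ((n : ℤ) - 2 * i) := by
    intro n i
    rw [wt, ← mul_inv, ← mul_zpow, qs_mul_qs, ← zpow_neg]
    congr 1
    ring
  have h1 : ∀ n, ∑ i ∈ Finset.range (n + 1), (gaussBinom q n i : ℂ) •
      (qc q ^ ((n : ℤ) - 2 * i)) •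
        (oStar q v ^ i * oStar q u ^ (n - i) * (u ^ (n - i) * v ^ i)) = κ ^ n • 1 := by
    intro n
    induction n with
    | zero => simp [gaussBinom_self]
    | succ n ih =>
      rw [sum_gaussBinom_succ]
      have e0 : ∀ i ∈ Finset.range (n + 1), (gaussBinom q n i : ℂ) •
          ((((qc q)⁻¹ ^ 2) ^ i) • (qc q ^ (((n + 1 : ℕ) : ℤ) - 2 * i)) •
            (oStar q v ^ i * oStar q u ^ (n + 1 - i) * (u ^ (n + 1 - i) * v ^ i)) +
          (qc q ^ (((n + 1 : ℕ) : ℤ) - 2 * ((i + 1 : ℕ) : ℤ))) •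
            (oStar q v ^ (i + 1) * oStar q u ^ (n + 1 - (i + 1)) *
              (u ^ (n + 1 - (i + 1)) * v ^ (i + 1)))) =
          qc q • (oStar q u * ((gaussBinom q n i : ℂ) • (qc q ^ ((n : ℤ) - 2 * i)) •
            (oStar q v ^ i * oStar q u ^ (n - i) * (u ^ (n - i) * v ^ i))) * u) +
          (qc q)⁻¹ • (oStar q v * ((gaussBinom q n i : ℂ) • (qc q ^ ((n : ℤ) - 2 * i)) •
            (oStar q v ^ i * oStar q u ^ (n - i) * (u ^ (n - i) * v ^ i))) * v) := by
        intro i hi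
        have hi : i ≤ n := by
          rw [Finset.mem_range] at hi
          omega
        rw [show n + 1 - i = n - i + 1 by omega, show n + 1 - (i + 1) = n - i by omega]
        have e1 : u ^ (n - i + 1) * v ^ i = qc q ^ i • (u ^ (n - i) * v ^ i * u) := by
          rw [pow_succ, mul_assoc, mul_pow_of_qcomm h.comm, mul_smul_comm, mul_assoc]
        have e2 : oStar q v ^ i * oStar q u ^ (n - i + 1) =
            qc q ^ i • (oStar q u * (oStar q v ^ i * oStar q u ^ (n - i))) := by
          rw [pow_succ', ← mul_assoc, pow_mul_of_qcomm h.star_comm, smul_mul_assoc, mul_assoc]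
        have e3 : ((qc q)⁻¹ ^ 2) ^ i * (qc q ^ i * qc q ^ i) = 1 := by
          rw [← mul_pow, ← mul_pow, sq, mul_mul_mul_comm, inv_mul_cancel₀ hq, one_mul, one_pow]
        have e4 : qc q ^ (((n + 1 : ℕ) : ℤ) - 2 * i) = qc q * qc q ^ ((n : ℤ) - 2 * i) := by
          rw [← zpow_one_add₀ hq]
          congr 1
          push_cast
          ring
        have e5 : qc q ^ (((n + 1 : ℕ) : ℤ) - 2 * ((i + 1 : ℕ) : ℤ)) =
            (qc q)⁻¹ * qc q ^ ((n : ℤ) - 2 * i) := by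
          rw [← zpow_neg_one, ← zpow_add₀ hq]
          congr 1
          push_cast
          ring
        rw [e1, e2, e4, e5, pow_succ v, pow_succ' (oStar q v), smul_mul_smul_comm, smul_smul,
          smul_smul, mul_right_comm, e3]
        simp only [mul_smul_comm, smul_mul_assoc, smul_smul, smul_add, mul_assoc, one_mul]
        congr 2 <;> ring
      rw [Finset.sum_congr rfl e0, Finset.sum_add_distrib, ← Finset.smul_sum, ← Finset.smul_sum,
        ← Finset.sum_mul, ← Finset.sum_mul, ← Finset.mul_sum, ← Finset.mul_sum, ih]
      simp only [mul_smul_comm, smul_mul_assoc, mul_one]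
      rw [smul_comm _ (κ ^ n), smul_comm _ (κ ^ n), ← smul_add, h.trace, smul_smul, pow_succ]
  rw [← h1 n]
  refine Finset.sum_congr rfl fun i hi => ?_
  have hi : i ≤ n := by
    rw [Finset.mem_range] at hi
    omega
  rw [oStar_spinRow, spinRow, smul_mul_smul_comm, binomSqrt_mul_self q hi, hw, smul_comm]

end SpinPair


/-! ### Spin rows: covariance, orthogonality and the value at the counit. -/

/-- The properties of a row of the spin-`n/2` corepresentation; `m` is the index of the entry at
which the counit does not vanish. -/
structure IsSpinRow (q : QParam) (κ : ℂ) {n : ℕ} (m : Fin (n + 1)) (t : Fin (n + 1) → O q) :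
    Prop where
  K : ∀ i, actK q (t i) = wt q n i • t i
  E : ∀ j, actE q (t j) = ∑ k, spinGen q n .E k j • t k
  F : ∀ j, actF q (t j) = ∑ k, spinGen q n .F k j • t k
  unit : ∑ i, t i * oStar q (t i) = 1
  trace : ∑ i : Fin (n + 1), ((wt q n i)⁻¹ * (wt q n i)⁻¹) • (oStar q (t i) * t i) = κ • 1
  counit : ∀ i, oCounit q (t i) = if i = m then 1 else 0

theorem SpinPair.isSpinRow {q : QParam} {κ : ℂ} {u v : O q} (h : SpinPair q κ u v) {n : ℕ}
    (m : Fin (n + 1))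
    (hm : ∀ i ≤ n, oCounit q (spinRow q u v n i) = if i = (m : ℕ) then 1 else 0) :
    IsSpinRow q (κ ^ n) m (fun i : Fin (n + 1) => spinRow q u v n i) where
  K i := h.K_row (by omega)
  E j := by
    have hj : (j : ℕ) ≤ n := by omega
    rw [h.E_row hj]
    rcases Nat.lt_or_ge (j : ℕ) n with h1 | h1
    · rw [Finset.sum_eq_single (⟨(j : ℕ) + 1, by omega⟩ : Fin (n + 1))]
      · simp [spinGen]
      · intro k _ hk
        rw [spinGen, Matrix.of_apply, if_neg (fun h2 => hk (Fin.ext h2)), zero_smul]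
      · simp
    · rw [le_antisymm hj h1, alpha_top, zero_smul, Finset.sum_eq_zero]
      intro k _
      rw [spinGen, Matrix.of_apply, if_neg (by omega), zero_smul]
  F j := by
    rcases Nat.eq_zero_or_pos (j : ℕ) with h1 | h1
    · rw [h1, h.F_row_zero, Finset.sum_eq_zero]
      intro k _
      rw [spinGen, Matrix.of_apply, if_neg (by omega), zero_smul]
    · obtain ⟨i, hi⟩ : ∃ i, (j : ℕ) = i + 1 := ⟨j - 1, by omega⟩
      rw [hi, h.F_row (by omega), Finset.sum_eq_single (⟨i, by omega⟩ : Fin (n + 1))]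
      · simp [spinGen, hi]
      · intro k _ hk
        rw [spinGen, Matrix.of_apply, if_neg, zero_smul]
        intro h2
        apply hk
        apply Fin.ext
        simp only
        omega
      · simp
  unit := by
    rw [← h.sum_row_mul_star n, Finset.sum_range]
  trace := by
    rw [← h.sum_star_mul_row n, Finset.sum_range]
  counit i := by
    rw [hm i (by omega)]
    simp only [Fin.ext_iff]

/-- The index of the entry of a row at which the counit does not vanish. -/
def rowIdx (N : ℤ) : Fin (N.natAbs + 1) := if 0 ≤ N then Fin.last _ else 0

/-- The sign of `N` decides where the row survives the counit: among `c^(n-i) d^i` only `d^n` does,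
at the highest weight, and among `a^(n-i) b^i` only `a^n`, at the lowest. -/
theorem isSpinRow_tRow (q : QParam) (N : ℤ) :
    ∃ κ : ℂ, IsSpinRow q κ (rowIdx N) (tRow q N) := by
  by_cases hN : 0 ≤ N
  · have h := (spinPair_cd q).isSpinRow (n := N.natAbs) (rowIdx N) (by
      intro i hi
      rw [rowIdx, if_pos hN, Fin.val_last, spinRow, map_smul, map_mul, map_pow, map_pow,
        oCounit_c, oCounit_d, one_pow, mul_one]
      split_ifs with h
      · rw [h, Nat.sub_self, pow_zero, binomSqrt_self]
        simp
      · rw [zero_pow (by omega), smul_zero])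
    have e : tRow q N = fun i : Fin (N.natAbs + 1) => spinRow q (oc q) (od q) N.natAbs i := by
      funext i
      rw [tRow, if_pos hN, spinRow]
    rw [e]
    exact ⟨_, h⟩
  · have h := (spinPair_ab q).isSpinRow (n := N.natAbs) (rowIdx N) (by
      intro i hi
      rw [rowIdx, if_neg hN, Fin.val_zero, spinRow, map_smul, map_mul, map_pow, map_pow,
        oCounit_a, oCounit_b, one_pow, one_mul]
      split_ifs with h
      · rw [h, pow_zero, binomSqrt_zero_right]
        simp
      · rw [zero_pow (by omega), smul_zero])
    have e : tRow q N = fun i : Fin (N.natAbs + 1) => spinRow q (oa q) (ob q) N.natAbs i := by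
      funext i
      rw [tRow, if_neg hN, spinRow]
    rw [e]
    exact ⟨_, h⟩

/-! ### The representations `ρ°` -/

theorem spin_gen (q : QParam) (n : ℕ) (x : UGen) : spin q n (uGen q x) = spinGen q n x := by
  rw [spin, uLift_gen]

theorem uAntipode_gen (q : QParam) (x : UGen) : unop (uAntipode q (uGen q x)) = match x with
      | .E => -(qc q • uE q)
      | .F => -((qc q)⁻¹ • uF q)
      | .K => uKi q
      | .Ki => uK q := by
  rw [uAntipode, uLift_gen]
  cases x <;> rfl

theorem sInv_gen (q : QParam) (x : UGen) : sInv q (uGen q x) = match x with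
      | .E => -((qc q)⁻¹ • uE q)
      | .F => -(qc q • uF q)
      | .K => uKi q
      | .Ki => uK q := by
  change unop (uAntipodeInv q (uGen q x)) = _
  rw [uAntipodeInv, uLift_gen]
  cases x <;> rfl

theorem sInv_mul (q : QParam) (f g : U q) : sInv q (f * g) = sInv q g * sInv q f := by
  change unop (uAntipodeInv q (f * g)) = unop (uAntipodeInv q g) * unop (uAntipodeInv q f)
  rw [map_mul, MulOpposite.unop_mul]

theorem sInv_one (q : QParam) : sInv q 1 = 1 := by
  change unop (uAntipodeInv q 1) = 1
  rw [map_one, MulOpposite.unop_one]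

/-- Conjugation by `K` removes the factor `q` in `S(E) = -q E`, and for `F` the factor `q⁻¹`. Thus
`ρ°(E)` and `ρ°(F)` become adjoint to each other. -/
theorem rhoSpin_E (q : QParam) (n : ℕ) : rhoSpin q n (op (uE q)) = -spinGen q n .E := by
  have h : uKi q * (uE q * uK q) = (qc q)⁻¹ • uE q := by
    have h1 : uE q * uK q = (qc q)⁻¹ • (uK q * uE q) := by
      rw [uKE, smul_smul, inv_mul_cancel₀ (qc_ne_zero q), one_smul]
    rw [h1, mul_smul_comm, ← mul_assoc, uKi_K, one_mul]
  rw [rhoSpin_apply, uAntipode_gen, mul_neg, neg_mul, map_neg, mul_smul_comm, smul_mul_assoc,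
    mul_assoc, h, smul_smul, mul_inv_cancel₀ (qc_ne_zero q), one_smul, spin_gen]

theorem rhoSpin_F (q : QParam) (n : ℕ) : rhoSpin q n (op (uF q)) = -spinGen q n .F := by
  have h : uKi q * (uF q * uK q) = qc q • uF q := by
    rw [uFK, mul_smul_comm, ← mul_assoc, uKi_K, one_mul]
  rw [rhoSpin_apply, uAntipode_gen, mul_neg, neg_mul, map_neg, mul_smul_comm, smul_mul_assoc,
    mul_assoc, h, smul_smul, inv_mul_cancel₀ (qc_ne_zero q), one_smul, spin_gen]

theorem rhoSpin_K (q : QParam) (n : ℕ) :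
    rhoSpin q n (op (uK q)) = Matrix.diagonal fun i : Fin (n + 1) => (wt q n i)⁻¹ := by
  rw [rhoSpin_apply, uAntipode_gen, mul_assoc, uKi_K, mul_one, spin_gen, spinGen]

theorem rhoSpin_Ki (q : QParam) (n : ℕ) :
    rhoSpin q n (op (uKi q)) = Matrix.diagonal fun i : Fin (n + 1) => wt q n i := by
  rw [rhoSpin_apply, uAntipode_gen, uKi_K, one_mul, spin_gen, spinGen]

theorem rhoSpin_K2 (q : QParam) (n : ℕ) : rhoSpin q n (op (uK q * uK q)) =
    Matrix.diagonal fun i : Fin (n + 1) => (wt q n i)⁻¹ * (wt q n i)⁻¹ := by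
  rw [MulOpposite.op_mul, map_mul, rhoSpin_K, Matrix.diagonal_mul_diagonal]

theorem u_induction (q : QParam) {C : U q → Prop} (halg : ∀ r : ℂ, C (algebraMap ℂ (U q) r))
    (hgen : ∀ x : UGen, C (uGen q x)) (hmul : ∀ x y, C x → C y → C (x * y))
    (hadd : ∀ x y, C x → C y → C (x + y)) (x : U q) : C x := by
  obtain ⟨x, rfl⟩ := RingQuot.mkAlgHom_surjective ℂ (URel q) x
  induction x using FreeAlgebra.induction with
  | grade0 r =>
    rw [AlgHom.commutes]
    exact halg r
  | grade1 x => exact hgen x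
  | mul x y hx hy =>
    rw [map_mul]
    exact hmul _ _ hx hy
  | add x y hx hy =>
    rw [map_add]
    exact hadd _ _ hx hy

theorem uStarHom_mk (q : QParam) (x : FreeAlgebra ℂ UGen) :
    uStarHom q (uMk q x) = conjLift (fun
      | .E => uF q
      | .F => uE q
      | .K => uK q
      | .Ki => uKi q) x :=
  ringQuot_lift_mkAlgHom _ _ x

theorem uStar_gen (q : QParam) (x : UGen) : uStar q (uGen q x) = match x with
      | .E => uF q
      | .F => uE q
      | .K => uK q
      | .Ki => uKi q := by
  rw [uStar, uGen, uStarHom_mk, conjLift_ι, MulOpposite.unop_op]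

theorem uStar_mul (q : QParam) (x y : U q) : uStar q (x * y) = uStar q y * uStar q x := by
  simp [uStar]

theorem uStar_add (q : QParam) (x y : U q) : uStar q (x + y) = uStar q x + uStar q y := by
  simp [uStar]

theorem uStar_algebraMap (q : QParam) (r : ℂ) :
    uStar q (algebraMap ℂ (U q) r) = algebraMap ℂ (U q) (starRingEnd ℂ r) := by
  have h : algebraMap ℂ (U q) r = uMk q (algebraMap ℂ _ r) := ((uMk q).commutes r).symm
  rw [h, uStar, uStarHom_mk, conjLift_algebraMap, MulOpposite.unop_op]

theorem conj_alpha (q : QParam) (n i : ℕ) : (starRingEnd ℂ) (alpha q n i) = alpha q n i :=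
  Complex.conj_ofReal _

theorem conj_wt (q : QParam) (n i : ℕ) : (starRingEnd ℂ) (wt q n i) = wt q n i := by
  rw [wt, map_zpow₀, conj_qs]

theorem spinGen_E_conjTranspose (q : QParam) (n : ℕ) :
    (spinGen q n .E).conjTranspose = spinGen q n .F := by
  ext i j
  rw [Matrix.conjTranspose_apply, spinGen, spinGen, Matrix.of_apply, Matrix.of_apply]
  split_ifs
  · exact conj_alpha q n i
  · exact star_zero _

theorem spinGen_F_conjTranspose (q : QParam) (n : ℕ) :
    (spinGen q n .F).conjTranspose = spinGen q n .E := by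
  rw [← spinGen_E_conjTranspose, Matrix.conjTranspose_conjTranspose]

theorem rhoSpin_uStar (q : QParam) (n : ℕ) (f : U q) :
    rhoSpin q n (op (uStar q f)) = (rhoSpin q n (op f)).conjTranspose := by
  induction f using u_induction with
  | halg r =>
    rw [uStar_algebraMap]
    change rhoSpin q n (algebraMap ℂ (U q)ᵐᵒᵖ _) =
      (rhoSpin q n (algebraMap ℂ (U q)ᵐᵒᵖ _)).conjTranspose
    rw [AlgHom.commutes, AlgHom.commutes, Matrix.algebraMap_eq_diagonal,
      Matrix.algebraMap_eq_diagonal, Matrix.diagonal_conjTranspose]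
    rfl
  | hgen x =>
    rw [uStar_gen]
    cases x
    · rw [rhoSpin_F, rhoSpin_E, Matrix.conjTranspose_neg, spinGen_E_conjTranspose]
    · rw [rhoSpin_F, rhoSpin_E, Matrix.conjTranspose_neg, spinGen_F_conjTranspose]
    · rw [rhoSpin_K, Matrix.diagonal_conjTranspose]
      congr 1
      funext i
      simp [conj_wt]
    · rw [rhoSpin_Ki, Matrix.diagonal_conjTranspose]
      congr 1
      funext i
      simp [conj_wt]
  | hmul x y hx hy =>
    rw [uStar_mul, MulOpposite.op_mul, map_mul, hx, hy, MulOpposite.op_mul, map_mul,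
      Matrix.conjTranspose_mul]
  | hadd x y hx hy =>
    rw [uStar_add, MulOpposite.op_add, map_add, hx, hy, MulOpposite.op_add, map_add,
      Matrix.conjTranspose_add]

/-! ### The right adjoint action on matrices over `O(SU_q(2))` -/

section AdjointAction

variable {q : QParam} {n : ℕ} (rho : (U q)ᵐᵒᵖ →ₐ[ℂ] Matrix (Fin n) (Fin n) ℂ)

/-- The entrywise action `f ↦ f ▷ X` on matrices over `O(SU_q(2))`. -/
def actMatO (X : Matrix (Fin n) (Fin n) (O q)) : U q →ₗ[ℂ] Matrix (Fin n) (Fin n) (O q) where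
  toFun f := X.map (act q f)
  map_add' f g := by
    ext i j
    simp
  map_smul' r f := by
    ext i j
    simp

/-- The map `f ⊗ g ⊗ h ↦ ρ°(S⁻¹(f)) (S⁻²(g) ▷ X) ρ°(h)`. -/
def adO (X : Matrix (Fin n) (Fin n) (O q)) :
    U q ⊗[ℂ] (U q ⊗[ℂ] U q) →ₗ[ℂ] Matrix (Fin n) (Fin n) (O q) :=
  LinearMap.mul' ℂ _ ∘ₗ
    TensorProduct.map (rhoMat rho ∘ₗ sInv q)
      (LinearMap.mul' ℂ _ ∘ₗ
        TensorProduct.map (actMatO X ∘ₗ sInv q ∘ₗ sInv q) (rhoMat rho))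

theorem adO_tmul (X : Matrix (Fin n) (Fin n) (O q)) (f g h : U q) :
    adO rho X (f ⊗ₜ (g ⊗ₜ h)) = scalarMat (O q) (rho (op (sInv q f))) *
      (X.map (act q (sInv q (sInv q g))) * scalarMat (O q) (rho (op h))) := rfl

theorem adR_eq (P : Matrix (Fin n) (Fin n) (S2 q)) (f : U q) :
    adR rho P f = adO rho (P.map fun x => (x : O q)) (uComul2 q f) := rfl

theorem scalarMat_mul_map (A : Matrix (Fin n) (Fin n) ℂ) (X : Matrix (Fin n) (Fin n) (O q))
    (L : O q →ₗ[ℂ] O q) : (scalarMat (O q) A * X).map L = scalarMat (O q) A * X.map L := by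
  ext i j
  simp only [Matrix.map_apply, Matrix.mul_apply, scalarMat_apply, map_sum, ← Algebra.smul_def,
    map_smul]

theorem mul_scalarMat_map (A : Matrix (Fin n) (Fin n) ℂ) (X : Matrix (Fin n) (Fin n) (O q))
    (L : O q →ₗ[ℂ] O q) : (X * scalarMat (O q) A).map L = X.map L * scalarMat (O q) A := by
  ext i j
  simp only [Matrix.map_apply, Matrix.mul_apply, scalarMat_apply, map_sum, ← Algebra.commutes,
    ← Algebra.smul_def, map_smul]

theorem tensor3_induction {C : U q ⊗[ℂ] (U q ⊗[ℂ] U q) → Prop}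
    (h0 : C 0) (hadd : ∀ x y, C x → C y → C (x + y)) (ht : ∀ f g h : U q, C (f ⊗ₜ (g ⊗ₜ h)))
    (x : U q ⊗[ℂ] (U q ⊗[ℂ] U q)) : C x := by
  induction x using TensorProduct.induction_on with
  | zero => exact h0
  | add x y hx hy => exact hadd x y hx hy
  | tmul f y =>
    induction y using TensorProduct.induction_on with
    | zero =>
      rw [TensorProduct.tmul_zero]
      exact h0
    | add x y hx hy =>
      rw [TensorProduct.tmul_add]
      exact hadd _ _ hx hy
    | tmul g h => exact ht f g h

theorem adO_smul (r : ℂ) (X : Matrix (Fin n) (Fin n) (O q)) (t : U q ⊗[ℂ] (U q ⊗[ℂ] U q)) :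
    adO rho (r • X) t = r • adO rho X t := by
  induction t using tensor3_induction with
  | h0 => simp
  | hadd x y hx hy => rw [map_add, map_add, hx, hy, smul_add]
  | ht f g h =>
    rw [adO_tmul, adO_tmul, Matrix.map_smul _ _ (fun a => map_smul _ _ _), smul_mul_assoc, mul_smul_comm]

theorem adO_add (X Y : Matrix (Fin n) (Fin n) (O q)) (t : U q ⊗[ℂ] (U q ⊗[ℂ] U q)) :
    adO rho (X + Y) t = adO rho X t + adO rho Y t := by
  induction t using tensor3_induction with
  | h0 => simp
  | hadd x y hx hy =>
    rw [map_add, map_add, map_add, hx, hy]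
    abel
  | ht f g h =>
    rw [adO_tmul, adO_tmul, adO_tmul, Matrix.map_add _ (fun a b => map_add _ _ _), add_mul, mul_add]

theorem adO_zero (t : U q ⊗[ℂ] (U q ⊗[ℂ] U q)) : adO rho 0 t = 0 := by
  have h := adO_smul rho 0 0 t
  rwa [zero_smul, zero_smul] at h

/-- `ρ° ∘ S⁻¹` and `S⁻²` preserve the order of products and `ρ°` reverses it, so multiplying the
triple tensors amounts to nesting the operators. -/
theorem adO_mul (X : Matrix (Fin n) (Fin n) (O q)) (s t : U q ⊗[ℂ] (U q ⊗[ℂ] U q)) :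
    adO rho X (s * t) = adO rho (adO rho X t) s := by
  induction s using tensor3_induction with
  | h0 => simp
  | hadd x y hx hy => rw [add_mul, map_add, map_add, hx, hy]
  | ht f g h =>
    induction t using tensor3_induction with
    | h0 => rw [mul_zero, map_zero, adO_zero]
    | hadd x y hx hy => rw [mul_add, map_add, map_add, hx, hy, adO_add]
    | ht f' g' h' =>
      rw [Algebra.TensorProduct.tmul_mul_tmul, Algebra.TensorProduct.tmul_mul_tmul, adO_tmul,
        adO_tmul, adO_tmul, scalarMat_mul_map, mul_scalarMat_map]
      simp only [sInv_mul, MulOpposite.op_mul, map_mul, scalarMat_mul, Matrix.mul_assoc]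
      rfl

theorem uComul2_mul (f g : U q) : uComul2 q (f * g) = uComul2 q f * uComul2 q g := by
  change Algebra.TensorProduct.map (AlgHom.id ℂ (U q)) (uComul q) (uComul q (f * g)) =
    Algebra.TensorProduct.map (AlgHom.id ℂ (U q)) (uComul q) (uComul q f) *
      Algebra.TensorProduct.map (AlgHom.id ℂ (U q)) (uComul q) (uComul q g)
  rw [map_mul, map_mul]

theorem uComul2_algebraMap (r : ℂ) :
    uComul2 q (algebraMap ℂ (U q) r) = r • (1 ⊗ₜ (1 ⊗ₜ 1)) := by
  change Algebra.TensorProduct.map (AlgHom.id ℂ (U q)) (uComul q)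
    (uComul q (algebraMap ℂ (U q) r)) = _
  rw [AlgHom.commutes, AlgHom.commutes, Algebra.algebraMap_eq_smul_one]
  rfl

theorem uComul_gen (x : UGen) : uComul q (uGen q x) = match x with
      | .E => uE q ⊗ₜ uK q + uKi q ⊗ₜ uE q
      | .F => uF q ⊗ₜ uK q + uKi q ⊗ₜ uF q
      | .K => uK q ⊗ₜ uK q
      | .Ki => uKi q ⊗ₜ uKi q := by
  cases x <;> rw [uComul, uLift_gen]

theorem uComul2_gen (x : UGen) : uComul2 q (uGen q x) = match x with
      | .E => uE q ⊗ₜ (uK q ⊗ₜ uK q) + (uKi q ⊗ₜ (uE q ⊗ₜ uK q) + uKi q ⊗ₜ (uKi q ⊗ₜ uE q))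
      | .F => uF q ⊗ₜ (uK q ⊗ₜ uK q) + (uKi q ⊗ₜ (uF q ⊗ₜ uK q) + uKi q ⊗ₜ (uKi q ⊗ₜ uF q))
      | .K => uK q ⊗ₜ (uK q ⊗ₜ uK q)
      | .Ki => uKi q ⊗ₜ (uKi q ⊗ₜ uKi q) := by
  rw [uComul2, LinearMap.comp_apply, AlgHom.toLinearMap_apply, uComul_gen]
  cases x <;>
    simp only [map_add, LinearMap.lTensor_tmul, AlgHom.toLinearMap_apply, uComul_gen,
      TensorProduct.tmul_add]

theorem uCounit_gen (x : UGen) : uCounit q (uGen q x) = match x with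
      | .E => 0
      | .F => 0
      | .K => 1
      | .Ki => 1 := by
  cases x <;> rw [uCounit, uLift_gen]

/-- The iterated coproduct and the counit are multiplicative and `adO` is an action, so invariance
under products follows from invariance under the factors. -/
theorem adO_invariant_of_gen {X : Matrix (Fin n) (Fin n) (O q)}
    (h : ∀ x : UGen, adO rho X (uComul2 q (uGen q x)) = uCounit q (uGen q x) • X) (f : U q) :
    adO rho X (uComul2 q f) = uCounit q f • X := by
  induction f using u_induction with
  | halg r =>
    rw [uComul2_algebraMap, map_smul, adO_tmul, sInv_one, sInv_one, AlgHom.commutes]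
    have h1 : scalarMat (O q) (rho (op 1)) = 1 := by
      rw [MulOpposite.op_one, map_one]
      exact Matrix.map_one _ (map_zero _) (map_one _)
    have h2 : X.map (act q 1) = X := by
      rw [map_one]
      ext i j
      simp
    rw [h1, h2, one_mul, mul_one]
    rfl
  | hgen x => exact h x
  | hmul f g hf hg => rw [uComul2_mul, adO_mul, hg, adO_smul, hf, smul_smul, map_mul, mul_comm]
  | hadd f g hf hg => rw [map_add, map_add, hf, hg, map_add, add_smul]

end AdjointAction


/-! ### The projections of the line bundles -/

theorem actK_oStar (q : QParam) (x : O q) : actK q (oStar q x) = oStar q (actKi q x) := by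
  rw [← actK_actKi q (oStar q (actKi q x)), ← oStar_actK, actK_actKi]

theorem actKi_oStar (q : QParam) (x : O q) : actKi q (oStar q x) = oStar q (actK q x) :=
  (oStar_actK q x).symm

theorem spinGen_E_mul_wt (q : QParam) (n : ℕ) (i k : Fin (n + 1)) :
    spinGen q n .E i k * wt q n i = qc q * (spinGen q n .E i k * wt q n k) := by
  rw [spinGen, Matrix.of_apply]
  split_ifs with h
  · rw [h, wt_succ]
    ring
  · ring

theorem spinGen_F_mul_wt (q : QParam) (n : ℕ) (i k : Fin (n + 1)) :
    spinGen q n .F i k * wt q n k = qc q * (spinGen q n .F i k * wt q n i) := by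
  rw [spinGen, Matrix.of_apply]
  split_ifs with h
  · rw [h, wt_succ]
    ring
  · ring

theorem conj_spinGen_E (q : QParam) (n : ℕ) (i j : Fin (n + 1)) :
    (starRingEnd ℂ) (spinGen q n .E i j) = spinGen q n .F j i := by
  rw [← spinGen_E_conjTranspose]
  rfl

theorem conj_spinGen_F (q : QParam) (n : ℕ) (i j : Fin (n + 1)) :
    (starRingEnd ℂ) (spinGen q n .F i j) = spinGen q n .E j i := by
  rw [← spinGen_F_conjTranspose]
  rfl

theorem oStar_sum (q : QParam) {ι : Type*} (s : Finset ι) (f : ι → O q) :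
    oStar q (∑ i ∈ s, f i) = ∑ i ∈ s, oStar q (f i) :=
  map_sum (AddMonoidHom.mk' (oStar q) (oStar_add q)) f s

namespace IsSpinRow

variable {q : QParam} {κ : ℂ} {n : ℕ} {m : Fin (n + 1)} {t : Fin (n + 1) → O q}

/-- The column `K ▷ t*` up to the matrix of `K`. -/
def col (t : Fin (n + 1) → O q) (i : Fin (n + 1)) : O q := wt q n i • oStar q (t i)

/-- The row `K⁻¹ ▷ t`. -/
def row (t : Fin (n + 1) → O q) (i : Fin (n + 1)) : O q := (wt q n i)⁻¹ • t i

theorem Ki (h : IsSpinRow q κ m t) (i : Fin (n + 1)) :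
    actKi q (t i) = (wt q n i)⁻¹ • t i := by
  have h1 := congrArg (fun x => (wt q n i)⁻¹ • actKi q x) (h.K i)
  simp only [actKi_actK, map_smul, smul_smul, inv_mul_cancel₀ (wt_ne_zero q n i), one_smul] at h1
  exact h1.symm

theorem K_row (h : IsSpinRow q κ m t) (i : Fin (n + 1)) :
    actK q (row t i) = wt q n i • row t i := by
  rw [row, map_smul, h.K, smul_comm]

theorem Ki_row (h : IsSpinRow q κ m t) (i : Fin (n + 1)) :
    actKi q (row t i) = (wt q n i)⁻¹ • row t i := by
  rw [row, map_smul, h.Ki]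

theorem K_col (h : IsSpinRow q κ m t) (i : Fin (n + 1)) :
    actK q (col t i) = (wt q n i)⁻¹ • col t i := by
  rw [col, map_smul, actK_oStar, h.Ki, oStar_smul, map_inv₀, conj_wt, smul_comm]

theorem Ki_col (h : IsSpinRow q κ m t) (i : Fin (n + 1)) :
    actKi q (col t i) = wt q n i • col t i := by
  rw [col, map_smul, actKi_oStar, h.K, oStar_smul, conj_wt]

theorem E_row (h : IsSpinRow q κ m t) (j : Fin (n + 1)) :
    actE q (row t j) = ∑ k, (qc q * spinGen q n .E k j) • row t k := by
  rw [row, map_smul, h.E, Finset.smul_sum]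
  refine Finset.sum_congr rfl fun k _ => ?_
  rw [row, smul_smul, smul_smul]
  congr 1
  have h1 := spinGen_E_mul_wt q n k j
  have h2 := wt_ne_zero q n k
  have h3 := wt_ne_zero q n j
  field_simp
  linear_combination h1

theorem F_row (h : IsSpinRow q κ m t) (j : Fin (n + 1)) :
    actF q (row t j) = ∑ k, ((qc q)⁻¹ * spinGen q n .F k j) • row t k := by
  rw [row, map_smul, h.F, Finset.smul_sum]
  refine Finset.sum_congr rfl fun k _ => ?_
  rw [row, smul_smul, smul_smul]
  congr 1
  have h1 := spinGen_F_mul_wt q n k j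
  have h2 := wt_ne_zero q n k
  have h3 := wt_ne_zero q n j
  have h4 := qc_ne_zero q
  field_simp
  linear_combination -h1

theorem E_col (h : IsSpinRow q κ m t) (i : Fin (n + 1)) :
    actE q (col t i) = ∑ k, (-(qc q ^ 2 * spinGen q n .E i k)) • col t k := by
  rw [col, map_smul, actE_oStar, h.F, oStar_sum, Finset.smul_sum, ← Finset.sum_neg_distrib,
    Finset.smul_sum]
  refine Finset.sum_congr rfl fun k _ => ?_
  rw [col, oStar_smul, conj_spinGen_F, smul_neg, smul_smul, smul_smul, smul_smul, ← neg_smul]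
  congr 1
  linear_combination -qc q * spinGen_E_mul_wt q n i k

theorem F_col (h : IsSpinRow q κ m t) (i : Fin (n + 1)) :
    actF q (col t i) = ∑ k, (-((qc q)⁻¹ ^ 2 * spinGen q n .F i k)) • col t k := by
  rw [col, map_smul, actF_oStar, h.E, oStar_sum, Finset.smul_sum, ← Finset.sum_neg_distrib,
    Finset.smul_sum]
  refine Finset.sum_congr rfl fun k _ => ?_
  rw [col, oStar_smul, conj_spinGen_E, smul_neg, smul_smul, smul_smul, smul_smul, ← neg_smul]
  congr 1
  have h1 := spinGen_F_mul_wt q n i k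
  have h4 := qc_ne_zero q
  field_simp
  linear_combination h1

theorem sum_row_mul_col (h : IsSpinRow q κ m t) : ∑ k, row t k * col t k = 1 := by
  rw [← h.unit]
  refine Finset.sum_congr rfl fun k _ => ?_
  rw [row, col, smul_mul_smul_comm, inv_mul_cancel₀ (wt_ne_zero q n k), one_smul]

end IsSpinRow

theorem oStar_oStar (q : QParam) (x : O q) : oStar q (oStar q x) = x := by
  have hq := qc_ne_zero q
  induction x using o_induction with
  | halg r => simp [oStar_algebraMap]
  | hgen x =>
    cases x <;> simp [oStar_gen, oStarGen, oStar_smul, oStar_neg, smul_smul, hq, conj_qc]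
  | hmul x y hx hy => rw [oStar_mul, oStar_mul, hx, hy]
  | hadd x y hx hy => rw [oStar_add, oStar_add, hx, hy]

theorem oCounit_oStar (q : QParam) (x : O q) :
    oCounit q (oStar q x) = starRingEnd ℂ (oCounit q x) := by
  induction x using o_induction with
  | halg r => simp [oStar_algebraMap]
  | hgen x => cases x <;> simp [oStar_gen, oStarGen, oCounit_gen]
  | hmul x y hx hy => rw [oStar_mul, map_mul, map_mul, map_mul, hx, hy, mul_comm]
  | hadd x y hx hy => rw [oStar_add, map_add, map_add, map_add, hx, hy]

open IsSpinRow in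
-- Over `O(SU_q(2))` the projection has rank one: it is a column times a row, although neither need
-- have entries in the sphere. The weights of `ρ°(K^{±1})` are absorbed into the two factors.
theorem coe_lineBundle (q : QParam) (N : ℤ) (i j : Fin (N.natAbs + 1)) :
    ((lineBundle q N i j : S2 q) : O q) = col (tRow q N) i * row (tRow q N) j := by
  have h1 : lineBundle q N i j = (wt q N.natAbs i * (wt q N.natAbs j)⁻¹) • tStarT q N i j := by
    rw [lineBundle, rhoSpin_K, rhoSpin_Ki, scalarMat, scalarMat,
      Matrix.diagonal_map (map_zero _), Matrix.diagonal_map (map_zero _), Matrix.mul_diagonal,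
      Matrix.diagonal_mul, ← Algebra.commutes,
      ← Algebra.smul_def, ← Algebra.smul_def, smul_smul, mul_comm]
  rw [h1, col, row, smul_mul_smul_comm]
  rfl

section Action

variable {q : QParam} {n : ℕ}

theorem scalarMat_diagonal (w : Fin n → ℂ) :
    scalarMat (O q) (Matrix.diagonal w) = Matrix.diagonal fun i => algebraMap ℂ (O q) (w i) := by
  rw [scalarMat, Matrix.diagonal_map (map_zero _)]

theorem scalarMat_neg (A : Matrix (Fin n) (Fin n) ℂ) :
    scalarMat (O q) (-A) = -scalarMat (O q) A := by
  ext i j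
  simp [scalarMat_apply]

theorem scalarMat_smul (r : ℂ) (A : Matrix (Fin n) (Fin n) ℂ) :
    scalarMat (O q) (r • A) = r • scalarMat (O q) A := by
  ext i j
  change algebraMap ℂ (O q) (r * A i j) = r • algebraMap ℂ (O q) (A i j)
  rw [map_mul, ← Algebra.smul_def]

theorem sInv_sInv_gen (x : UGen) : sInv q (sInv q (uGen q x)) = match x with
      | .E => (qc q)⁻¹ ^ 2 • uE q
      | .F => qc q ^ 2 • uF q
      | .K => uK q
      | .Ki => uKi q := by
  rw [sInv_gen]
  cases x
  · rw [map_neg, map_smul, sInv_gen, smul_neg, neg_neg, smul_smul, ← sq]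
  · rw [map_neg, map_smul, sInv_gen, smul_neg, neg_neg, smul_smul, ← sq]
  · exact sInv_gen q .Ki
  · exact sInv_gen q .K

theorem rhoSpin_sInv_E : rhoSpin q n (op (sInv q (uE q))) = (qc q)⁻¹ • spinGen q n .E := by
  rw [sInv_gen, MulOpposite.op_neg, MulOpposite.op_smul, map_neg, map_smul, rhoSpin_E, smul_neg,
    neg_neg]

theorem rhoSpin_sInv_F : rhoSpin q n (op (sInv q (uF q))) = qc q • spinGen q n .F := by
  rw [sInv_gen, MulOpposite.op_neg, MulOpposite.op_smul, map_neg, map_smul, rhoSpin_F, smul_neg,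
    neg_neg]

theorem rhoSpin_sInv_K : rhoSpin q n (op (sInv q (uK q))) =
    Matrix.diagonal fun i : Fin (n + 1) => wt q n i := by
  rw [sInv_gen, rhoSpin_Ki]

theorem rhoSpin_sInv_Ki : rhoSpin q n (op (sInv q (uKi q))) =
    Matrix.diagonal fun i : Fin (n + 1) => (wt q n i)⁻¹ := by
  rw [sInv_gen, rhoSpin_K]

theorem adO_rhoSpin_E (X : Matrix (Fin (n + 1)) (Fin (n + 1)) (O q)) (i j : Fin (n + 1)) :
    adO (rhoSpin q n) X (uComul2 q (uE q)) i j =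
      (∑ k, ((wt q n j)⁻¹ * (qc q)⁻¹ * spinGen q n .E i k) • actK q (X k j)) +
        (((wt q n i)⁻¹ * (wt q n j)⁻¹ * (qc q)⁻¹ ^ 2) • actE q (X i j) -
          ∑ k, ((wt q n i)⁻¹ * spinGen q n .E k j) • actKi q (X i k)) := by
  rw [uComul2_gen, map_add, map_add, adO_tmul, adO_tmul, adO_tmul, rhoSpin_sInv_E,
    rhoSpin_sInv_Ki, rhoSpin_E, rhoSpin_K, sInv_sInv_gen, sInv_sInv_gen, sInv_sInv_gen,
    scalarMat_diagonal, scalarMat_neg, scalarMat_smul, map_smul]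
  simp only [Matrix.add_apply, Matrix.smul_mul, Matrix.mul_neg, Matrix.neg_apply,
    Matrix.smul_apply, Matrix.mul_diagonal, Matrix.diagonal_mul, Matrix.map_apply,
    ← Matrix.mul_assoc, LinearMap.smul_apply, act_E]
  simp only [Matrix.mul_apply, scalarMat_apply, Matrix.map_apply, Matrix.diagonal_apply, act_K,
    act_Ki, ← Algebra.commutes, ← Algebra.smul_def, Finset.smul_sum, smul_smul, mul_assoc,
    sub_eq_add_neg, ite_mul, zero_mul, Finset.sum_ite_eq, Finset.mem_univ, if_true]
  simp only [mul_comm, mul_left_comm, mul_assoc]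

theorem adO_rhoSpin_F (X : Matrix (Fin (n + 1)) (Fin (n + 1)) (O q)) (i j : Fin (n + 1)) :
    adO (rhoSpin q n) X (uComul2 q (uF q)) i j =
      (∑ k, ((wt q n j)⁻¹ * qc q * spinGen q n .F i k) • actK q (X k j)) +
        (((wt q n i)⁻¹ * (wt q n j)⁻¹ * qc q ^ 2) • actF q (X i j) -
          ∑ k, ((wt q n i)⁻¹ * spinGen q n .F k j) • actKi q (X i k)) := by
  rw [uComul2_gen, map_add, map_add, adO_tmul, adO_tmul, adO_tmul, rhoSpin_sInv_F,
    rhoSpin_sInv_Ki, rhoSpin_F, rhoSpin_K, sInv_sInv_gen, sInv_sInv_gen, sInv_sInv_gen,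
    scalarMat_diagonal, scalarMat_neg, scalarMat_smul, map_smul]
  simp only [Matrix.add_apply, Matrix.smul_mul, Matrix.mul_neg, Matrix.neg_apply,
    Matrix.smul_apply, Matrix.mul_diagonal, Matrix.diagonal_mul, Matrix.map_apply,
    ← Matrix.mul_assoc, LinearMap.smul_apply, act_F]
  simp only [Matrix.mul_apply, scalarMat_apply, Matrix.map_apply, Matrix.diagonal_apply, act_K,
    act_Ki, ← Algebra.commutes, ← Algebra.smul_def, Finset.smul_sum, smul_smul, mul_assoc,
    sub_eq_add_neg, ite_mul, zero_mul, Finset.sum_ite_eq, Finset.mem_univ, if_true]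
  simp only [mul_comm, mul_left_comm, mul_assoc]

theorem adO_rhoSpin_K (X : Matrix (Fin (n + 1)) (Fin (n + 1)) (O q)) (i j : Fin (n + 1)) :
    adO (rhoSpin q n) X (uComul2 q (uK q)) i j =
      (wt q n i * (wt q n j)⁻¹) • actK q (X i j) := by
  rw [uComul2_gen, adO_tmul, rhoSpin_sInv_K, rhoSpin_K, sInv_sInv_gen, scalarMat_diagonal,
    scalarMat_diagonal, Matrix.diagonal_mul, Matrix.mul_diagonal, Matrix.map_apply, act_K,
    ← Algebra.commutes, ← Algebra.smul_def, ← Algebra.smul_def, smul_smul]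

theorem adO_rhoSpin_Ki (X : Matrix (Fin (n + 1)) (Fin (n + 1)) (O q)) (i j : Fin (n + 1)) :
    adO (rhoSpin q n) X (uComul2 q (uKi q)) i j =
      ((wt q n i)⁻¹ * wt q n j) • actKi q (X i j) := by
  rw [uComul2_gen, adO_tmul, rhoSpin_sInv_Ki, rhoSpin_Ki, sInv_sInv_gen, scalarMat_diagonal,
    scalarMat_diagonal, Matrix.diagonal_mul, Matrix.mul_diagonal, Matrix.map_apply, act_Ki,
    ← Algebra.commutes, ← Algebra.smul_def, ← Algebra.smul_def, smul_smul]

end Action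

open IsSpinRow in
-- The column and the row transform by mutually dual representations. In the twisted Leibniz rule
-- each of the two terms cancels against one of the matrix multiplications by `ρ°`, once weights are
-- compared by `E`, `F` changing them by one step.
theorem adO_rhoSpin_col_row {q : QParam} {κ : ℂ} {n : ℕ} {m : Fin (n + 1)}
    {t : Fin (n + 1) → O q} (h : IsSpinRow q κ m t) (x : UGen) :
    adO (rhoSpin q n) (Matrix.of fun i j => col t i * row t j) (uComul2 q (uGen q x)) =
      uCounit q (uGen q x) • Matrix.of fun i j => col t i * row t j := by
  have hq := qc_ne_zero q
  have hw := wt_ne_zero q n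
  ext i j
  rw [uCounit_gen]
  cases x
  · simp only [adO_rhoSpin_E, Matrix.of_apply, map_mul, actE_mul, h.K_row, h.Ki_row, h.K_col,
      h.Ki_col, h.E_row, h.E_col, Finset.sum_mul, Finset.mul_sum, Finset.smul_sum, smul_add,
      smul_mul_assoc, mul_smul_comm, smul_smul, zero_smul, Matrix.zero_apply]
    have e1 : ∀ k : Fin (n + 1), (wt q n i)⁻¹ * (wt q n j)⁻¹ * (qc q)⁻¹ ^ 2 *
        (wt q n j * -(qc q ^ 2 * spinGen q n .E i k)) =
        -((wt q n j)⁻¹ * (qc q)⁻¹ * spinGen q n .E i k * (wt q n j * (wt q n k)⁻¹)) := by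
      intro k
      have h1 := spinGen_E_mul_wt q n i k
      have h2 := hw i
      have h3 := hw j
      have h4 := hw k
      field_simp
      linear_combination h1
    have e2 : ∀ k : Fin (n + 1), (wt q n i)⁻¹ * (wt q n j)⁻¹ * (qc q)⁻¹ ^ 2 *
        (qc q * spinGen q n .E k j * wt q n i) =
        (wt q n i)⁻¹ * spinGen q n .E k j * ((wt q n k)⁻¹ * wt q n i) := by
      intro k
      have h1 := spinGen_E_mul_wt q n k j
      have h2 := hw i
      have h3 := hw j
      have h4 := hw k
      field_simp
      linear_combination h1
    simp only [e1, e2, neg_smul, Finset.sum_neg_distrib]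
    abel
  · simp only [adO_rhoSpin_F, Matrix.of_apply, map_mul, actF_mul, h.K_row, h.Ki_row, h.K_col,
      h.Ki_col, h.F_row, h.F_col, Finset.sum_mul, Finset.mul_sum, Finset.smul_sum, smul_add,
      smul_mul_assoc, mul_smul_comm, smul_smul, zero_smul, Matrix.zero_apply]
    have e1 : ∀ k : Fin (n + 1), (wt q n i)⁻¹ * (wt q n j)⁻¹ * qc q ^ 2 *
        (wt q n j * -((qc q)⁻¹ ^ 2 * spinGen q n .F i k)) =
        -((wt q n j)⁻¹ * qc q * spinGen q n .F i k * (wt q n j * (wt q n k)⁻¹)) := by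
      intro k
      have h1 := spinGen_F_mul_wt q n i k
      have h2 := hw i
      have h3 := hw j
      have h4 := hw k
      field_simp
      linear_combination -h1
    have e2 : ∀ k : Fin (n + 1), (wt q n i)⁻¹ * (wt q n j)⁻¹ * qc q ^ 2 *
        ((qc q)⁻¹ * spinGen q n .F k j * wt q n i) =
        (wt q n i)⁻¹ * spinGen q n .F k j * ((wt q n k)⁻¹ * wt q n i) := by
      intro k
      have h1 := spinGen_F_mul_wt q n k j
      have h2 := hw i
      have h3 := hw j
      have h4 := hw k
      field_simp
      linear_combination -h1
    simp only [e1, e2, neg_smul, Finset.sum_neg_distrib]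
    abel
  · rw [adO_rhoSpin_K, Matrix.of_apply, map_mul, h.K_row, h.K_col, smul_mul_smul_comm, smul_smul,
      one_smul, Matrix.of_apply]
    have h2 := hw i
    have h3 := hw j
    rw [show wt q n i * (wt q n j)⁻¹ * ((wt q n i)⁻¹ * wt q n j) = 1 by field_simp, one_smul]
  · rw [adO_rhoSpin_Ki, Matrix.of_apply, map_mul, h.Ki_row, h.Ki_col, smul_mul_smul_comm,
      smul_smul, one_smul, Matrix.of_apply]
    have h2 := hw i
    have h3 := hw j
    rw [show (wt q n i)⁻¹ * wt q n j * (wt q n i * (wt q n j)⁻¹) = 1 by field_simp, one_smul]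

theorem lineBundle_map_coe (q : QParam) (N : ℤ) :
    ((lineBundle q N).map fun x => (x : O q)) =
      Matrix.of fun i j => IsSpinRow.col (tRow q N) i * IsSpinRow.row (tRow q N) j := by
  ext i j
  exact coe_lineBundle q N i j

theorem isInvProj_lineBundle (q : QParam) (N : ℤ) :
    IsInvProj q (rhoSpin q N.natAbs) (lineBundle q N) := by
  obtain ⟨κ, h⟩ := isSpinRow_tRow q N
  refine ⟨rhoSpin_uStar q N.natAbs, ?_, ?_, fun f => ?_⟩
  · ext i j
    rw [Matrix.mul_apply, AddSubmonoidClass.coe_finsetSum]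
    simp only [MulMemClass.coe_mul, coe_lineBundle]
    rw [Finset.sum_congr rfl fun k _ => show _ = IsSpinRow.col (tRow q N) i *
      (IsSpinRow.row (tRow q N) k * IsSpinRow.col (tRow q N) k) * IsSpinRow.row (tRow q N) j by
      simp only [mul_assoc], ← Finset.sum_mul, ← Finset.mul_sum, h.sum_row_mul_col, mul_one]
  -- `K²` scales the `(j, i)` entry by the inverse squares of the weights of its two factors; this
  -- turns the ratio of weights in `P_{ji}` into that of `P_{ij}` after the star.
  · ext i j
    change oStar q ((thetaInv q (lineBundle q N j i) : S2 q) : O q) = _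
    rw [coe_thetaInv, coe_lineBundle, coe_lineBundle, map_mul, map_mul, h.K_col, h.K_row,
      map_smul, map_smul, h.K_col, h.K_row, smul_smul, smul_smul, smul_mul_smul_comm, oStar_smul, oStar_mul,
      IsSpinRow.col, IsSpinRow.row, IsSpinRow.col, IsSpinRow.row, oStar_smul, oStar_smul,
      oStar_oStar, smul_mul_smul_comm, smul_mul_smul_comm, smul_smul]
    simp only [map_mul, map_inv₀, conj_wt]
    congr 1
    have h1 := wt_ne_zero q N.natAbs i
    have h2 := wt_ne_zero q N.natAbs j
    field_simp
  · rw [adR_eq, lineBundle_map_coe]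
    exact adO_invariant_of_gen _ (adO_rhoSpin_col_row h) f


/-! ### The Hochschild cycle of an equivariant idempotent -/

section Cycle

variable {A : Type*} [Ring A] [Algebra ℂ A] (lam : A ≃ₐ[ℂ] A) {n : Type*} [Fintype n]

/-- On `1 ⊗ y` the boundary is symmetrization by the twisted flip, up to a term `1 ⊗ (product)`;
this is how half of an invariant chain gets bounded. -/
theorem hochB2_one_tmul (y : A ⊗[ℂ] A) :
    hochB2 lam (1 ⊗ₜ y) = y - 1 ⊗ₜ LinearMap.mul' ℂ A y + tau1 lam y := by
  induction y using TensorProduct.induction_on with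
  | zero => simp
  | tmul a b => simp [hochB2_tmul, tau1_tmul]
  | add x y hx hy =>
    rw [TensorProduct.tmul_add, map_add, hx, hy, map_add, TensorProduct.tmul_add, map_add]
    abel

variable {R : Matrix n n ℂ} {P : Matrix n n A}

/-- The flip puts the twist on one factor, and `R P = λ(P) R` passes `R` across to undo it. -/
theorem tau1_trace2 (hRP : scalarMat A R * P = P.map lam * scalarMat A R) :
    tau1 lam (trace2 (scalarMat A R * P) P) = trace2 (scalarMat A R * P) P := by
  have h2 : trace2 (P.map lam) (scalarMat A R * P) = trace2 (scalarMat A R * P) P := by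
    rw [trace2_scalar, hRP]
  conv_rhs => rw [← h2]
  simp only [trace2, map_sum, tau1_tmul]
  rw [Finset.sum_comm]
  rfl

/-- By idempotency and equivariance all three faces equal the same two-fold trace; with signs `+`,
`-`, `+` one copy remains. -/
theorem hochB2_quantumTrace (hP : P * P = P)
    (hRP : scalarMat A R * P = P.map lam * scalarMat A R) :
    hochB2 lam (quantumTrace R P) = trace2 (scalarMat A R * P) P := by
  rw [quantumTrace_eq, hochB2_trace3, Matrix.mul_assoc, hP,
    ← Matrix.mul_assoc, ← hRP, Matrix.mul_assoc, hP, sub_self, zero_add]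

theorem mul_trace2 (hP : P * P = P) :
    LinearMap.mul' ℂ A (trace2 (scalarMat A R * P) P) = (scalarMat A R * P).trace := by
  conv_rhs => rw [← hP, ← Matrix.mul_assoc]
  simp only [trace2, map_sum, LinearMap.mul'_apply, Matrix.trace, Matrix.diag_apply,
    Matrix.mul_apply (M := scalarMat A R * P)]

/-- The correction of `2 Tr(P ⊗ P ⊗ P)` to a Hochschild cycle. -/
def traceCycle (κ : ℂ) (R : Matrix n n ℂ) (P : Matrix n n A) : A ⊗[ℂ] (A ⊗[ℂ] A) :=
  (2 : ℂ) • quantumTrace R P - 1 ⊗ₜ (trace2 (scalarMat A R * P) P + κ • (1 ⊗ₜ 1))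

/-- Doubling the triple trace gives twice the two-fold trace, which is the boundary of `1 ⊗` that
trace up to `κ 1 ⊗ 1`. The leftover is the boundary `κ b₂(1 ⊗ 1 ⊗ 1)`; only here must the quantum
trace of `P` be scalar. -/
theorem hochB2_traceCycle {κ : ℂ} (hP : P * P = P)
    (hRP : scalarMat A R * P = P.map lam * scalarMat A R)
    (hκ : (scalarMat A R * P).trace = algebraMap ℂ A κ) :
    hochB2 lam (traceCycle κ R P) = 0 := by
  rw [traceCycle, map_sub, map_smul, hochB2_quantumTrace lam hP hRP, hochB2_one_tmul, map_add,
    map_add, tau1_trace2 lam hRP, mul_trace2 hP, hκ, map_smul, map_smul, tau1_tmul, map_one,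
    LinearMap.mul'_apply, mul_one, ← Algebra.algebraMap_eq_smul_one, TensorProduct.tmul_add,
    Algebra.algebraMap_eq_smul_one, TensorProduct.tmul_smul, two_smul]
  abel

end Cycle

/-! ### Evaluation of the normalized cocycle on the cycle. -/

section Value

variable {q : QParam} {χ : S2 q ⊗[ℂ] S2 q →ₗ[ℂ] ℂ}

theorem krahmer_one_tmul (h : IsNormalizing q χ) (y : S2 q ⊗[ℂ] S2 q) :
    krahmer q χ (1 ⊗ₜ y) = 0 := by
  induction y using TensorProduct.induction_on with
  | zero => simp
  | tmul a b => exact h a b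
  | add x y hx hy => rw [TensorProduct.tmul_add, map_add, hx, hy, add_zero]

theorem krahmer_traceCycle (h : IsNormalizing q χ) {n : Type*} [Fintype n] (κ : ℂ)
    (R : Matrix n n ℂ) (P : Matrix n n (S2 q)) :
    krahmer q χ (traceCycle κ R P) = 2 * krahmer q χ (quantumTrace R P) := by
  rw [traceCycle, map_sub, krahmer_one_tmul h, sub_zero, map_smul, smul_eq_mul]

/-- The normalized cocycle ignores the correction terms of the cycle, and the coboundary of `χ`
vanishes on the cycle. So `χ` disappears from the value, and `κ` too, since derivations kill `1`. -/
theorem two_mul_krahmer_quantumTrace (h : IsNormalizing q χ) {n : Type*} [Fintype n] {κ : ℂ}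
    {R : Matrix n n ℂ} {P : Matrix n n (S2 q)} (hP : P * P = P)
    (hRP : scalarMat (S2 q) R * P = P.map (thetaInv q) * scalarMat (S2 q) R)
    (hκ : (scalarMat (S2 q) R * P).trace = algebraMap ℂ (S2 q) κ) :
    2 * krahmer q χ (quantumTrace R P) =
      2 * varphi q (quantumTrace R P) -
        varphi q (1 ⊗ₜ trace2 (scalarMat (S2 q) R * P) P) := by
  rw [← krahmer_traceCycle h κ, krahmer, LinearMap.add_apply, LinearMap.comp_apply,
    hochB2_traceCycle _ hP hRP hκ, map_zero, add_zero, traceCycle, map_sub, map_smul,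
    TensorProduct.tmul_add, map_add, TensorProduct.tmul_smul, map_smul, varphi_eq, derE_one,
    zero_mul, mul_zero, mul_zero, smul_zero, add_zero, smul_eq_mul]

theorem varphi_quantumTrace_diagonal {n : Type*} [Fintype n] [DecidableEq n] (r : n → ℂ)
    (P : Matrix n n (S2 q)) :
    varphi q (quantumTrace (Matrix.diagonal r) P) = qc q *
      ∑ i, ∑ j, ∑ k, r i * (eps q (P i j) * (derE q (P j k) * derF q (P k i))) := by
  simp only [quantumTrace, map_sum, map_smul, varphi_eq, Matrix.diagonal_apply, smul_eq_mul,
    ite_mul, zero_mul, Finset.sum_ite_eq', Finset.mem_univ, if_true, Finset.mul_sum]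
  refine Finset.sum_congr rfl fun i _ => Finset.sum_congr rfl fun j _ =>
    Finset.sum_congr rfl fun k _ => ?_
  ring

theorem varphi_one_trace2_diagonal {n : Type*} [Fintype n] [DecidableEq n] (r : n → ℂ)
    (P : Matrix n n (S2 q)) :
    varphi q (1 ⊗ₜ trace2 (scalarMat (S2 q) (Matrix.diagonal r) * P) P) = qc q *
      ∑ i, ∑ j, r i * (derE q (P i j) * derF q (P j i)) := by
  rw [scalarMat, Matrix.diagonal_map (map_zero _)]
  simp only [trace2, TensorProduct.tmul_sum, map_sum, varphi_eq, Matrix.diagonal_mul, map_one,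
    one_mul, ← Algebra.smul_def, map_smul, smul_eq_mul, Finset.mul_sum, mul_assoc]

end Value

/-! ### The derivations at the counit on the projections of the line bundles -/

namespace IsSpinRow

variable {q : QParam} {κ : ℂ} {n : ℕ} {m : Fin (n + 1)} {t : Fin (n + 1) → O q}

theorem counit_col (h : IsSpinRow q κ m t) (i : Fin (n + 1)) :
    oCounit q (col t i) = if i = m then wt q n m else 0 := by
  rw [col, map_smul, oCounit_oStar, h.counit]
  split_ifs with h1
  · simp [h1]
  · simp

theorem counit_row (h : IsSpinRow q κ m t) (i : Fin (n + 1)) :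
    oCounit q (row t i) = if i = m then (wt q n m)⁻¹ else 0 := by
  rw [row, map_smul, h.counit]
  split_ifs with h1
  · simp [h1]
  · simp

theorem counit_E (h : IsSpinRow q κ m t) (i j : Fin (n + 1)) :
    oCounit q (actKi q (actE q (col t i * row t j))) =
      (if j = m then -(qc q ^ 2 * wt q n m * spinGen q n .E i m) else 0) +
        if i = m then qc q * wt q n m * spinGen q n .E m j else 0 := by
  have hw := wt_ne_zero q n m
  simp only [actE_mul, h.E_col, h.E_row, h.K_row, h.Ki_col, map_add, map_mul, map_sum, map_smul,
    h.Ki_row, h.counit_col, h.counit_row, smul_eq_mul, mul_ite, mul_zero, Finset.sum_ite_eq',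
    Finset.mem_univ, if_true, ite_mul, zero_mul]
  congr 1
  · split_ifs with h1
    · rw [h1]
      field_simp
    · rfl
  · split_ifs with h1
    · rw [h1]
      field_simp
    · rfl

theorem counit_F (h : IsSpinRow q κ m t) (i j : Fin (n + 1)) :
    oCounit q (actKi q (actF q (col t i * row t j))) =
      (if j = m then -((qc q)⁻¹ ^ 2 * wt q n m * spinGen q n .F i m) else 0) +
        if i = m then (qc q)⁻¹ * wt q n m * spinGen q n .F m j else 0 := by
  have hw := wt_ne_zero q n m
  simp only [actF_mul, h.F_col, h.F_row, h.K_row, h.Ki_col, map_add, map_mul, map_sum, map_smul,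
    h.Ki_row, h.counit_col, h.counit_row, smul_eq_mul, mul_ite, mul_zero, Finset.sum_ite_eq',
    Finset.mem_univ, if_true, ite_mul, zero_mul]
  congr 1
  · split_ifs with h1
    · rw [h1]
      field_simp
    · rfl
  · split_ifs with h1
    · rw [h1]
      field_simp
    · rfl

end IsSpinRow

theorem eps_lineBundle (q : QParam) (N : ℤ) (i j : Fin (N.natAbs + 1)) :
    eps q (lineBundle q N i j) = if i = rowIdx N ∧ j = rowIdx N then 1 else 0 := by
  obtain ⟨κ, h⟩ := isSpinRow_tRow q N
  rw [eps_apply, coe_lineBundle, map_mul, h.counit_col, h.counit_row]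
  by_cases h1 : i = rowIdx N <;> by_cases h2 : j = rowIdx N <;>
    simp [h1, h2, wt_ne_zero q N.natAbs]

theorem derE_lineBundle (q : QParam) (N : ℤ) (i j : Fin (N.natAbs + 1)) :
    derE q (lineBundle q N i j) =
      (if j = rowIdx N then
        -(qc q ^ 2 * wt q N.natAbs (rowIdx N) * spinGen q N.natAbs .E i (rowIdx N)) else 0) +
        if i = rowIdx N then
          qc q * wt q N.natAbs (rowIdx N) * spinGen q N.natAbs .E (rowIdx N) j else 0 := by
  obtain ⟨κ, h⟩ := isSpinRow_tRow q N
  rw [derE_apply, coe_lineBundle, h.counit_E]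

theorem derF_lineBundle (q : QParam) (N : ℤ) (i j : Fin (N.natAbs + 1)) :
    derF q (lineBundle q N i j) =
      (if j = rowIdx N then
        -((qc q)⁻¹ ^ 2 * wt q N.natAbs (rowIdx N) * spinGen q N.natAbs .F i (rowIdx N)) else 0) +
        if i = rowIdx N then
          (qc q)⁻¹ * wt q N.natAbs (rowIdx N) * spinGen q N.natAbs .F (rowIdx N) j else 0 := by
  obtain ⟨κ, h⟩ := isSpinRow_tRow q N
  rw [derF_apply, coe_lineBundle, h.counit_F]


/-! ### The pairing with the line bundles -/

theorem qInt_neg (q : QParam) (n : ℤ) : qInt q (-n) = -qInt q n := by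
  rw [qInt, qInt, neg_neg, ← neg_div, neg_sub]

theorem spin_EF_diag_eq_qInt (q : QParam) (n : ℕ) (i : Fin (n + 1)) :
    (spinGen q n .E * spinGen q n .F) i i - (spinGen q n .F * spinGen q n .E) i i =
      ((qInt q (2 * (i : ℤ) - n) : ℝ) : ℂ) := by
  have hw : wt q n i * wt q n i = qc q ^ (2 * (i : ℤ) - n) := by
    rw [wt, ← mul_zpow, qs_mul_qs]
  rw [spin_EF_diag, ← mul_inv, hw, qInt, div_eq_inv_mul, zpow_neg]
  push_cast [qc]
  rfl

theorem spinGen_E_last (q : QParam) (n : ℕ) (i : Fin (n + 1)) :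
    spinGen q n .E i (Fin.last n) = 0 := by
  rw [spinGen, Matrix.of_apply, Fin.val_last, if_neg (by omega)]

theorem spinGen_F_last (q : QParam) (n : ℕ) (i : Fin (n + 1)) :
    spinGen q n .F (Fin.last n) i = 0 := by
  rw [spinGen, Matrix.of_apply, Fin.val_last, if_neg (by omega)]

theorem spinGen_E_zero (q : QParam) (n : ℕ) (i : Fin (n + 1)) :
    spinGen q n .E 0 i = 0 := by
  rw [spinGen, Matrix.of_apply, Fin.val_zero, if_neg (by omega)]

theorem spinGen_F_zero (q : QParam) (n : ℕ) (i : Fin (n + 1)) :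
    spinGen q n .F i 0 = 0 := by
  rw [spinGen, Matrix.of_apply, Fin.val_zero, if_neg (by omega)]

/-- At the highest weight `E` vanishes, so `EF` alone carries the commutator `(K² - K⁻²)/(q - q⁻¹)`.
At the lowest weight the roles of `E` and `F` are exchanged. -/
theorem sum_spinGen_E_F_last (q : QParam) (n : ℕ) :
    ∑ k, spinGen q n .E (Fin.last n) k * spinGen q n .F k (Fin.last n) =
      ((qInt q n : ℝ) : ℂ) := by
  have h := spin_EF_diag_eq_qInt q n (Fin.last n)
  simp only [Matrix.mul_apply, spinGen_E_last, mul_zero, Finset.sum_const_zero, sub_zero,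
    Fin.val_last] at h
  rw [h]
  congr 2
  ring

theorem sum_spinGen_F_E_zero (q : QParam) (n : ℕ) :
    ∑ k, spinGen q n .F 0 k * spinGen q n .E k 0 = ((qInt q n : ℝ) : ℂ) := by
  have h := spin_EF_diag_eq_qInt q n 0
  simp only [Matrix.mul_apply, spinGen_F_zero, mul_zero, Finset.sum_const_zero, zero_sub,
    Fin.val_zero, Nat.cast_zero, qInt_neg] at h
  push_cast at h
  exact neg_inj.mp h

/-- The weights of `ρ°(K²)`. -/
def wtK2 (q : QParam) (n : ℕ) (i : Fin (n + 1)) : ℂ := (wt q n i)⁻¹ * (wt q n i)⁻¹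

theorem rowIdx_of_nonneg {N : ℤ} (hN : 0 ≤ N) : rowIdx N = Fin.last _ := if_pos hN

theorem rowIdx_of_neg {N : ℤ} (hN : ¬0 ≤ N) : rowIdx N = 0 := if_neg hN

/-- The extremal weight kills half of each derivative. For `N ≥ 0` only row `i = m` remains and its
weights cancel exactly; for `N < 0` only column `j = m` remains. -/
theorem sum_derE_derF (q : QParam) (N : ℤ) :
    ∑ i, ∑ j, wtK2 q N.natAbs i *
      (derE q (lineBundle q N i j) * derF q (lineBundle q N j i)) =
        -((qc q)⁻¹ * ((qInt q N.natAbs : ℝ) : ℂ)) := by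
  have hq := qc_ne_zero q
  have hw := wt_ne_zero q N.natAbs
  by_cases hN : 0 ≤ N
  · rw [← sum_spinGen_E_F_last, Finset.sum_eq_single (rowIdx N), Finset.mul_sum,
      ← Finset.sum_neg_distrib]
    · refine Finset.sum_congr rfl fun k _ => ?_
      simp only [derE_lineBundle, derF_lineBundle, rowIdx_of_nonneg hN, spinGen_E_last,
        spinGen_F_last, mul_zero, neg_zero, ite_self, zero_add, add_zero, if_true, wtK2]
      have h1 := hw (Fin.last N.natAbs)
      field_simp
    · intro i _ hi
      refine Finset.sum_eq_zero fun k _ => ?_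
      rw [derE_lineBundle, if_neg hi, rowIdx_of_nonneg hN, spinGen_E_last]
      simp
    · simp
  · rw [← sum_spinGen_F_E_zero, Finset.sum_comm, Finset.sum_eq_single (rowIdx N), Finset.mul_sum,
      ← Finset.sum_neg_distrib]
    · refine Finset.sum_congr rfl fun k _ => ?_
      simp only [derE_lineBundle, derF_lineBundle, rowIdx_of_neg hN, spinGen_E_zero,
        spinGen_F_zero, mul_zero, neg_zero, ite_self, zero_add, add_zero, if_true, wtK2]
      have h1 := hw k
      -- Here the weight of `ρ°(K²)` is taken one step above the lowest, which contributes the `q⁻²`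
      -- that compensates the `q²` in the derivative of the column.
      have h2 := spinGen_E_mul_wt q N.natAbs k 0
      field_simp
      linear_combination spinGen q N.natAbs .F 0 k *
        (wt q N.natAbs k + qc q * wt q N.natAbs (0 : Fin (N.natAbs + 1))) * h2
    · intro i _ hi
      refine Finset.sum_eq_zero fun k _ => ?_
      rw [derF_lineBundle, if_neg hi, rowIdx_of_neg hN, spinGen_F_zero]
      simp
    · simp

/-- The counit forces `i = j = m`. At the lowest weight row `m` of `E` is zero, hence no
contribution for `N < 0`; this asymmetry is the source of the sign of `[N]`. -/
theorem sum_eps_derE_derF (q : QParam) (N : ℤ) :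
    ∑ i, ∑ j, ∑ k, wtK2 q N.natAbs i * (eps q (lineBundle q N i j) *
      (derE q (lineBundle q N j k) * derF q (lineBundle q N k i))) =
        if 0 ≤ N then -((qc q)⁻¹ * ((qInt q N.natAbs : ℝ) : ℂ)) else 0 := by
  have hq := qc_ne_zero q
  have hw := wt_ne_zero q N.natAbs
  rw [Finset.sum_eq_single (rowIdx N), Finset.sum_eq_single (rowIdx N)]
  · split_ifs with hN
    · rw [← sum_spinGen_E_F_last, Finset.mul_sum, ← Finset.sum_neg_distrib]
      refine Finset.sum_congr rfl fun k _ => ?_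
      simp only [eps_lineBundle, derE_lineBundle, derF_lineBundle, rowIdx_of_nonneg hN,
        spinGen_E_last, spinGen_F_last, mul_zero, neg_zero, ite_self, zero_add, add_zero,
        if_true, wtK2, and_self, one_mul]
      have h1 := hw (Fin.last N.natAbs)
      field_simp
    · refine Finset.sum_eq_zero fun k _ => ?_
      simp only [derE_lineBundle, rowIdx_of_neg hN, spinGen_E_zero, mul_zero, neg_zero, ite_self,
        zero_add, zero_mul]
  · intro j _ hj
    refine Finset.sum_eq_zero fun k _ => ?_
    rw [eps_lineBundle, if_neg (fun h => hj h.2), zero_mul, mul_zero]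
  · simp
  · intro i _ hi
    refine Finset.sum_eq_zero fun j _ => Finset.sum_eq_zero fun k _ => ?_
    rw [eps_lineBundle, if_neg (fun h => hi h.1), zero_mul, mul_zero]
  · simp

theorem rhoSpin_uK_uK (q : QParam) (n : ℕ) :
    rhoSpin q n (op (uK q * uK q)) = Matrix.diagonal (wtK2 q n) := rhoSpin_K2 q n

/-- The weights of the column and the row cancel on the diagonal, and the weighted orthogonality
relation of the row is precisely the quantum trace. -/
theorem trace_lineBundle (q : QParam) (N : ℤ) : ∃ κ : ℂ,
    (scalarMat (S2 q) (Matrix.diagonal (wtK2 q N.natAbs)) * lineBundle q N).trace =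
      algebraMap ℂ (S2 q) κ := by
  obtain ⟨κ, h⟩ := isSpinRow_tRow q N
  refine ⟨κ, s2_ext ?_⟩
  rw [scalarMat, Matrix.diagonal_map (map_zero _), Matrix.trace,
    AddSubmonoidClass.coe_finsetSum]
  refine Eq.trans ?_ (h.trace.trans (Algebra.algebraMap_eq_smul_one κ).symm)
  refine Finset.sum_congr rfl fun i _ => ?_
  rw [Matrix.diag_apply, Matrix.diagonal_mul, ← Algebra.smul_def, SetLike.val_smul,
    coe_lineBundle, IsSpinRow.col, IsSpinRow.row, smul_mul_smul_comm,
    mul_inv_cancel₀ (wt_ne_zero q N.natAbs i), one_smul, wtK2]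

theorem scalarMat_mul_lineBundle (q : QParam) (N : ℤ) :
    scalarMat (S2 q) (Matrix.diagonal (wtK2 q N.natAbs)) * lineBundle q N =
      (lineBundle q N).map (thetaInv q) *
        scalarMat (S2 q) (Matrix.diagonal (wtK2 q N.natAbs)) := by
  rw [← rhoSpin_uK_uK]
  -- Invariance under the group-like element `K²` is the required commutation relation between `R`
  -- and `P`.
  exact InvProj.R_P ⟨N.natAbs + 1, rhoSpin q N.natAbs, lineBundle q N, isInvProj_lineBundle q N⟩

theorem krahmer_lineBundle {q : QParam} {χ : S2 q ⊗[ℂ] S2 q →ₗ[ℂ] ℂ} (h : IsNormalizing q χ)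
    (N : ℤ) :
    -2 * krahmer q χ (quantumTrace (Matrix.diagonal (wtK2 q N.natAbs)) (lineBundle q N)) =
      ((qInt q N : ℝ) : ℂ) := by
  have hq := qc_ne_zero q
  obtain ⟨κ, hκ⟩ := trace_lineBundle q N
  rw [neg_mul, two_mul_krahmer_quantumTrace h (isInvProj_lineBundle q N).idem
    (scalarMat_mul_lineBundle q N) hκ, varphi_quantumTrace_diagonal, varphi_one_trace2_diagonal,
    sum_derE_derF, sum_eps_derE_derF]
  -- With `n = |N|` the value is `-(2 · (-[n]) + [n]) = [n]` for `N ≥ 0` and `-(0 + [n]) = -[n]` for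
  -- `N < 0`.
  split_ifs with hN
  · rw [Int.natAbs_of_nonneg hN]
    field_simp
    ring
  · rw [Int.ofNat_natAbs_of_nonpos (by omega), qInt_neg]
    push_cast
    field_simp
    ring

/-- The cycle built from `P_1` detects the class: the pairing is minus the value of the cocycle on
it, and `[1] = 1`. -/
theorem nontrivialOnHH2_krahmer {q : QParam} {χ : S2 q ⊗[ℂ] S2 q →ₗ[ℂ] ℂ}
    (h : IsNormalizing q χ) : NontrivialOnHH2 (thetaInv q) (krahmer q χ) := by
  obtain ⟨κ, hκ⟩ := trace_lineBundle q 1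
  refine nontrivialOnHH2_of_cycle (thetaInv q) (krahmer_mem_cyclicCocycles2 h)
    (hochB2_traceCycle (thetaInv q) (isInvProj_lineBundle q 1).idem
      (scalarMat_mul_lineBundle q 1) hκ) ?_
  have h1 := krahmer_lineBundle h 1
  rw [neg_mul, ← krahmer_traceCycle h κ, qInt_one] at h1
  intro h2
  rw [h2] at h1
  norm_num at h1

end
end Podles

/-! ### The proposition. -/

theorem mainTheorem5 (q : Podles.QParam) :
    (∃ χ : Podles.S2 q ⊗[ℂ] Podles.S2 q →ₗ[ℂ] ℂ, Podles.IsNormalizing q χ) ∧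
    ∀ χ : Podles.S2 q ⊗[ℂ] Podles.S2 q →ₗ[ℂ] ℂ, Podles.IsNormalizing q χ →
      ∃ hφ : Podles.krahmer q χ ∈ Podles.cyclicCocycles2 (Podles.thetaInv q),
        Podles.NontrivialOnHH2 (Podles.thetaInv q) (Podles.krahmer q χ) ∧
        ∀ N : ℤ, ∃ hP : Podles.IsInvProj q (Podles.rhoSpin q N.natAbs) (Podles.lineBundle q N),
          Podles.pairing (Podles.HC2.mk (Podles.thetaInv q) (Podles.krahmer q χ) hφ)
            (Podles.K0.mk ⟨N.natAbs + 1, Podles.rhoSpin q N.natAbs, Podles.lineBundle q N, hP⟩) =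
          ((Podles.qInt q N : ℝ) : ℂ) := by
  refine ⟨Podles.exists_isNormalizing q, fun χ h => ⟨Podles.krahmer_mem_cyclicCocycles2 h,
    Podles.nontrivialOnHH2_krahmer h, fun N => ⟨Podles.isInvProj_lineBundle q N, ?_⟩⟩⟩
  rw [Podles.pairing_mk_mk, Podles.rhoSpin_uK_uK]
  exact Podles.krahmer_lineBundle h N
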